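/- Let $n\ge 1$, $\nu=\lfloor n/2\rfloor$, and let $\lambda=(\lambda_1\ge\cdots\ge\lambda_\nu\ge 0)$ be real numbers. Let $n(\lambda)$ be the number of nonzero $\lambda_i$, and for $1\le i\le\nu$ let $e(i)$ be the largest $k$ with $\lambda_k=\lambda_i$. **Polytope.** The Gelfand–Cetlin polytope $\Delta_\lambda^{(n)}$ of $\mathrm{SO}(n)$ is the set of real tuples $(u_{i,j})$, indexed by $1\le i\le j$, $i+j\le n$, such that $u_{i,n-i}=\lambda_i$ for $1\le i\le\nu$, $u_{i,j+1}\ge v_{i,j}$, and $u_{i,j}\ge v_{i+1,j}$ (whenever both indices are allowed), where $v_{i,j}=u_{i,j}$ for $i\neq j$ and $v_{i,i}=|u_{i,i}|$. (Coordinates that are constant on the polytope are kept.) Its faces are the non-empty sets of maximizers on $\Delta_\lambda^{(n)}$ of linear functionals, ordered by inclusion; $\dim$ is the dimension of the affine span. **Ladder diagram.** $\Gamma_\lambda^{(n)}$ is the subgraph of the square grid on $\mathbb Z^2$ induced on $$\bigcup_{j=0}^{n(\lambda)-1}\{(a,b)\in\mathbb Z^2 : j\le a\le j+1,\ j\le b\le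 n-1-e(j+1)\}.$$ Its terminal vertices are those farthest from $(0,0)$ in the taxicab metric. A positive path is a shortest path in $\Gamma_\lambda^{(n)}$ from $(0,0)$ to a terminal vertex. Let $\square^{(i,j)}$ be the unit square with top-right vertex $(i,j)$. An *isogram* is a subgraph $\gamma$ of $\Gamma_\lambda^{(n)}$ that is a union of positive paths, contains all terminal vertices, and has the property that whenever it contains the top and left edges of a box $\square^{(j,j)}$, it also contains the bottom and right edges of that box. Its dimension $\dim\gamma$ is the number of bounded regions into which $\gamma$ cuts the plane (the number of minimal cycles of $\gamma$). For $0\le j<n(\lambda)$ let $y_j(\gamma)$ be the height of the lowest horizontal segment of $\gamma$ over $[j,j+1]$. For each $0\le j<n(\lambda)$ choose a set of horizontal segments over $[j,j+1]$ as follows: if $y_j(\gamma)>j+1$, the segment at height $y_j(\gamma)$; if $\gamma$ contains all four edges of $\square^{(j+1,j+1)}$, its two horizontal edges; otherwise, either the segment at height $j$ or the one at height $j+1$. The corresponding *coastline* is the union $\delta$ of all positive paths whose horizontal edges are chosen segments; a choice is admissible only if $\delta$ contains all the chosen segments. Write $\delta_j$ for the set of horizontal segments of $\delta$ over $[j,j+1]$.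 A *face* of $\Gamma_\lambda^{(n)}$ is a pair $(\gamma,\delta)$ of an isogram $\gamma$ and a coastline $\delta$ of $\gamma$. Put $(\gamma',\delta')\le(\gamma,\delta)$ if $\gamma'\subseteq\gamma$ and $\delta'_j\subseteq\delta_j$ for every $0\le j<n(\lambda)$ with $y_j(\gamma')<j+1$. **Theorem.** There is a bijection $\Psi$ from the set of faces of $\Gamma_\lambda^{(n)}$ to the set of faces of $\Delta_\lambda^{(n)}$ such that, for all faces $(\gamma,\delta)$ and $(\gamma',\delta')$ of $\Gamma_\lambda^{(n)}$, $$(\gamma,\delta)\le(\gamma',\delta')\iff\Psi(\gamma,\delta)\subseteq\Psi(\gamma',\delta'),\qquad \dim\Psi(\gamma,\delta)=\dim\gamma .$$ -/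

import Mathlib

namespace GelfandCetlin

/-! ### The ladder diagram

Throughout, `lam : Fin (n / 2) → ℝ` is the tuple `(λ₁, …, λ_ν)` with `ν = ⌊n/2⌋`, so that `lam i` is
`λ_{i+1}`. Grid vertices are elements of `ℤ × ℤ`, and the unit square `□^{(i,j)}` is named by its
top-right vertex `(i, j)`. -/

/-- The square grid graph on `ℤ²`: vertices are adjacent when their taxicab distance is one. -/
def squareGrid : SimpleGraph (ℤ × ℤ) where
  Adj p q := |p.1 - q.1| + |p.2 - q.2| = 1
  symm := ⟨fun p q h => by rw [abs_sub_comm q.1, abs_sub_comm q.2]; exact h⟩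
  loopless := ⟨fun p h => by simp at h⟩

/-- The (one-based) position of the last entry of the block of equal entries containing `lam i`, for
weakly decreasing `lam`. -/
noncomputable def blockEnd (n : ℕ) (lam : Fin (n / 2) → ℝ) (i : Fin (n / 2)) : ℕ :=
  Nat.card {k : Fin (n / 2) // lam i ≤ lam k}

/-- The number `n(λ)` of nonzero entries. -/
noncomputable def numNonzero (n : ℕ) (lam : Fin (n / 2) → ℝ) : ℕ :=
  Nat.card {k : Fin (n / 2) // lam k ≠ 0}

/-- The vertex set of the ladder diagram. -/
def ladderVertices (n : ℕ) (lam : Fin (n / 2) → ℝ) : Set (ℤ × ℤ) :=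
  {p | ∃ j : Fin (n / 2), (j : ℕ) < numNonzero n lam ∧
    ((j : ℕ) : ℤ) ≤ p.1 ∧ p.1 ≤ ((j : ℕ) : ℤ) + 1 ∧
    ((j : ℕ) : ℤ) ≤ p.2 ∧ p.2 ≤ (n : ℤ) - 1 - (blockEnd n lam j : ℤ)}

/-- The ladder diagram: the subgraph of the square grid induced on `ladderVertices` (the points of
`ℤ × ℤ` outside `ladderVertices` are isolated and play no role). -/
def ladder (n : ℕ) (lam : Fin (n / 2) → ℝ) : SimpleGraph (ℤ × ℤ) where
  Adj p q := squareGrid.Adj p q ∧ p ∈ ladderVertices n lam ∧ q ∈ ladderVertices n lam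
  symm := ⟨fun _ _ h => ⟨h.1.symm, h.2.2, h.2.1⟩⟩
  loopless := ⟨fun _ h => h.1.ne rfl⟩

/-- Terminal vertices: the vertices of the ladder diagram farthest from the origin in the taxicab
metric. -/
def IsTerminal (n : ℕ) (lam : Fin (n / 2) → ℝ) (t : ℤ × ℤ) : Prop :=
  t ∈ ladderVertices n lam ∧ ∀ p ∈ ladderVertices n lam, |p.1| + |p.2| ≤ |t.1| + |t.2|

/-- Positive paths: shortest paths in the ladder diagram from the origin to a terminal vertex. -/
def IsPositivePath (n : ℕ) (lam : Fin (n / 2) → ℝ) (P : (ladder n lam).Subgraph) : Prop :=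
  ∃ t, IsTerminal n lam t ∧ ∃ w : (ladder n lam).Walk (0, 0) t,
    w.length = (ladder n lam).dist (0, 0) t ∧ P = w.toSubgraph

/-! ### Isograms -/

section Box

variable {G : SimpleGraph (ℤ × ℤ)} (γ : G.Subgraph) (i j : ℤ)

/-- The top edge of the box `□^{(i,j)}` belongs to `γ`. -/
def HasTop : Prop := γ.Adj (i - 1, j) (i, j)

/-- The bottom edge of the box `□^{(i,j)}` belongs to `γ`. -/
def HasBottom : Prop := γ.Adj (i - 1, j - 1) (i, j - 1)

/-- The left edge of the box `□^{(i,j)}` belongs to `γ`. -/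
def HasLeft : Prop := γ.Adj (i - 1, j - 1) (i - 1, j)

/-- The right edge of the box `□^{(i,j)}` belongs to `γ`. -/
def HasRight : Prop := γ.Adj (i, j - 1) (i, j)

end Box

/-- Isograms: unions of positive paths that contain all terminal vertices and that, whenever they
contain the top and left edges of a diagonal box, contain its bottom and right edges too. -/
def IsIsogram (n : ℕ) (lam : Fin (n / 2) → ℝ) (γ : (ladder n lam).Subgraph) : Prop :=
  (∃ S : Set (ladder n lam).Subgraph, (∀ P ∈ S, IsPositivePath n lam P) ∧ γ = sSup S) ∧
  (∀ t, IsTerminal n lam t → t ∈ γ.verts) ∧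
  ∀ j : ℤ, HasTop γ j j → HasLeft γ j j → HasBottom γ j j ∧ HasRight γ j j

/-- The graph of boxes of the plane, two boxes being adjacent when they share an edge that is not an
edge of `γ`. Its connected components are the regions into which `γ` cuts the plane. -/
def boxGraph {G : SimpleGraph (ℤ × ℤ)} (γ : G.Subgraph) : SimpleGraph (ℤ × ℤ) :=
  SimpleGraph.fromRel fun s t =>
    (t = (s.1, s.2 + 1) ∧ ¬ HasTop γ s.1 s.2) ∨ (t = (s.1 + 1, s.2) ∧ ¬ HasRight γ s.1 s.2)

/-- The dimension of `γ`: the number of bounded regions cut out by `γ`, that is, the number of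
minimal cycles of `γ`. -/
noncomputable def regionCount {G : SimpleGraph (ℤ × ℤ)} (γ : G.Subgraph) : ℕ :=
  Nat.card {c : (boxGraph γ).ConnectedComponent // c.supp.Finite}

/-! ### Coastlines and faces of the ladder diagram -/

/-- The set of heights of the horizontal segments of `γ` over `[j, j+1]`. -/
def heights {G : SimpleGraph (ℤ × ℤ)} (γ : G.Subgraph) (j : ℤ) : Set ℤ :=
  {y | γ.Adj (j, y) (j + 1, y)}

/-- The height of the lowest horizontal segment `β_j(γ)` of `γ` over `[j, j+1]`; used only for
isograms `γ` and `0 ≤ j < n(λ)`, where the set of heights is finite and non-empty. -/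
noncomputable def baseHeight {G : SimpleGraph (ℤ × ℤ)} (γ : G.Subgraph) (j : ℤ) : ℤ :=
  sInf (heights γ j)

/-- `γ` contains all four edges of the diagonal box `□^{(j,j)}`. -/
def HasFullBox {G : SimpleGraph (ℤ × ℤ)} (γ : G.Subgraph) (j : ℤ) : Prop :=
  HasTop γ j j ∧ HasLeft γ j j ∧ HasBottom γ j j ∧ HasRight γ j j

/-- The rule for the choice of the segments `δ_j(γ)`, `0 ≤ j < n(λ)`. Here `d j` is the set of
heights of the chosen segments over `[j, j+1]`. -/
def IsSegmentChoice (n : ℕ) (lam : Fin (n / 2) → ℝ) (γ : (ladder n lam).Subgraph)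
    (d : ℤ → Set ℤ) : Prop :=
  ∀ j : ℤ, 0 ≤ j → j < numNonzero n lam →
    (j + 1 < baseHeight γ j → d j = {baseHeight γ j}) ∧
    (HasFullBox γ (j + 1) → d j = {baseHeight γ j, baseHeight γ j + 1}) ∧
    (baseHeight γ j ≤ j + 1 → ¬ HasFullBox γ (j + 1) → d j = {j} ∨ d j = {j + 1})

/-- `δ` is a coastline of `γ`: for an admissible choice of the segments `δ_j(γ)`, it is the union of
all positive paths whose horizontal edges are chosen segments, and it contains all chosen
segments. -/
def IsCoastline (n : ℕ) (lam : Fin (n / 2) → ℝ) (γ δ : (ladder n lam).Subgraph) : Prop :=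
  ∃ d : ℤ → Set ℤ, IsSegmentChoice n lam γ d ∧
    δ = sSup {P | IsPositivePath n lam P ∧ ∀ j, heights P j ⊆ d j} ∧
    ∀ j : ℤ, 0 ≤ j → j < numNonzero n lam → d j ⊆ heights δ j

/-- Faces of the ladder diagram: an isogram together with one of its coastlines. -/
structure DiagramFace (n : ℕ) (lam : Fin (n / 2) → ℝ) where
  isogram : (ladder n lam).Subgraph
  coastline : (ladder n lam).Subgraph
  isIsogram : IsIsogram n lam isogram
  isCoastline : IsCoastline n lam isogram coastline

/-- The order on faces of the ladder diagram. The horizontal segments of the coastline over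
`[j, j+1]` are compared for those `j` for which the base of the smaller isogram runs below the box
`□^{(j+1,j+1)}`. -/
instance (n : ℕ) (lam : Fin (n / 2) → ℝ) : LE (DiagramFace n lam) where
  le F G := F.isogram ≤ G.isogram ∧
    ∀ j : ℤ, 0 ≤ j → j < numNonzero n lam → baseHeight F.isogram j < j + 1 →
      heights F.coastline j ⊆ heights G.coastline j

/-- The dimension of a face of the ladder diagram. -/
noncomputable def DiagramFace.dim {n : ℕ} {lam : Fin (n / 2) → ℝ} (F : DiagramFace n lam) : ℕ :=
  regionCount F.isogram

/-! ### The Gelfand-Cetlin polytope and its faces -/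

/-- The indices `(i, j)` of the coordinates `u_{i,j}`: `1 ≤ i ≤ j` and `i + j ≤ n`. -/
abbrev GCIndex (n : ℕ) : Type := {p : ℕ × ℕ // 1 ≤ p.1 ∧ p.1 ≤ p.2 ∧ p.1 + p.2 ≤ n}

/-- `|u_{i,j}|` if `i = j`, and `u_{i,j}` otherwise. -/
noncomputable def diagAbs {n : ℕ} (u : GCIndex n → ℝ) (p : GCIndex n) : ℝ :=
  if p.1.1 = p.1.2 then |u p| else u p

/-- The Gelfand-Cetlin polytope of `SO(n)` and `λ`: with `u_{i,n-i} = λ_i`, it is defined by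
`u_{i,j+1} ≥ u_{i,j}` and `u_{i,j} ≥ u_{i+1,j}`, the coordinate on the right-hand side being replaced
by its absolute value if it is a diagonal one. -/
def gcPolytope (n : ℕ) (lam : Fin (n / 2) → ℝ) : Set (GCIndex n → ℝ) :=
  {u | (∀ (k : Fin (n / 2)) (p : GCIndex n), p.1.1 = k + 1 → p.1.1 + p.1.2 = n → u p = lam k) ∧
    (∀ p q : GCIndex n, q.1.1 = p.1.1 → q.1.2 = p.1.2 + 1 → diagAbs u p ≤ u q) ∧
    (∀ p q : GCIndex n, q.1.1 = p.1.1 + 1 → q.1.2 = p.1.2 → diagAbs u q ≤ u p)}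

/-- The (non-empty) faces of the Gelfand-Cetlin polytope: the sets of maximizers of linear
functionals. The polytope itself is one of them. They are ordered by inclusion. -/
def PolytopeFace (n : ℕ) (lam : Fin (n / 2) → ℝ) : Type :=
  {f : Set (GCIndex n → ℝ) // IsExposed ℝ (gcPolytope n lam) f ∧ f.Nonempty}

instance (n : ℕ) (lam : Fin (n / 2) → ℝ) : LE (PolytopeFace n lam) where
  le f g := f.1 ⊆ g.1

/-- The dimension of a face of the polytope: the dimension of its affine span. -/
noncomputable def PolytopeFace.dim {n : ℕ} {lam : Fin (n / 2) → ℝ} (f : PolytopeFace n lam) : ℕ :=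
  Module.finrank ℝ (vectorSpan ℝ f.1)

end GelfandCetlin

/-!
The proof compares both posets with the *fillings* of the plane: functions on the unit squares that
decrease to the right, increase upwards, are `0` below the diagonal and equal to the `λ_i` on and above
the antidiagonal. A point `u` of the polytope is the same thing as a filling, namely `|u|` (`absFill`),
together with signs of the diagonal coordinates (`IsFilling.isPoint_signed`).

*Isograms are contours.* The edges that separate boxes with different values of a filling form its
contour. The boundary of each superlevel set of a filling is a positive path, so the contour is a union
of positive paths (`IsFilling.exists_contour`). Conversely, a choice of one positive path to each
terminal vertex gives a filling, whose step across the path ending at `(a, n - 1 - a)` is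
`λ_a - λ_{a+1}`; averaging such fillings realizes every union of positive paths that reaches all
terminal vertices (`exists_filling`). The condition on diagonal boxes in the definition of an isogram
says that a diagonal value is nonzero unless one of its two neighbours forces it to vanish
(`DiagGeneric`).

*Coastlines are signs.* If the diagonal value is nonzero and equal to a neighbouring one, the face has
to know the sign of the diagonal coordinate; this is the choice between the two edges of the diagonal
box. A full box leaves the sign free, and where the diagonal value is zero the coastline has no choice
(`IsCoastline.heights_eq_of_base`). All choices occur (`exists_coastline`), since raising the lowest
path over a diagonal box amounts to replacing the diagonal value by zero.

*Faces are tight sets.* The exposed faces of a polyhedron are its sets `faceAt u`, cut out by the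
constraints that are tight at a point `u`, and their direction space is the common kernel of those
constraints (`exists_eq_faceAt`, `mem_vectorSpan_faceAt`). Each diagram face is represented by a point
(`exists_represents`), each point has the tight constraints of one that represents a diagram face
(`exists_face_of_isPoint`), and the order of diagram faces is the reverse inclusion of tight sets
(`tightLE_of_le`, `le_of_tightLE`). As the order on diagram faces is antisymmetric, this yields the
isomorphism. Finally, a direction of the face is, up to the signs, a function that is constant on the
regions of the isogram and vanishes on the unbounded ones (`range_regionDirection`), so the dimension
is the number of bounded regions.
-/

namespace GelfandCetlin

/-! ### Faces of polyhedra -/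

/-- If each of finitely many properties `Q k` survives suitable combinations inside `C`, then a single
element of `C` has every property that some element of `C` has. -/
theorem exists_generic {X K : Type*} [Finite K] (C : Set X) (hC : C.Nonempty) (Q : K → X → Prop)
    (h : ∀ x ∈ C, ∀ y ∈ C, ∃ z ∈ C, ∀ k, Q k x ∨ Q k y → Q k z) :
    ∃ z ∈ C, ∀ k, (∃ y ∈ C, Q k y) → Q k z := by
  classical
  have := Fintype.ofFinite K
  suffices H : ∀ s : Finset K, ∃ z ∈ C, ∀ k ∈ s, (∃ y ∈ C, Q k y) → Q k z by
    obtain ⟨z, hz, H⟩ := H Finset.univ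
    exact ⟨z, hz, fun k => H k (Finset.mem_univ k)⟩
  intro s
  induction s using Finset.induction_on with
  | empty => exact ⟨hC.some, hC.some_mem, by simp⟩
  | insert a s _ ih =>
    obtain ⟨x, hx, H⟩ := ih
    by_cases hy : ∃ y ∈ C, Q a y
    · obtain ⟨y, hyC, hy⟩ := hy
      obtain ⟨z, hz, hzQ⟩ := h x hx y hyC
      refine ⟨z, hz, fun k hk hex => ?_⟩
      rcases Finset.mem_insert.1 hk with rfl | hk
      · exact hzQ _ (Or.inr hy)
      · exact hzQ _ (Or.inl (H k hk hex))
    · refine ⟨x, hx, fun k hk hex => ?_⟩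
      rcases Finset.mem_insert.1 hk with rfl | hk
      · exact absurd hex hy
      · exact H k hk hex

section Polyhedron

variable {E K : Type*} [AddCommGroup E] [Module ℝ E] [TopologicalSpace E]
  (l : K → E →L[ℝ] ℝ) (b : K → ℝ)

/-- The polyhedron cut out by the inequalities `l k x ≤ b k`. -/
def polyhedron : Set E := {x | ∀ k, l k x ≤ b k}

/-- The constraints of the polyhedron that are tight at `x`. -/
def tight (x : E) : Set K := {k | l k x = b k}

/-- The smallest face of the polyhedron that contains `u`. -/
def faceAt (u : E) : Set E := {x | x ∈ polyhedron l b ∧ tight l b u ⊆ tight l b x}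

variable {l b}

theorem faceAt_subset_iff {u v : E} (hu : u ∈ polyhedron l b) :
    faceAt l b u ⊆ faceAt l b v ↔ tight l b v ⊆ tight l b u :=
  ⟨fun h => (h ⟨hu, subset_rfl⟩).2, fun h _ hx => ⟨hx.1, h.trans hx.2⟩⟩

theorem isExposed_faceAt [Finite K] {u : E} (hu : u ∈ polyhedron l b) :
    IsExposed ℝ (polyhedron l b) (faceAt l b u) := by
  classical
  have := Fintype.ofFinite K
  intro _
  have key : ∀ x, (∑ k ∈ Finset.univ.filter (· ∈ tight l b u), l k) x
      = ∑ k ∈ Finset.univ.filter (· ∈ tight l b u), l k x := fun x => by simp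
  refine ⟨∑ k ∈ Finset.univ.filter (· ∈ tight l b u), l k, ?_⟩
  ext x
  simp only [Set.mem_ofPred_eq, key]
  constructor
  · rintro ⟨hx, ht⟩
    refine ⟨hx, fun y hy => Finset.sum_le_sum fun k hk => ?_⟩
    have hk' : l k x = b k := ht (Finset.mem_filter.1 hk).2
    rw [hk']
    exact hy k
  · rintro ⟨hx, hmax⟩
    refine ⟨hx, ?_⟩
    have h1 : ∑ k ∈ Finset.univ.filter (· ∈ tight l b u), l k x
        = ∑ k ∈ Finset.univ.filter (· ∈ tight l b u), b k := by
      refine le_antisymm (Finset.sum_le_sum fun k _ => hx k) ?_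
      refine le_trans (Finset.sum_le_sum fun k hk => ?_) (hmax u hu)
      exact (Finset.mem_filter.1 hk).2.ge
    intro k hk
    exact (Finset.sum_eq_sum_iff_of_le (fun k _ => hx k)).1 h1 k (by simpa using hk)

theorem eventually_mem_polyhedron [Finite K] {u w : E} (hu : u ∈ polyhedron l b)
    (hw : ∀ k ∈ tight l b u, l k w ≤ 0) :
    ∃ ε : ℝ, 0 < ε ∧ u + ε • w ∈ polyhedron l b := by
  classical
  have := Fintype.ofFinite K
  have h : ∀ k, ∀ᶠ ε in nhdsWithin (0 : ℝ) (Set.Ioi 0), l k (u + ε • w) ≤ b k := by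
    intro k
    by_cases hk : k ∈ tight l b u
    · filter_upwards [self_mem_nhdsWithin] with ε hε
      have h1 : l k u = b k := hk
      have h2 := mul_nonpos_of_nonneg_of_nonpos (le_of_lt (Set.mem_Ioi.1 hε)) (hw k hk)
      simp only [map_add, map_smul, smul_eq_mul]
      linarith
    · have h1 : l k u < b k := lt_of_le_of_ne (hu k) hk
      have hc : Filter.Tendsto (fun ε : ℝ => l k u + ε * l k w) (nhdsWithin 0 (Set.Ioi 0))
          (nhds (l k u + 0 * l k w)) :=
        Filter.Tendsto.mono_left (Continuous.tendsto (by fun_prop) 0) nhdsWithin_le_nhds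
      have := hc.eventually_lt_const (show l k u + 0 * l k w < b k by simpa using h1)
      exact this.mono fun _ h => by simpa using le_of_lt h
  obtain ⟨ε, hε, h0⟩ := ((Filter.eventually_all.2 h).and self_mem_nhdsWithin).exists
  exact ⟨ε, h0, hε⟩

/-- Every non-empty exposed face of a polyhedron is the smallest face at one of its points. -/
theorem exists_eq_faceAt [Finite K] {f : Set E} (hf : IsExposed ℝ (polyhedron l b) f) (hne : f.Nonempty) :
    ∃ u ∈ polyhedron l b, f = faceAt l b u := by
  obtain ⟨φ, hφ⟩ := hf hne
  obtain ⟨u, huf, hu⟩ := exists_generic f hne (fun k x => l k x < b k) (by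
    intro x hx y hy
    have hxP := (hφ ▸ hx).1
    have hyP := (hφ ▸ hy).1
    refine ⟨(1 / 2 : ℝ) • x + (1 / 2 : ℝ) • y, ?_, ?_⟩
    · have hx' := hφ ▸ hx
      have hy' := hφ ▸ hy
      rw [hφ]
      refine ⟨fun k => ?_, fun z hz => ?_⟩
      · have := hxP k; have := hyP k
        simp only [map_add, map_smul, smul_eq_mul]; linarith
      · have := hx'.2 z hz; have := hy'.2 z hz
        simp only [map_add, map_smul, smul_eq_mul]; linarith
    · intro k hk
      have := hxP k; have := hyP k
      simp only [map_add, map_smul, smul_eq_mul]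
      rcases hk with h | h <;> linarith)
  have huP : u ∈ polyhedron l b := (hφ ▸ huf).1
  refine ⟨u, huP, ?_⟩
  ext y
  constructor
  · intro hy
    have hyP : y ∈ polyhedron l b := (hφ ▸ hy).1
    refine ⟨hyP, fun k hk => ?_⟩
    by_contra hne'
    exact (hu k ⟨y, hy, lt_of_le_of_ne (hyP k) hne'⟩).ne hk
  · rintro ⟨hyP, ht⟩
    -- Moving from `u` away from `y` stays in the polyhedron for a short while.
    obtain ⟨ε, hε, hmem⟩ := eventually_mem_polyhedron (w := u - y) huP (fun k hk => by
      have h1 : l k u = b k := hk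
      have h2 : l k y = b k := ht hk
      rw [map_sub, h1, h2, sub_self])
    have hmaxu := (hφ ▸ huf).2
    have h1 := hmaxu _ hmem
    simp only [map_add, map_smul, smul_eq_mul, map_sub] at h1
    have h2 : φ u ≤ φ y := by nlinarith
    rw [hφ]
    exact ⟨hyP, fun z hz => (hmaxu z hz).trans h2⟩

theorem mem_vectorSpan_faceAt [Finite K] {u w : E} (hu : u ∈ polyhedron l b) :
    w ∈ vectorSpan ℝ (faceAt l b u) ↔ ∀ k ∈ tight l b u, l k w = 0 := by
  constructor
  · intro hw k hk
    have : vectorSpan ℝ (faceAt l b u) ≤ LinearMap.ker (l k : E →ₗ[ℝ] ℝ) := by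
      rw [vectorSpan_def, Submodule.span_le]
      rintro _ ⟨x, hx, y, hy, rfl⟩
      have h1 : l k x = b k := hx.2 hk
      have h2 : l k y = b k := hy.2 hk
      simp [h1, h2]
    exact this hw
  · intro hw
    obtain ⟨ε, hε, hmem⟩ := eventually_mem_polyhedron (w := w) hu (fun k hk => (hw k hk).le)
    have h1 : u + ε • w ∈ faceAt l b u := by
      refine ⟨hmem, fun k hk => ?_⟩
      have : l k u = b k := hk
      simp [tight, hw k hk, this]
    have h2 := vsub_mem_vectorSpan ℝ h1 (show u ∈ faceAt l b u from ⟨hu, subset_rfl⟩)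
    have h3 := Submodule.smul_mem _ ε⁻¹ h2
    simpa [smul_smul, inv_mul_cancel₀ hε.ne'] using h3

end Polyhedron

/-! ### The weight extended to the integers, and the vertices of the ladder diagram -/

/-- For a decreasing property of the elements of `Fin m`, the elements with that property are the
initial ones. -/
theorem lt_card_subtype_iff {m : ℕ} (p : Fin m → Prop) (hp : ∀ i j, i ≤ j → p j → p i) (k : Fin m) :
    (k : ℕ) < Nat.card {i // p i} ↔ p k := by
  classical
  rw [Nat.card_eq_fintype_card, Fintype.card_subtype]
  constructor
  · intro h
    by_contra hk
    have : Finset.univ.filter (fun i => p i) ⊆ Finset.univ.filter (fun i : Fin m => i < k) := by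
      intro i hi
      simp only [Finset.mem_filter, Finset.mem_univ, true_and] at hi ⊢
      by_contra hki
      exact hk (hp _ _ (not_lt.1 hki) hi)
    have h2 := Finset.card_le_card this
    have h3 : (Finset.univ.filter (fun i : Fin m => i < k)).card = k := by
      have : Finset.univ.filter (fun i : Fin m => i < k) = Finset.Iio k := by ext; simp
      rw [this, Fin.card_Iio]
    omega
  · intro hk
    have : Finset.univ.filter (fun i : Fin m => i ≤ k) ⊆ Finset.univ.filter (fun i => p i) := by
      intro i hi
      simp only [Finset.mem_filter, Finset.mem_univ, true_and] at hi ⊢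
      exact hp _ _ hi hk
    have h2 := Finset.card_le_card this
    have h3 : (Finset.univ.filter (fun i : Fin m => i ≤ k)).card = k + 1 := by
      have : Finset.univ.filter (fun i : Fin m => i ≤ k) = Finset.Iic k := by ext; simp
      rw [this, Fin.card_Iic]
    omega

/-- The entry `λ_i` for an integer `i`: it is `λ_1` for `i ≤ 0` and `0` for `i > ν`. -/
noncomputable def wt (n : ℕ) (lam : Fin (n / 2) → ℝ) (i : ℤ) : ℝ :=
  if h : (i - 1).toNat < n / 2 then lam ⟨(i - 1).toNat, h⟩ else 0

section

variable {n : ℕ} {lam : Fin (n / 2) → ℝ}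

theorem wt_natCast_add_one (k : Fin (n / 2)) : wt n lam (((k : ℕ) : ℤ) + 1) = lam k := by
  have : ((((k : ℕ) : ℤ) + 1) - 1).toNat = k := by omega
  simp [wt]

theorem wt_nonneg (h0 : ∀ k, 0 ≤ lam k) (i : ℤ) : 0 ≤ wt n lam i := by
  unfold wt; split_ifs
  · exact h0 _
  · exact le_rfl

theorem wt_antitone (hl : Antitone lam) (h0 : ∀ k, 0 ≤ lam k) : Antitone (wt n lam) := by
  intro i j hij
  unfold wt
  split_ifs with h1 h2
  · exact hl (by rw [Fin.mk_le_mk]; omega)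
  · omega
  · exact h0 _
  · exact le_rfl

theorem wt_eq_zero {i : ℤ} (h : (n : ℤ) < 2 * i) : wt n lam i = 0 := by
  unfold wt; rw [dif_neg (by omega)]

theorem wt_of_nonpos {i : ℤ} (h : i ≤ 0) : wt n lam i = wt n lam 1 := by
  have : (i - 1).toNat = (1 - 1 : ℤ).toNat := by omega
  unfold wt; simp only [this]

theorem le_half_of_wt_pos {i : ℤ} (h : 0 < wt n lam i) : 2 * i ≤ n := by
  by_contra h'
  rw [wt_eq_zero (by omega)] at h
  exact lt_irrefl _ h

theorem lt_numNonzero_iff (hl : Antitone lam) (h0 : ∀ k, 0 ≤ lam k) (k : Fin (n / 2)) :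
    (k : ℕ) < numNonzero n lam ↔ 0 < lam k := by
  rw [numNonzero, lt_card_subtype_iff (fun k => lam k ≠ 0)]
  · exact ⟨fun h => lt_of_le_of_ne (h0 k) (Ne.symm h), fun h => h.ne'⟩
  · intro i j hij hj
    exact (lt_of_lt_of_le (lt_of_le_of_ne (h0 j) (Ne.symm hj)) (hl hij)).ne'

theorem lt_blockEnd_iff (hl : Antitone lam) (i k : Fin (n / 2)) :
    (k : ℕ) < blockEnd n lam i ↔ lam i ≤ lam k :=
  lt_card_subtype_iff (fun k => lam i ≤ lam k) (fun _ _ hij h => h.trans (hl hij)) k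

theorem blockEnd_le (i : Fin (n / 2)) : blockEnd n lam i ≤ n / 2 := by
  classical
  rw [blockEnd, Nat.card_eq_fintype_card]
  simpa using Fintype.card_subtype_le (fun k : Fin (n / 2) => lam i ≤ lam k)

theorem numNonzero_le : numNonzero n lam ≤ n / 2 := by
  classical
  rw [numNonzero, Nat.card_eq_fintype_card]
  simpa only [Fintype.card_fin] using Fintype.card_subtype_le (fun k : Fin (n / 2) => lam k ≠ 0)

theorem lt_numNonzero_iff_wt (hl : Antitone lam) (h0 : ∀ k, 0 ≤ lam k) {j : ℤ} (hj : 0 ≤ j) :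
    j < numNonzero n lam ↔ 0 < wt n lam (j + 1) := by
  have hN := numNonzero_le (n := n) (lam := lam)
  by_cases h : j.toNat < n / 2
  · have h1 := lt_numNonzero_iff hl h0 ⟨j.toNat, h⟩
    have h2 := wt_natCast_add_one (lam := lam) ⟨j.toNat, h⟩
    simp only [] at h1 h2
    rw [show ((j.toNat : ℕ) : ℤ) = j by omega] at h2
    rw [h2, ← h1]
    omega
  · rw [wt_eq_zero (by omega)]
    simp only [lt_irrefl, iff_false]
    omega

/-- The height bound `b ≤ n - 1 - e(i)` says that the box with top-right corner `(i, b)` is not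
confined to a single value. -/
theorem le_sub_blockEnd_iff (hl : Antitone lam) (h0 : ∀ k, 0 ≤ lam k) (j : Fin (n / 2))
    (hj : 0 < lam j) (b : ℤ) :
    b ≤ (n : ℤ) - 1 - (blockEnd n lam j : ℤ) ↔ wt n lam (n - b) < lam j := by
  have hB := blockEnd_le (lam := lam) j
  have hjB := (lt_blockEnd_iff hl j j).2 le_rfl
  by_cases hb : (n : ℤ) - b ≤ 0
  · have h1 : lam j ≤ wt n lam (n - b) := by
      rw [wt_of_nonpos hb, ← wt_natCast_add_one (lam := lam) j]
      exact wt_antitone hl h0 (by omega)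
    constructor
    · intro h; omega
    · intro h; exact absurd h1 (not_le.2 h)
  · by_cases h : ((n : ℤ) - b - 1).toNat < n / 2
    · have h1 := lt_blockEnd_iff hl j ⟨_, h⟩
      have h2 := wt_natCast_add_one (lam := lam) ⟨_, h⟩
      simp only [] at h1 h2
      rw [show (((((n : ℤ) - b - 1).toNat : ℕ) : ℤ) + 1) = n - b by omega] at h2
      rw [h2, ← not_le (a := lam j), ← h1]
      omega
    · rw [wt_eq_zero (by omega)]
      simp only [hj, iff_true]
      omega

theorem mem_ladderVertices_iff (hl : Antitone lam) (h0 : ∀ k, 0 ≤ lam k) (p : ℤ × ℤ) :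
    p ∈ ladderVertices n lam ↔
      0 ≤ p.1 ∧ 0 ≤ p.2 ∧ p.1 ≤ p.2 + 1 ∧ wt n lam (n - p.2) < wt n lam p.1 := by
  obtain ⟨a, b⟩ := p
  have hanti := wt_antitone hl h0
  have hw0 := wt_nonneg (n := n) h0
  simp only [ladderVertices, Set.mem_ofPred_eq]
  constructor
  · rintro ⟨j, hj, h1, h2, h3, h4⟩
    have hj' := (lt_numNonzero_iff hl h0 j).1 hj
    rw [le_sub_blockEnd_iff hl h0 j hj', ← wt_natCast_add_one (lam := lam) j] at h4
    refine ⟨by omega, by omega, by omega, h4.trans_le (hanti h2)⟩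
  · rintro ⟨h1, h2, h3, h4⟩
    have hpos : 0 < wt n lam a := (hw0 _).trans_lt h4
    have hpos' : 0 < wt n lam (max a 1) := by
      rcases le_total a 1 with h | h
      · rw [max_eq_right h]; rcases h.lt_or_eq with h' | h'
        · rwa [wt_of_nonpos (by omega)] at hpos
        · rwa [h'] at hpos
      · rwa [max_eq_left h]
    have hk := le_half_of_wt_pos hpos'
    have hlt : (a - 1).toNat < n / 2 := by omega
    have hw : wt n lam a = lam ⟨(a - 1).toNat, hlt⟩ := by unfold wt; rw [dif_pos hlt]
    rw [hw] at h4 hpos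
    refine ⟨⟨(a - 1).toNat, hlt⟩, (lt_numNonzero_iff hl h0 _).2 hpos, ?_, ?_, ?_, ?_⟩
    · simp only []; omega
    · simp only []; omega
    · simp only []; omega
    · exact (le_sub_blockEnd_iff hl h0 _ hpos b).2 h4

theorem add_le_of_mem (hl : Antitone lam) (h0 : ∀ k, 0 ≤ lam k) {p : ℤ × ℤ}
    (hp : p ∈ ladderVertices n lam) : p.1 + p.2 ≤ n - 1 := by
  obtain ⟨-, -, -, h⟩ := (mem_ladderVertices_iff hl h0 p).1 hp
  by_contra hlt
  exact absurd (wt_antitone hl h0 (show (n : ℤ) - p.2 ≤ p.1 by omega)) (not_le.2 h)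

theorem isTerminal_iff (hl : Antitone lam) (h0 : ∀ k, 0 ≤ lam k) (t : ℤ × ℤ) :
    IsTerminal n lam t ↔ t ∈ ladderVertices n lam ∧ t.1 + t.2 = n - 1 := by
  have hw0 := wt_nonneg (n := n) h0
  have hanti := wt_antitone hl h0
  constructor
  · rintro ⟨ht, hmax⟩
    refine ⟨ht, le_antisymm (add_le_of_mem hl h0 ht) ?_⟩
    obtain ⟨h1, h2, h3, h4⟩ := (mem_ladderVertices_iff hl h0 t).1 ht
    -- The last block end is a vertex at distance `n - 1`.
    obtain ⟨a, ha, hamax⟩ := Int.exists_greatest_of_bdd (P := fun a : ℤ => 0 < wt n lam a)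
      ⟨n, fun z hz => by have := le_half_of_wt_pos hz; omega⟩ ⟨t.1, (hw0 _).trans_lt h4⟩
    have ha0 : 0 ≤ a := h1.trans (hamax _ ((hw0 _).trans_lt h4))
    have ha1 : wt n lam (a + 1) = 0 := by
      refine le_antisymm (not_lt.1 fun h => ?_) (hw0 _)
      have := hamax _ h
      omega
    have hmem : ((a, n - 1 - a) : ℤ × ℤ) ∈ ladderVertices n lam := by
      rw [mem_ladderVertices_iff hl h0]
      have := le_half_of_wt_pos ha
      have h1 : 0 < wt n lam 1 := ha.trans_le (by
        rw [← wt_of_nonpos le_rfl]; exact hanti ha0)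
      have := le_half_of_wt_pos h1
      refine ⟨ha0, by simp only []; omega, by simp only []; omega, ?_⟩
      simp only []
      rwa [show (n : ℤ) - (n - 1 - a) = a + 1 by ring, ha1]
    have hd := hmax _ hmem
    have h5 := (mem_ladderVertices_iff hl h0 _).1 hmem
    simp only [] at h5
    rw [abs_of_nonneg h1, abs_of_nonneg h2, abs_of_nonneg h5.1, abs_of_nonneg h5.2.1] at hd
    omega
  · rintro ⟨ht, hs⟩
    refine ⟨ht, fun p hp => ?_⟩
    obtain ⟨h1, h2, -, -⟩ := (mem_ladderVertices_iff hl h0 t).1 ht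
    obtain ⟨h3, h4, -, -⟩ := (mem_ladderVertices_iff hl h0 p).1 hp
    have := add_le_of_mem hl h0 hp
    rw [abs_of_nonneg h1, abs_of_nonneg h2, abs_of_nonneg h3, abs_of_nonneg h4]
    omega

end

/-! ### Positive paths as monotone lattice paths -/

/-- A monotone lattice path in the ladder diagram from the origin to a terminal vertex, encoded by its
abscissa `A t` at time `t`, so that its ordinate is `t - A t`. The encoding is extended to all times
`t : ℤ` by a vertical ray below the origin and one above the terminal vertex. -/
structure IsLatticePath (n : ℕ) (lam : Fin (n / 2) → ℝ) (A : ℤ → ℤ) : Prop where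
  start : ∀ t ≤ 0, A t = 0
  finish : ∀ t, (n : ℤ) - 1 ≤ t → A t = A (n - 1)
  le_succ : ∀ t, A t ≤ A (t + 1)
  succ_le : ∀ t, A (t + 1) ≤ A t + 1
  mem : ∀ t, 0 ≤ t → t ≤ (n : ℤ) - 1 → ((A t, t - A t) : ℤ × ℤ) ∈ ladderVertices n lam

/-- `P` is the subgraph traced out by the lattice path `A`. A box `(i, k)` lies above the path exactly
when `i ≤ A (i + k - 1)`, and an edge is on the path when the two boxes that it separates lie on
different sides. -/
structure Traces {n : ℕ} {lam : Fin (n / 2) → ℝ} (P : (ladder n lam).Subgraph) (A : ℤ → ℤ) : Prop where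
  top : ∀ i k, HasTop P i k ↔ ¬ i ≤ A (i + k - 1) ∧ i ≤ A (i + k)
  right : ∀ i k, HasRight P i k ↔
    1 ≤ i + k ∧ i + k ≤ (n : ℤ) - 1 ∧ i ≤ A (i + k - 1) ∧ ¬ i + 1 ≤ A (i + k)
  verts : ∀ p, p ∈ P.verts ↔ 0 ≤ p.1 + p.2 ∧ p.1 + p.2 ≤ (n : ℤ) - 1 ∧ p.1 = A (p.1 + p.2)

section

variable {n : ℕ} {lam : Fin (n / 2) → ℝ}

theorem abs_add_abs_eq_one {a b : ℤ} (h : |a| + |b| = 1) :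
    (a = 1 ∧ b = 0) ∨ (a = -1 ∧ b = 0) ∨ (a = 0 ∧ b = 1) ∨ (a = 0 ∧ b = -1) := by
  rcases abs_cases a with ⟨h1, h2⟩ | ⟨h1, h2⟩ <;> rcases abs_cases b with ⟨h3, h4⟩ | ⟨h3, h4⟩ <;> omega

/-- A walk climbs by at most one per step. -/
theorem add_le_add_length {u v : ℤ × ℤ} (w : (ladder n lam).Walk u v) :
    v.1 + v.2 ≤ u.1 + u.2 + w.length := by
  induction w with
  | nil => simp
  | cons h _ ih =>
    have := abs_add_abs_eq_one h.1
    simp only [SimpleGraph.Walk.length_cons]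
    push_cast
    omega

/-- A lattice path is traced out by a walk whose `s`-th vertex is `(A s, s - A s)`. -/
theorem IsLatticePath.exists_walk {A : ℤ → ℤ} (hA : IsLatticePath n lam A) (m : ℕ)
    (hm : (m : ℤ) ≤ n - 1) : ∃ w : (ladder n lam).Walk (0, 0) (A m, m - A m), w.length = m ∧
      ∀ s : ℕ, s ≤ m → w.getVert s = (A s, s - A s) := by
  induction m with
  | zero =>
    have h0 : ((A (0 : ℕ), (0 : ℕ) - A (0 : ℕ)) : ℤ × ℤ) = (0, 0) := by
      simp [hA.start 0 le_rfl]
    refine ⟨(SimpleGraph.Walk.nil).copy rfl h0.symm, by simp, fun s hs => ?_⟩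
    obtain rfl : s = 0 := by omega
    simpa using h0.symm
  | succ m ih =>
    obtain ⟨w, hw, hg⟩ := ih (by push_cast at hm; omega)
    have hadj : (ladder n lam).Adj (A m, m - A m) (A (m + 1 : ℕ), (m + 1 : ℕ) - A (m + 1 : ℕ)) := by
      refine ⟨?_, hA.mem _ (by omega) (by push_cast at hm; omega), hA.mem _ (by omega) hm⟩
      have h1 := hA.le_succ m
      have h2 := hA.succ_le m
      push_cast
      simp only [squareGrid]
      rcases (show A (m + 1) = A m ∨ A (m + 1) = A m + 1 by omega) with h | h <;> rw [h]
      · rw [show A m - A m = 0 by ring, show (m : ℤ) - A m - (m + 1 - A m) = -1 by ring]; simp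
      · rw [show A m - (A m + 1) = -1 by ring, show (m : ℤ) - A m - (m + 1 - (A m + 1)) = 0 by ring]
        simp
    refine ⟨w.concat hadj, by simp [hw], fun s hs => ?_⟩
    rw [SimpleGraph.Walk.concat_eq_append, SimpleGraph.Walk.getVert_append, hw]
    split_ifs with h
    · exact hg s (by omega)
    · rcases (show s = m ∨ s = m + 1 by omega) with rfl | rfl
      · simp
      · simp

end

section

variable {n : ℕ} {lam : Fin (n / 2) → ℝ}

theorem traces_toSubgraph {A : ℤ → ℤ} (hA : IsLatticePath n lam A) {v : ℤ × ℤ}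
    (w : (ladder n lam).Walk (0, 0) v) (hw : (w.length : ℤ) = n - 1)
    (hg : ∀ s : ℕ, s ≤ w.length → w.getVert s = (A s, s - A s)) : Traces w.toSubgraph A := by
  refine ⟨fun i k => ?_, fun i k => ?_, fun p => ?_⟩
  · rw [HasTop, SimpleGraph.Walk.toSubgraph_adj_iff]
    constructor
    · rintro ⟨s, hs, hlt⟩
      rw [hg s hlt.le, hg (s + 1) hlt] at hs
      have h1 := hA.le_succ s
      push_cast at hs
      simp only [Sym2.eq_iff, Prod.mk.injEq] at hs
      rcases hs with ⟨⟨h2, h3⟩, h4, h5⟩ | ⟨⟨h2, h3⟩, h4, h5⟩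
      · rw [show i + k - 1 = s by omega, show i + k = s + 1 by omega]
        omega
      · omega
    · rintro ⟨h1, h2⟩
      have h3 := hA.succ_le (i + k - 1)
      rw [show i + k - 1 + 1 = i + k by ring] at h3
      have h4 : 0 ≤ i + k - 1 := by
        by_contra h
        rw [hA.start _ (by omega)] at h1 h2
        omega
      have h5 : i + k - 1 < n - 1 := by
        by_contra h
        rw [hA.finish _ (by omega)] at h1 h2
        omega
      refine ⟨(i + k - 1).toNat, ?_, by omega⟩
      rw [hg _ (by omega), hg _ (by omega)]
      push_cast
      rw [Int.toNat_of_nonneg h4, show i + k - 1 + 1 = i + k by ring,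
        show A (i + k) = i by omega, show A (i + k - 1) = i - 1 by omega,
        show i + k - 1 - (i - 1) = k by ring, show i + k - i = k by ring]
  · rw [HasRight, SimpleGraph.Walk.toSubgraph_adj_iff]
    constructor
    · rintro ⟨s, hs, hlt⟩
      rw [hg s hlt.le, hg (s + 1) hlt] at hs
      have h1 := hA.le_succ s
      push_cast at hs
      simp only [Sym2.eq_iff, Prod.mk.injEq] at hs
      rcases hs with ⟨⟨h2, h3⟩, h4, h5⟩ | ⟨⟨h2, h3⟩, h4, h5⟩
      · rw [show i + k - 1 = s by omega, show i + k = s + 1 by omega]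
        omega
      · omega
    · rintro ⟨h4, h5, h1, h2⟩
      have h3 := hA.le_succ (i + k - 1)
      rw [show i + k - 1 + 1 = i + k by ring] at h3
      refine ⟨(i + k - 1).toNat, ?_, by omega⟩
      rw [hg _ (by omega), hg _ (by omega)]
      push_cast
      rw [Int.toNat_of_nonneg (by omega), show i + k - 1 + 1 = i + k by ring,
        show A (i + k) = i by omega, show A (i + k - 1) = i by omega,
        show i + k - 1 - i = k - 1 by ring, show i + k - i = k by ring]
  · rw [SimpleGraph.Walk.mem_verts_toSubgraph, SimpleGraph.Walk.mem_support_iff_exists_getVert]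
    obtain ⟨a, b⟩ := p
    constructor
    · rintro ⟨s, hs, hle⟩
      rw [hg s hle, Prod.mk.injEq] at hs
      obtain ⟨h1, h2⟩ := hs
      simp only []
      rw [show a + b = s by omega]
      omega
    · rintro ⟨h1, h2, h3⟩
      simp only [] at h1 h2 h3
      refine ⟨(a + b).toNat, ?_, by omega⟩
      rw [hg _ (by omega), Int.toNat_of_nonneg h1, ← h3, Prod.mk.injEq]
      omega

/-- The lattice path that climbs to the height of `t` before it turns right. -/
theorem exists_isLatticePath (hl : Antitone lam) (h0 : ∀ k, 0 ≤ lam k) {t : ℤ × ℤ}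
    (ht : IsTerminal n lam t) : ∃ A, IsLatticePath n lam A ∧ A (n - 1) = t.1 := by
  obtain ⟨hm, hs⟩ := (isTerminal_iff hl h0 t).1 ht
  obtain ⟨h1, h2, h3, h4⟩ := (mem_ladderVertices_iff hl h0 t).1 hm
  have hanti := wt_antitone hl h0
  refine ⟨fun s => max 0 (min s (n - 1) - t.2), ⟨?_, ?_, ?_, ?_, ?_⟩, ?_⟩
  · intro s hs; omega
  · intro s hs; omega
  · intro s; omega
  · intro s; omega
  · intro s h5 h6
    rw [mem_ladderVertices_iff hl h0]
    simp only []
    refine ⟨by omega, by omega, by omega, ?_⟩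
    exact (hanti (by omega)).trans_lt (h4.trans_le (hanti (by omega)))
  · change max 0 (min ((n : ℤ) - 1) (n - 1) - t.2) = t.1
    omega

theorem dist_origin_terminal (hl : Antitone lam) (h0 : ∀ k, 0 ≤ lam k) {t : ℤ × ℤ}
    (ht : IsTerminal n lam t) : ((ladder n lam).dist (0, 0) t : ℤ) = n - 1 := by
  obtain ⟨A, hA, hAt⟩ := exists_isLatticePath hl h0 ht
  obtain ⟨hm, hs⟩ := (isTerminal_iff hl h0 t).1 ht
  obtain ⟨h1, h2, h3, h4⟩ := (mem_ladderVertices_iff hl h0 t).1 hm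
  obtain ⟨w, hw, -⟩ := hA.exists_walk (n - 1) (by omega)
  have hc : ((n - 1 : ℕ) : ℤ) = n - 1 := by omega
  have he : ((A (n - 1 : ℕ), (n - 1 : ℕ) - A (n - 1 : ℕ)) : ℤ × ℤ) = t := by
    rw [hc, hAt]; ext <;> simp only []; omega
  have hle := SimpleGraph.dist_le (w.copy rfl he)
  rw [SimpleGraph.Walk.length_copy, hw] at hle
  obtain ⟨w', hw'⟩ := (SimpleGraph.Walk.reachable (w.copy rfl he)).exists_walk_length_eq_dist
  have := add_le_add_length w'
  simp only [] at this
  omega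

theorem IsPositivePath.exists_traces (hl : Antitone lam) (h0 : ∀ k, 0 ≤ lam k)
    {P : (ladder n lam).Subgraph} (hP : IsPositivePath n lam P) :
    ∃ A, IsLatticePath n lam A ∧ Traces P A := by
  obtain ⟨t, ht, w, hw, rfl⟩ := hP
  have hlen : (w.length : ℤ) = n - 1 := by rw [hw]; exact dist_origin_terminal hl h0 ht
  obtain ⟨hm, hs⟩ := (isTerminal_iff hl h0 t).1 ht
  have hsum : ∀ s : ℕ, s ≤ w.length → (w.getVert s).1 + (w.getVert s).2 = s := by
    intro s hsl
    have h1 := add_le_add_length (w.take s)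
    have h2 := add_le_add_length (w.drop s)
    rw [SimpleGraph.Walk.take_length] at h1
    rw [SimpleGraph.Walk.drop_length] at h2
    simp only [] at h1
    omega
  have hstep : ∀ s : ℕ, s < w.length → (w.getVert s).1 ≤ (w.getVert (s + 1)).1 ∧
      (w.getVert (s + 1)).1 ≤ (w.getVert s).1 + 1 := by
    intro s hsl
    have h1 := abs_add_abs_eq_one (w.adj_getVert_succ hsl).1
    have h2 := hsum s hsl.le
    have h3 := hsum (s + 1) hsl
    push_cast at h3
    omega
  set A : ℤ → ℤ := fun s => (w.getVert (min s.toNat w.length)).1 with hAdef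
  have hg : ∀ s : ℕ, s ≤ w.length → w.getVert s = (A s, s - A s) := by
    intro s hsl
    have := hsum s hsl
    simp only [hAdef, Int.toNat_natCast, min_eq_left hsl]
    ext
    · rfl
    · simp only []; omega
  have hmem : ∀ s : ℕ, s ≤ w.length → w.getVert s ∈ ladderVertices n lam := by
    intro s hsl
    rcases hsl.lt_or_eq with h | rfl
    · exact (w.adj_getVert_succ h).2.1
    · rw [SimpleGraph.Walk.getVert_length]; exact hm
  have hA : IsLatticePath n lam A := by
    refine ⟨?_, ?_, ?_, ?_, ?_⟩
    · intro s hs0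
      simp [hAdef, Int.toNat_of_nonpos hs0]
    · intro s hs1
      simp only [hAdef]
      congr 2
      omega
    · intro s
      simp only [hAdef]
      by_cases h : 0 ≤ s ∧ s < w.length
      · have := (hstep s.toNat (by omega)).1
        rw [min_eq_left (by omega), min_eq_left (by omega)]
        rwa [show (s + 1).toNat = s.toNat + 1 by omega]
      · rw [show min (s + 1).toNat w.length = min s.toNat w.length by omega]
    · intro s
      simp only [hAdef]
      by_cases h : 0 ≤ s ∧ s < w.length
      · have := (hstep s.toNat (by omega)).2
        rw [min_eq_left (by omega), min_eq_left (by omega)]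
        rwa [show (s + 1).toNat = s.toNat + 1 by omega]
      · rw [show min (s + 1).toNat w.length = min s.toNat w.length by omega]
        omega
    · intro s h1 h2
      have h3 := hg s.toNat (by omega)
      have h4 := hmem s.toNat (by omega)
      rw [h3, Int.toNat_of_nonneg h1] at h4
      exact h4
  exact ⟨A, hA, traces_toSubgraph hA w hlen hg⟩

theorem IsLatticePath.isTerminal (hl : Antitone lam) (h0 : ∀ k, 0 ≤ lam k) (hn : 0 < n) {A : ℤ → ℤ}
    (hA : IsLatticePath n lam A) : IsTerminal n lam (A (n - 1), n - 1 - A (n - 1)) := by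
  rw [isTerminal_iff hl h0]
  exact ⟨hA.mem _ (by omega) le_rfl, by simp only []; omega⟩

theorem IsLatticePath.exists_positivePath (hl : Antitone lam) (h0 : ∀ k, 0 ≤ lam k) (hn : 0 < n)
    {A : ℤ → ℤ} (hA : IsLatticePath n lam A) :
    ∃ P : (ladder n lam).Subgraph, IsPositivePath n lam P ∧ Traces P A := by
  obtain ⟨w, hw, hg⟩ := hA.exists_walk (n - 1) (by omega)
  have hc : ((n - 1 : ℕ) : ℤ) = n - 1 := by omega
  have ht : IsTerminal n lam (A (n - 1 : ℕ), (n - 1 : ℕ) - A (n - 1 : ℕ)) := by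
    rw [hc]; exact hA.isTerminal hl h0 hn
  refine ⟨_, ⟨_, ht, w, ?_, rfl⟩, traces_toSubgraph hA w (by omega) (fun s hs => hg s (by omega))⟩
  have := dist_origin_terminal hl h0 ht
  omega

/-- A lattice path with all its vertices in the ladder diagram has at least one step. -/
theorem IsLatticePath.two_le (hl : Antitone lam) (h0 : ∀ k, 0 ≤ lam k) (hn : 0 < n) {A : ℤ → ℤ}
    (hA : IsLatticePath n lam A) : 2 ≤ n := by
  obtain ⟨-, -, -, h⟩ := (mem_ladderVertices_iff hl h0 _).1 (hA.mem 0 le_rfl (by omega))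
  simp only [] at h
  rw [hA.start 0 le_rfl, wt_of_nonpos le_rfl] at h
  have := le_half_of_wt_pos ((wt_nonneg h0 _).trans_lt h)
  omega

/-! ### Subgraphs as sets of edges -/

theorem adj_cases {γ : (ladder n lam).Subgraph} {p q : ℤ × ℤ} (h : γ.Adj p q) :
    (q = (p.1 + 1, p.2) ∧ HasTop γ q.1 q.2) ∨ (p = (q.1 + 1, q.2) ∧ HasTop γ p.1 p.2) ∨
    (q = (p.1, p.2 + 1) ∧ HasRight γ q.1 q.2) ∨ (p = (q.1, q.2 + 1) ∧ HasRight γ p.1 p.2) := by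
  obtain ⟨a, b⟩ := p
  obtain ⟨c, d⟩ := q
  have h1 := abs_add_abs_eq_one (γ.adj_sub h).1
  simp only [] at h1
  simp only [Prod.mk.injEq, HasTop, HasRight]
  rcases h1 with ⟨h1, h2⟩ | ⟨h1, h2⟩ | ⟨h1, h2⟩ | ⟨h1, h2⟩
  · obtain rfl : a = c + 1 := by omega
    obtain rfl : b = d := by omega
    right; left
    refine ⟨⟨rfl, rfl⟩, ?_⟩
    rw [show c + 1 - 1 = c by ring]; exact h.symm
  · obtain rfl : c = a + 1 := by omega
    obtain rfl : b = d := by omega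
    left
    refine ⟨⟨rfl, rfl⟩, ?_⟩
    rw [show a + 1 - 1 = a by ring]; exact h
  · obtain rfl : b = d + 1 := by omega
    obtain rfl : a = c := by omega
    right; right; right
    refine ⟨⟨rfl, rfl⟩, ?_⟩
    rw [show d + 1 - 1 = d by ring]; exact h.symm
  · obtain rfl : d = b + 1 := by omega
    obtain rfl : a = c := by omega
    right; right; left
    refine ⟨⟨rfl, rfl⟩, ?_⟩
    rw [show b + 1 - 1 = b by ring]; exact h

theorem Traces.exists_adj (hl : Antitone lam) (h0 : ∀ k, 0 ≤ lam k) (hn : 0 < n)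
    {P : (ladder n lam).Subgraph} {A : ℤ → ℤ} (hA : IsLatticePath n lam A) (hPA : Traces P A)
    {p : ℤ × ℤ} (hp : p ∈ P.verts) : ∃ q, P.Adj p q := by
  obtain ⟨a, b⟩ := p
  obtain ⟨h1, h2, h3⟩ := (hPA.verts _).1 hp
  simp only [] at h1 h2 h3
  have hn2 := hA.two_le hl h0 hn
  by_cases h : a + b = n - 1
  · -- the last step
    have h4 := hA.le_succ (a + b - 1)
    have h5 := hA.succ_le (a + b - 1)
    rw [show a + b - 1 + 1 = a + b by ring] at h4 h5
    by_cases h6 : a ≤ A (a + b - 1)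
    · exact ⟨_, ((hPA.right a b).2 ⟨by omega, h2, h6, by omega⟩).symm⟩
    · exact ⟨_, ((hPA.top a b).2 ⟨h6, by omega⟩).symm⟩
  · have h4 := hA.le_succ (a + b)
    have h5 := hA.succ_le (a + b)
    by_cases h6 : a + 1 ≤ A (a + b + 1)
    · refine ⟨(a + 1, b), ?_⟩
      have := (hPA.top (a + 1) b).2 ⟨by rw [show a + 1 + b - 1 = a + b by ring]; omega,
        by rw [show a + 1 + b = a + b + 1 by ring]; exact h6⟩
      rwa [HasTop, show a + 1 - 1 = a by ring] at this
    · refine ⟨(a, b + 1), ?_⟩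
      have := (hPA.right a (b + 1)).2 ⟨by omega, by omega,
        by rw [show a + (b + 1) - 1 = a + b by ring]; omega,
        by rw [show a + (b + 1) = a + b + 1 by ring]; exact h6⟩
      rwa [HasRight, show b + 1 - 1 = b by ring] at this

/-- A union of positive paths is contained in a subgraph as soon as its edges are. -/
theorem sSup_le_of_edges (hl : Antitone lam) (h0 : ∀ k, 0 ≤ lam k) (hn : 0 < n)
    {S : Set (ladder n lam).Subgraph} (hS : ∀ P ∈ S, IsPositivePath n lam P)
    {γ : (ladder n lam).Subgraph} (htop : ∀ i k, HasTop (sSup S) i k → HasTop γ i k)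
    (hright : ∀ i k, HasRight (sSup S) i k → HasRight γ i k) : sSup S ≤ γ := by
  have hadj : ∀ p q, (sSup S).Adj p q → γ.Adj p q := by
    intro p q h
    rcases adj_cases h with ⟨h1, h2⟩ | ⟨h1, h2⟩ | ⟨h1, h2⟩ | ⟨h1, h2⟩
    · have := htop _ _ h2; rw [HasTop, h1] at this; rw [h1]; simpa using this
    · have := htop _ _ h2; rw [HasTop, h1] at this; rw [h1]; simpa using this.symm
    · have := hright _ _ h2; rw [HasRight, h1] at this; rw [h1]; simpa using this
    · have := hright _ _ h2; rw [HasRight, h1] at this; rw [h1]; simpa using this.symm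
  refine ⟨fun p hp => ?_, fun p q => hadj p q⟩
  rw [SimpleGraph.Subgraph.verts_sSup] at hp
  simp only [Set.mem_iUnion] at hp
  obtain ⟨P, hPS, hp⟩ := hp
  obtain ⟨A, hA, hPA⟩ := (hS P hPS).exists_traces hl h0
  obtain ⟨q, hq⟩ := hPA.exists_adj hl h0 hn hA hp
  exact (hadj p q (SimpleGraph.Subgraph.sSup_adj.2 ⟨P, hPS, hq⟩)).fst_mem

end

/-! ### Fillings of the plane and their contours -/

/-- The values `|u_{i,k}|` of a point of the polytope, extended to all unit squares `□^{(i,k)}` of the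
plane: by the `λ_i` above the antidiagonal, by `0` below the diagonal, and by `λ_1` on the left. -/
structure IsFilling (n : ℕ) (lam : Fin (n / 2) → ℝ) (V : ℤ → ℤ → ℝ) : Prop where
  succ_fst_le : ∀ i k, V (i + 1) k ≤ V i k
  le_succ_snd : ∀ i k, V i k ≤ V i (k + 1)
  outer : ∀ i k, (n : ℤ) ≤ i + k → V i k = wt n lam i
  below : ∀ i k, 1 ≤ i → k < i → V i k = 0
  left : ∀ i k, i ≤ 0 → V i k = wt n lam 1

/-- The subgraph `γ` consists of the edges of the ladder diagram that separate two boxes with different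
values of `V`. -/
structure IsContour {n : ℕ} {lam : Fin (n / 2) → ℝ} (γ : (ladder n lam).Subgraph) (V : ℤ → ℤ → ℝ) :
    Prop where
  top : ∀ i k, HasTop γ i k ↔ V i k < V i (k + 1)
  right : ∀ i k, HasRight γ i k ↔ 1 ≤ k ∧ i + k ≤ (n : ℤ) - 1 ∧ V (i + 1) k < V i k

section

variable {n : ℕ} {lam : Fin (n / 2) → ℝ} {V : ℤ → ℤ → ℝ}

namespace IsFilling

theorem antitone_fst (hV : IsFilling n lam V) (k : ℤ) : Antitone fun i => V i k :=
  antitone_int_of_succ_le fun i => hV.succ_fst_le i k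

theorem monotone_snd (hV : IsFilling n lam V) (i : ℤ) : Monotone (V i) :=
  monotone_int_of_le_succ fun k => hV.le_succ_snd i k

theorem le_wt (hV : IsFilling n lam V) (i k : ℤ) : V i k ≤ wt n lam i := by
  rw [← hV.outer i (max k (n - i)) (by omega)]
  exact hV.monotone_snd i (le_max_left _ _)

theorem wt_le (hV : IsFilling n lam V) {i k : ℤ} (h : i + k ≤ n) : wt n lam (n - k) ≤ V i k := by
  rw [← hV.outer (n - k) k (by omega)]
  exact hV.antitone_fst k (by omega)

theorem nonneg (h0 : ∀ k, 0 ≤ lam k) (hV : IsFilling n lam V) (i k : ℤ) : 0 ≤ V i k := by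
  refine le_trans (wt_nonneg h0 (max i (n - k))) ?_
  rw [← hV.outer (max i (n - k)) k (by omega)]
  exact hV.antitone_fst k (le_max_left _ _)

theorem le_wt_one (hV : IsFilling n lam V) (i k : ℤ) : V i k ≤ wt n lam 1 := by
  rw [← hV.left (min i 0) k (min_le_right _ _)]
  exact hV.antitone_fst k (min_le_left _ _)

/-- A vertex across which a filling changes, from its upper left to its lower right box, belongs to the
ladder diagram. -/
theorem mem_of_lt (hl : Antitone lam) (h0 : ∀ k, 0 ≤ lam k) (hV : IsFilling n lam V) {a b : ℤ}
    (ha : 0 ≤ a) (hb : 0 ≤ b) (hab : a + b ≤ n - 1) (h : V (a + 1) b < V a (b + 1)) :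
    ((a, b) : ℤ × ℤ) ∈ ladderVertices n lam := by
  rw [mem_ladderVertices_iff hl h0]
  refine ⟨ha, hb, ?_, ?_⟩
  · by_contra hlt
    simp only [] at hlt
    rw [hV.below a (b + 1) (by omega) (by omega)] at h
    exact absurd (hV.nonneg h0 _ _) (not_le.2 h)
  · exact (hV.wt_le (i := a + 1) (by omega)).trans_lt (h.trans_le (hV.le_wt _ _))

/-- The boundary of a superlevel set of a filling is a lattice path. -/
theorem exists_levelPath (hl : Antitone lam) (h0 : ∀ k, 0 ≤ lam k) (hV : IsFilling n lam V)
    {c : ℝ} (hc0 : 0 ≤ c) (hc : c < wt n lam 1) :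
    ∃ A, IsLatticePath n lam A ∧ ∀ t i, i ≤ A t ↔ c < V i (t + 1 - i) := by
  have hd : ∀ t i, V (i + 1) (t + 1 - (i + 1)) ≤ V i (t + 1 - i) := fun t i => by
    refine (hV.succ_fst_le i _).trans (hV.monotone_snd i ?_)
    omega
  have hdiag : ∀ t, Antitone fun i => V i (t + 1 - i) := fun t =>
    antitone_int_of_succ_le (hd t)
  have hbd : ∀ t i, c < V i (t + 1 - i) → i ≤ max 0 (t + 1) := by
    intro t i h
    by_contra hlt
    rw [hV.below i _ (by omega) (by omega)] at h
    exact absurd hc0 (not_le.2 h)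
  have hex : ∀ t, ∃ a, c < V a (t + 1 - a) ∧ ∀ i, c < V i (t + 1 - i) → i ≤ a := fun t =>
    Int.exists_greatest_of_bdd ⟨_, hbd t⟩ ⟨0, by rw [hV.left 0 _ le_rfl]; exact hc⟩
  choose A hA1 hA2 using hex
  have hA : ∀ t i, i ≤ A t ↔ c < V i (t + 1 - i) := fun t i =>
    ⟨fun h => (hA1 t).trans_le (hdiag t h), hA2 t i⟩
  have hnonneg : ∀ t, 0 ≤ A t := fun t => (hA t 0).2 (by rw [hV.left 0 _ le_rfl]; exact hc)
  have hle : ∀ t, A t ≤ A (t + 1) := fun t => by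
    rw [hA]
    exact (hA1 t).trans_le (hV.monotone_snd _ (by omega))
  have hstart : ∀ t ≤ 0, A t = 0 := by
    intro t ht
    refine le_antisymm (not_lt.1 fun h => ?_) (hnonneg t)
    have := (hA t 1).1 h
    rw [hV.below 1 _ le_rfl (by omega)] at this
    exact absurd hc0 (not_le.2 this)
  have hsucc : ∀ t, A (t + 1) ≤ A t + 1 := by
    intro t
    have h := hA1 (t + 1)
    have h2 : A (t + 1) - 1 ≤ A t := by
      rw [hA]
      refine h.trans_le ?_
      have h3 := hV.succ_fst_le (A (t + 1) - 1) (t + 1 + 1 - A (t + 1))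
      rw [show A (t + 1) - 1 + 1 = A (t + 1) by ring] at h3
      rwa [show t + 1 - (A (t + 1) - 1) = t + 1 + 1 - A (t + 1) by ring]
    omega
  refine ⟨A, ⟨hstart, ?_, hle, hsucc, ?_⟩, hA⟩
  · intro t ht
    have : ∀ i, i ≤ A t ↔ i ≤ A (n - 1) := by
      intro i
      rw [hA, hA, hV.outer i _ (by omega), hV.outer i _ (by omega)]
    exact le_antisymm ((this _).1 le_rfl) ((this _).2 le_rfl)
  · intro t ht0 ht
    have hAt : A t ≤ t := by
      have : ∀ s : ℕ, A s ≤ s := by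
        intro s
        induction s with
        | zero => exact (hstart 0 le_rfl).le
        | succ s ih => have := hsucc s; push_cast; omega
      have := this t.toNat
      rwa [Int.toNat_of_nonneg ht0] at this
    refine hV.mem_of_lt hl h0 (hnonneg t) (by omega) (by omega) ?_
    have h1 : ¬ c < V (A t + 1) (t + 1 - (A t + 1)) := fun h => by
      have := hA2 t _ h; omega
    rw [show t + 1 - (A t + 1) = t - A t by ring] at h1
    have h2 := hA1 t
    rw [show t + 1 - A t = t - A t + 1 by ring] at h2
    exact (not_lt.1 h1).trans_lt h2

end IsFilling

/-- `A` bounds the set of boxes where the filling exceeds `c`. -/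
def IsLevelPath (V : ℤ → ℤ → ℝ) (c : ℝ) (A : ℤ → ℤ) : Prop := ∀ t i, i ≤ A t ↔ c < V i (t + 1 - i)

theorem Traces.top_levelPath {P : (ladder n lam).Subgraph} {A : ℤ → ℤ} {c : ℝ} (h : Traces P A)
    (hA : IsLevelPath V c A) (i k : ℤ) : HasTop P i k ↔ V i k ≤ c ∧ c < V i (k + 1) := by
  rw [h.top, hA, hA, not_lt, show i + k - 1 + 1 - i = k by ring, show i + k + 1 - i = k + 1 by ring]

theorem Traces.right_levelPath {P : (ladder n lam).Subgraph} {A : ℤ → ℤ} {c : ℝ} (h : Traces P A)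
    (hA : IsLevelPath V c A) (i k : ℤ) :
    HasRight P i k ↔ 1 ≤ i + k ∧ i + k ≤ (n : ℤ) - 1 ∧ c < V i k ∧ V (i + 1) k ≤ c := by
  rw [h.right, hA, hA, not_lt, show i + k - 1 + 1 - i = k by ring,
    show i + k + 1 - (i + 1) = k by ring]

/-- The contour of a filling is a union of positive paths, namely of the boundaries of its superlevel
sets, and it reaches all terminal vertices. -/
theorem IsFilling.exists_contour (hl : Antitone lam) (h0 : ∀ k, 0 ≤ lam k) (hn : 0 < n)
    (hV : IsFilling n lam V) :
    ∃ S : Set (ladder n lam).Subgraph, (∀ P ∈ S, IsPositivePath n lam P) ∧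
      (∀ t, IsTerminal n lam t → t ∈ (sSup S).verts) ∧ IsContour (sSup S) V := by
  have hanti := wt_antitone hl h0
  set S : Set (ladder n lam).Subgraph := {P | IsPositivePath n lam P ∧
    ∃ c A, 0 ≤ c ∧ Traces P A ∧ IsLevelPath V c A} with hS
  have hpath : ∀ c, 0 ≤ c → c < wt n lam 1 → ∃ P ∈ S, ∃ A, Traces P A ∧ IsLevelPath V c A := by
    intro c hc0 hc
    obtain ⟨A, hA, hAV⟩ := hV.exists_levelPath hl h0 hc0 hc
    obtain ⟨P, hP, hPA⟩ := hA.exists_positivePath hl h0 hn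
    exact ⟨P, ⟨hP, c, A, hc0, hPA, hAV⟩, A, hPA, hAV⟩
  refine ⟨S, fun P hP => hP.1, fun t ht => ?_, fun i k => ?_, fun i k => ?_⟩
  · obtain ⟨hm, hs⟩ := (isTerminal_iff hl h0 t).1 ht
    obtain ⟨h1, h2, h3, h4⟩ := (mem_ladderVertices_iff hl h0 t).1 hm
    rw [show (n : ℤ) - t.2 = t.1 + 1 by omega] at h4
    obtain ⟨P, hPS, A, hPA, hAV⟩ := hpath (wt n lam (t.1 + 1)) (wt_nonneg h0 _)
      (h4.trans_le (by rw [← wt_of_nonpos le_rfl]; exact hanti h1))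
    rw [SimpleGraph.Subgraph.verts_sSup]
    refine Set.mem_biUnion hPS ((hPA.verts t).2 ⟨by omega, by omega, ?_⟩)
    have h5 := (hAV (t.1 + t.2) t.1).2 (by rw [hV.outer _ _ (by omega)]; exact h4)
    have h6 : ¬ t.1 + 1 ≤ A (t.1 + t.2) := by
      rw [hAV, hV.outer _ _ (by omega)]; exact lt_irrefl _
    omega
  · rw [HasTop, SimpleGraph.Subgraph.sSup_adj]
    constructor
    · rintro ⟨P, ⟨-, c, A, -, hPA, hAV⟩, h⟩
      have := (hPA.top_levelPath hAV i k).1 h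
      exact this.1.trans_lt this.2
    · intro h
      obtain ⟨P, hPS, A, hPA, hAV⟩ := hpath (V i k) (hV.nonneg h0 _ _)
        (h.trans_le (hV.le_wt_one _ _))
      exact ⟨P, hPS, (hPA.top_levelPath hAV i k).2 ⟨le_rfl, h⟩⟩
  · rw [HasRight, SimpleGraph.Subgraph.sSup_adj]
    have hi : V (i + 1) k < V i k → 0 ≤ i := by
      intro h
      by_contra hlt
      rw [hV.left _ _ (by omega), hV.left _ _ (by omega)] at h
      exact lt_irrefl _ h
    constructor
    · rintro ⟨P, ⟨-, c, A, hc0, hPA, hAV⟩, h⟩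
      obtain ⟨h1, h2, h3, h4⟩ := (hPA.right_levelPath hAV i k).1 h
      have h5 := hi (h4.trans_lt h3)
      refine ⟨?_, h2, h4.trans_lt h3⟩
      by_contra hk
      rw [hV.below i k (by omega) (by omega)] at h3
      exact absurd hc0 (not_le.2 h3)
    · rintro ⟨h1, h2, h3⟩
      have h5 := hi h3
      obtain ⟨P, hPS, A, hPA, hAV⟩ := hpath (V (i + 1) k) (hV.nonneg h0 _ _)
        (h3.trans_le (hV.le_wt_one _ _))
      exact ⟨P, hPS, (hPA.right_levelPath hAV i k).2 ⟨by omega, h2, h3, le_rfl⟩⟩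

/-! ### Fillings with a given contour -/

/-- The sum of the drops of `λ` at the ends of its blocks, from position `i` on, is `λ_i`. -/
theorem sum_drop (hn : 0 < n) (i : ℤ) :
    ∑ a ∈ Finset.range (n + 1), (wt n lam a - wt n lam (a + 1)) * (if i ≤ (a : ℤ) then 1 else 0)
      = wt n lam (max i 0) := by
  have key : ∀ m : ℕ, ∑ a ∈ Finset.range m,
      (wt n lam a - wt n lam (a + 1)) * (if i ≤ (a : ℤ) then 1 else 0)
      = wt n lam (min (max i 0) m) - wt n lam m := by
    intro m
    induction m with
    | zero => simp
    | succ m ih =>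
      rw [Finset.sum_range_succ, ih]
      push_cast
      split_ifs with h
      · rw [show min (max i 0) ((m : ℤ) + 1) = min (max i 0) m by omega]; ring
      · rw [show min (max i 0) (m : ℤ) = m by omega,
          show min (max i 0) ((m : ℤ) + 1) = m + 1 by omega]; ring
  rw [key, wt_eq_zero (i := ((n + 1 : ℕ) : ℤ)) (by push_cast; omega), sub_zero]
  rcases le_total (max i 0) ((n + 1 : ℕ) : ℤ) with h | h
  · rw [min_eq_left h]
  · rw [min_eq_right h, wt_eq_zero (i := max i 0) (by push_cast at h; omega),
      wt_eq_zero (by push_cast; omega)]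

/-- The filling with a step of height `λ_a - λ_{a+1}` across the path `Q a`, for each `a`. -/
noncomputable def pathFilling (n : ℕ) (lam : Fin (n / 2) → ℝ) (Q : ℤ → ℤ → ℤ) (i k : ℤ) : ℝ :=
  ∑ a ∈ Finset.range (n + 1),
    (wt n lam a - wt n lam (a + 1)) * (if i ≤ Q a (i + k - 1) then 1 else 0)

theorem pathFilling_lt_iff {Q : ℤ → ℤ → ℤ} {i k i' k' : ℤ}
    (hw : ∀ a : ℤ, wt n lam (a + 1) ≤ wt n lam a)
    (himp : ∀ a, wt n lam (a + 1) < wt n lam a → i ≤ Q a (i + k - 1) → i' ≤ Q a (i' + k' - 1)) :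
    pathFilling n lam Q i k ≤ pathFilling n lam Q i' k' ∧
    (pathFilling n lam Q i k < pathFilling n lam Q i' k' ↔ ∃ a : ℕ, a < n + 1 ∧
      wt n lam (a + 1) < wt n lam a ∧ ¬ i ≤ Q a (i + k - 1) ∧ i' ≤ Q a (i' + k' - 1)) := by
  have hterm : ∀ a ∈ Finset.range (n + 1),
      (wt n lam a - wt n lam (a + 1)) * (if i ≤ Q a (i + k - 1) then (1 : ℝ) else 0) ≤
      (wt n lam a - wt n lam (a + 1)) * (if i' ≤ Q a (i' + k' - 1) then 1 else 0) := by
    intro a _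
    rcases (hw a).lt_or_eq with h | h
    · have := himp a h
      have h2 := sub_pos.2 h
      split_ifs with h3 h4 h4
      · exact le_rfl
      · exact absurd (this h3) h4
      · simpa using h2.le
      · exact le_rfl
    · simp [h]
  refine ⟨Finset.sum_le_sum hterm, ?_, ?_⟩
  · intro h
    obtain ⟨a, ha, hlt⟩ := Finset.exists_lt_of_sum_lt h
    refine ⟨a, Finset.mem_range.1 ha, ?_⟩
    rcases (hw a).lt_or_eq with h1 | h1
    · refine ⟨h1, ?_⟩
      have h2 := sub_pos.2 h1
      split_ifs at hlt with h3 h4 h4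
      · exact absurd hlt (lt_irrefl _)
      · simp only [mul_one, mul_zero] at hlt; linarith
      · exact ⟨h3, h4⟩
      · exact absurd hlt (lt_irrefl _)
    · simp [h1] at hlt
  · rintro ⟨a, ha, h1, h2, h3⟩
    refine Finset.sum_lt_sum hterm ⟨a, Finset.mem_range.2 ha, ?_⟩
    rw [if_neg h2, if_pos h3]
    simpa using h1

/-- A family of lattice paths, one for each terminal vertex. -/
def IsPathFamily (n : ℕ) (lam : Fin (n / 2) → ℝ) (Q : ℤ → ℤ → ℤ) : Prop :=
  ∀ a, wt n lam (a + 1) < wt n lam a → IsLatticePath n lam (Q a) ∧ Q a (n - 1) = a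

theorem IsLatticePath.two_mul_le (hl : Antitone lam) (h0 : ∀ k, 0 ≤ lam k) (hn : 0 < n)
    {A : ℤ → ℤ} (hA : IsLatticePath n lam A) {t : ℤ} (ht : 0 ≤ t) : 2 * A t ≤ t + 1 := by
  rcases le_total t ((n : ℤ) - 1) with h | h
  · obtain ⟨-, -, h3, -⟩ := (mem_ladderVertices_iff hl h0 _).1 (hA.mem t ht h)
    simp only [] at h3
    omega
  · obtain ⟨-, -, h3, -⟩ := (mem_ladderVertices_iff hl h0 _).1 (hA.mem (n - 1) (by omega) le_rfl)
    simp only [] at h3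
    rw [hA.finish t h]
    omega

theorem IsLatticePath.nonneg (hA : IsLatticePath n lam A) (t : ℤ) : 0 ≤ A t := by
  have hm : Monotone A := monotone_int_of_le_succ hA.le_succ
  rw [← hA.start (min t 0) (min_le_right _ _)]
  exact hm (min_le_left _ _)

theorem isFilling_pathFilling (hl : Antitone lam) (h0 : ∀ k, 0 ≤ lam k) (hn : 0 < n)
    {Q : ℤ → ℤ → ℤ} (hQ : IsPathFamily n lam Q) : IsFilling n lam (pathFilling n lam Q) := by
  have hw : ∀ a : ℤ, wt n lam (a + 1) ≤ wt n lam a := fun a => wt_antitone hl h0 (by omega)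
  have hsum : ∀ i k j, (∀ a, wt n lam (a + 1) < wt n lam a → (i ≤ Q a (i + k - 1) ↔ j ≤ a)) →
      pathFilling n lam Q i k = wt n lam (max j 0) := by
    intro i k j h
    rw [← sum_drop hn, pathFilling]
    refine Finset.sum_congr rfl fun a _ => ?_
    rcases (hw a).lt_or_eq with h1 | h1
    · rw [if_congr (h a h1) rfl rfl]
    · simp [h1]
  refine ⟨fun i k => (pathFilling_lt_iff hw ?_).1, fun i k => (pathFilling_lt_iff hw ?_).1, ?_, ?_, ?_⟩
  · intro a ha h
    have := (hQ a ha).1.succ_le (i + k - 1)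
    rw [show i + 1 + k - 1 = i + k - 1 + 1 by ring] at h
    omega
  · intro a ha h
    have := (hQ a ha).1.le_succ (i + k - 1)
    rw [show i + (k + 1) - 1 = i + k - 1 + 1 by ring]
    omega
  · intro i k hik
    rw [hsum i k i]
    · rcases le_total i 0 with h | h
      · rw [max_eq_right h, wt_of_nonpos h, wt_of_nonpos le_rfl]
      · rw [max_eq_left h]
    · intro a ha
      rw [(hQ a ha).1.finish _ (by omega), (hQ a ha).2]
  · intro i k hi hk
    rw [pathFilling]
    refine Finset.sum_eq_zero fun a _ => ?_
    rcases (hw a).lt_or_eq with h1 | h1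
    · rw [if_neg, mul_zero]
      intro h
      have hA := (hQ a h1).1
      by_cases ht : 0 ≤ i + k - 1
      · have := hA.two_mul_le hl h0 hn ht
        omega
      · rw [hA.start _ (by omega)] at h
        omega
    · simp [h1]
  · intro i k hi
    rw [hsum i k 0]
    · rw [max_self, wt_of_nonpos le_rfl]
    · intro a ha
      have hA := (hQ a ha).1
      have h1 := hA.nonneg (i + k - 1)
      have h2 := hA.nonneg (n - 1)
      rw [(hQ a ha).2] at h2
      omega

theorem wt_lt_of_isLatticePath (hl : Antitone lam) (h0 : ∀ k, 0 ≤ lam k) (hn : 0 < n) {A : ℤ → ℤ}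
    (hA : IsLatticePath n lam A) : wt n lam (A (n - 1) + 1) < wt n lam (A (n - 1)) := by
  have := ((mem_ladderVertices_iff hl h0 _).1 (hA.mem (n - 1) (by omega) le_rfl)).2.2.2
  simp only [] at this
  rwa [show (n : ℤ) - (n - 1 - A (n - 1)) = A (n - 1) + 1 by ring] at this

/-- Every union of positive paths that reaches all terminal vertices is the contour of a filling. -/
theorem exists_filling (hl : Antitone lam) (h0 : ∀ k, 0 ≤ lam k) (hn : 0 < n)
    {S : Set (ladder n lam).Subgraph} (hS : ∀ P ∈ S, IsPositivePath n lam P)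
    (hterm : ∀ t, IsTerminal n lam t → t ∈ (sSup S).verts) :
    ∃ V, IsFilling n lam V ∧ IsContour (sSup S) V := by
  have hw : ∀ a : ℤ, wt n lam (a + 1) ≤ wt n lam a := fun a => wt_antitone hl h0 (by omega)
  -- the lattice paths of the members of `S`
  set 𝒜 : Set (ℤ → ℤ) := {A | IsLatticePath n lam A ∧ ∃ P ∈ S, Traces P A} with h𝒜
  have hex : ∀ a, ∃ A, wt n lam (a + 1) < wt n lam a → A ∈ 𝒜 ∧ A (n - 1) = a := by
    intro a
    by_cases ha : wt n lam (a + 1) < wt n lam a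
    · have hpos := (wt_nonneg h0 _).trans_lt ha
      have h2 := le_half_of_wt_pos hpos
      have ha0 : 0 ≤ a := by
        by_contra h
        rw [wt_of_nonpos (i := a + 1) (by omega), wt_of_nonpos (i := a) (by omega)] at ha
        exact lt_irrefl _ ha
      have ht : IsTerminal n lam (a, n - 1 - a) := by
        rw [isTerminal_iff hl h0, mem_ladderVertices_iff hl h0]
        simp only []
        have h1 := le_half_of_wt_pos
          (hpos.trans_le ((wt_antitone hl h0 ha0).trans_eq (wt_of_nonpos le_rfl)))
        refine ⟨⟨ha0, by omega, by omega, ?_⟩, by omega⟩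
        rwa [show (n : ℤ) - (n - 1 - a) = a + 1 by ring]
      have hv := hterm _ ht
      rw [SimpleGraph.Subgraph.verts_sSup] at hv
      simp only [Set.mem_iUnion] at hv
      obtain ⟨P, hPS, hv⟩ := hv
      obtain ⟨A, hA, hPA⟩ := (hS P hPS).exists_traces hl h0
      refine ⟨A, fun _ => ⟨⟨hA, P, hPS, hPA⟩, ?_⟩⟩
      have := ((hPA.verts _).1 hv).2.2
      simp only [show a + ((n : ℤ) - 1 - a) = n - 1 by ring] at this
      exact this.symm
    · exact ⟨fun _ => 0, fun h => absurd h ha⟩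
  choose Q0 hQ0 using hex
  -- fillings whose contour is contained in the given graph
  set C : Set (ℤ → ℤ → ℝ) := {V | IsFilling n lam V ∧
    (∀ i k, V i k < V i (k + 1) → HasTop (sSup S) i k) ∧
    (∀ i k, 1 ≤ k → i + k ≤ (n : ℤ) - 1 → V (i + 1) k < V i k → HasRight (sSup S) i k)} with hC
  have hfam : ∀ Q : ℤ → ℤ → ℤ, (∀ a, wt n lam (a + 1) < wt n lam a → Q a ∈ 𝒜 ∧ Q a (n - 1) = a) →
      pathFilling n lam Q ∈ C := by
    intro Q hQ
    have hV := isFilling_pathFilling hl h0 hn (fun a ha => ⟨(hQ a ha).1.1, (hQ a ha).2⟩)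
    refine ⟨hV, fun i k h => ?_, fun i k hk hik h => ?_⟩
    · obtain ⟨a, -, ha, h1, h2⟩ := (pathFilling_lt_iff hw (fun a ha h => by
        have := (hQ a ha).1.1.le_succ (i + k - 1)
        rw [show i + (k + 1) - 1 = i + k - 1 + 1 by ring]
        omega)).2.1 h
      obtain ⟨-, P, hPS, hPA⟩ := (hQ a ha).1
      rw [HasTop, SimpleGraph.Subgraph.sSup_adj]
      refine ⟨P, hPS, (hPA.top i k).2 ⟨h1, ?_⟩⟩
      rwa [show i + (k + 1) - 1 = i + k by ring] at h2
    · obtain ⟨a, -, ha, h1, h2⟩ := (pathFilling_lt_iff hw (fun a ha h => by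
        have := (hQ a ha).1.1.succ_le (i + k - 1)
        rw [show i + 1 + k - 1 = i + k - 1 + 1 by ring] at h
        omega)).2.1 h
      obtain ⟨-, P, hPS, hPA⟩ := (hQ a ha).1
      rw [HasRight, SimpleGraph.Subgraph.sSup_adj]
      have hi : 0 ≤ i := by
        by_contra hlt
        rw [hV.left _ _ (by omega), hV.left _ _ (by omega)] at h
        exact lt_irrefl _ h
      refine ⟨P, hPS, (hPA.right i k).2 ⟨by omega, hik, h2, ?_⟩⟩
      rwa [show i + 1 + k - 1 = i + k by ring] at h1
  -- each path of `S` can be made part of a family of paths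
  have hupd : ∀ A ∈ 𝒜, ∃ Q : ℤ → ℤ → ℤ, pathFilling n lam Q ∈ C ∧
      (∀ a, wt n lam (a + 1) < wt n lam a → IsLatticePath n lam (Q a)) ∧
      Q (A (n - 1)) = A := by
    intro A hA
    have hQ : ∀ a, wt n lam (a + 1) < wt n lam a →
        Function.update Q0 (A (n - 1)) A a ∈ 𝒜 ∧ Function.update Q0 (A (n - 1)) A a (n - 1) = a := by
      intro a ha
      by_cases h : a = A (n - 1)
      · subst h
        rw [Function.update_self]
        exact ⟨hA, rfl⟩
      · rw [Function.update_of_ne h]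
        exact hQ0 a ha
    exact ⟨_, hfam _ hQ, fun a ha => (hQ a ha).1.1, Function.update_self ..⟩
  have hend : ∀ A ∈ 𝒜, ∃ a : ℕ, a < n + 1 ∧ (a : ℤ) = A (n - 1) := by
    intro A hA
    have h1 := hA.1.nonneg (n - 1)
    have h2 := hA.1.two_mul_le hl h0 hn (t := n - 1) (by omega)
    exact ⟨(A (n - 1)).toNat, by omega, by omega⟩
  obtain ⟨V, ⟨hV, hV1, hV2⟩, hgen⟩ := exists_generic (K := Fin (n + 1) × Fin (n + 1) × Bool) C
    ⟨_, hfam Q0 hQ0⟩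
    (fun e V => if e.2.2 then V (e.1 : ℕ) (e.2.1 : ℕ) < V (e.1 : ℕ) ((e.2.1 : ℕ) + 1)
      else V ((e.1 : ℕ) + 1) (e.2.1 : ℕ) < V (e.1 : ℕ) (e.2.1 : ℕ)) (by
    rintro x ⟨hx, hx1, hx2⟩ y ⟨hy, hy1, hy2⟩
    refine ⟨fun i k => (x i k + y i k) / 2, ⟨⟨?_, ?_, ?_, ?_, ?_⟩, ?_, ?_⟩, ?_⟩
    · intro i k
      have := hx.succ_fst_le i k; have := hy.succ_fst_le i k; linarith
    · intro i k
      have := hx.le_succ_snd i k; have := hy.le_succ_snd i k; linarith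
    · intro i k h; rw [hx.outer i k h, hy.outer i k h]; ring
    · intro i k h h'; rw [hx.below i k h h', hy.below i k h h']; ring
    · intro i k h; rw [hx.left i k h, hy.left i k h]; ring
    · intro i k h
      by_contra hno
      have h1 := not_lt.1 (mt (hx1 i k) hno)
      have h2 := not_lt.1 (mt (hy1 i k) hno)
      linarith
    · intro i k hk hik h
      by_contra hno
      have h1 := not_lt.1 (mt (hx2 i k hk hik) hno)
      have h2 := not_lt.1 (mt (hy2 i k hk hik) hno)
      linarith
    · rintro ⟨i, k, b⟩ h
      cases b
      · simp only [Bool.false_eq_true, if_false] at h ⊢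
        have := hx.succ_fst_le i k; have := hy.succ_fst_le i k
        rcases h with h | h <;> linarith
      · simp only [if_true] at h ⊢
        have := hx.le_succ_snd i k; have := hy.le_succ_snd i k
        rcases h with h | h <;> linarith)
  refine ⟨V, hV, fun i k => ⟨fun h => ?_, hV1 i k⟩, fun i k => ⟨fun h => ?_, fun h => hV2 i k h.1 h.2.1 h.2.2⟩⟩
  · have hm := (mem_ladderVertices_iff hl h0 _).1 ((sSup S).adj_sub h).2.2
    have hle := add_le_of_mem hl h0 ((sSup S).adj_sub h).2.2
    simp only [] at hm hle
    have h' := h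
    rw [HasTop, SimpleGraph.Subgraph.sSup_adj] at h'
    obtain ⟨P, hPS, hP⟩ := h'
    obtain ⟨A, hA, hPA⟩ := (hS P hPS).exists_traces hl h0
    obtain ⟨Q, hQC, hQl, hQA⟩ := hupd A ⟨hA, P, hPS, hPA⟩
    obtain ⟨a, ha, haA⟩ := hend A ⟨hA, P, hPS, hPA⟩
    have hg := hgen (⟨i.toNat, by omega⟩, ⟨k.toNat, by omega⟩, true) ⟨_, hQC, by
      simp only [if_true, Int.toNat_of_nonneg hm.1, Int.toNat_of_nonneg hm.2.1]
      refine (pathFilling_lt_iff hw (fun a ha h => ?_)).2.2 ⟨a, ha, ?_, ?_⟩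
      · have := (hQl a ha).le_succ (i + k - 1)
        rw [show i + (k + 1) - 1 = i + k - 1 + 1 by ring]
        omega
      · rw [haA]; exact wt_lt_of_isLatticePath hl h0 hn hA
      · rw [haA, hQA, show i + (k + 1) - 1 = i + k by ring]
        exact (hPA.top i k).1 hP⟩
    simpa only [if_true, Int.toNat_of_nonneg hm.1, Int.toNat_of_nonneg hm.2.1] using hg
  · have hm := (mem_ladderVertices_iff hl h0 _).1 ((sSup S).adj_sub h).2.2
    have hm' := (mem_ladderVertices_iff hl h0 _).1 ((sSup S).adj_sub h).2.1
    have hle := add_le_of_mem hl h0 ((sSup S).adj_sub h).2.2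
    simp only [] at hm hm' hle
    refine ⟨by omega, hle, ?_⟩
    have h' := h
    rw [HasRight, SimpleGraph.Subgraph.sSup_adj] at h'
    obtain ⟨P, hPS, hP⟩ := h'
    obtain ⟨A, hA, hPA⟩ := (hS P hPS).exists_traces hl h0
    obtain ⟨Q, hQC, hQl, hQA⟩ := hupd A ⟨hA, P, hPS, hPA⟩
    obtain ⟨a, ha, haA⟩ := hend A ⟨hA, P, hPS, hPA⟩
    have hg := hgen (⟨i.toNat, by omega⟩, ⟨k.toNat, by omega⟩, false) ⟨_, hQC, by
      simp only [Bool.false_eq_true, if_false, Int.toNat_of_nonneg hm.1, Int.toNat_of_nonneg hm.2.1]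
      refine (pathFilling_lt_iff hw (fun a ha h => ?_)).2.2 ⟨a, ha, ?_, ?_⟩
      · have := (hQl a ha).succ_le (i + k - 1)
        rw [show i + 1 + k - 1 = i + k - 1 + 1 by ring] at h
        omega
      · rw [haA]; exact wt_lt_of_isLatticePath hl h0 hn hA
      · rw [haA, hQA, show i + 1 + k - 1 = i + k by ring]
        exact ⟨((hPA.right i k).1 hP).2.2.2, ((hPA.right i k).1 hP).2.2.1⟩⟩
    simpa only [Bool.false_eq_true, if_false, Int.toNat_of_nonneg hm.1, Int.toNat_of_nonneg hm.2.1]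
      using hg

end

/-! ### The polytope as a polyhedron -/

/-- The relation between the coordinates that the inequalities of the polytope compare: the box of `q`
is the upper or the left neighbour of the box of `p`. -/
def Cov {n : ℕ} (p q : GCIndex n) : Prop :=
  (q.1.1 = p.1.1 ∧ q.1.2 = p.1.2 + 1) ∨ (p.1.1 = q.1.1 + 1 ∧ p.1.2 = q.1.2)

/-- The points of the polytope, in terms of `wt` and `Cov`. -/
structure IsPoint (n : ℕ) (lam : Fin (n / 2) → ℝ) (u : GCIndex n → ℝ) : Prop where
  outer : ∀ p : GCIndex n, p.1.1 + p.1.2 = n → u p = wt n lam p.1.1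
  le : ∀ p q : GCIndex n, Cov p q → diagAbs u p ≤ u q

theorem mem_gcPolytope_iff {n : ℕ} {lam : Fin (n / 2) → ℝ} {u : GCIndex n → ℝ} :
    u ∈ gcPolytope n lam ↔ IsPoint n lam u := by
  constructor
  · rintro ⟨h1, h2, h3⟩
    refine ⟨fun p hp => ?_, fun p q h => ?_⟩
    · have hp2 := p.2
      have hlt : p.1.1 - 1 < n / 2 := by omega
      rw [h1 ⟨p.1.1 - 1, hlt⟩ p (by simp only []; omega) hp, ← wt_natCast_add_one (lam := lam)]
      congr 1
      simp only []
      omega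
    · rcases h with h | h
      · exact h2 p q h.1 h.2
      · exact h3 q p h.1 h.2
  · rintro ⟨h1, h2⟩
    refine ⟨fun k p hp hs => ?_, fun p q h h' => h2 p q (Or.inl ⟨h, h'⟩),
      fun p q h h' => h2 q p (Or.inr ⟨h, h'⟩)⟩
    rw [h1 p hs, ← wt_natCast_add_one (lam := lam) k, hp]
    push_cast
    rfl

/-- The constraints of the polytope: two inequalities for each of the prescribed coordinates, and, for
each pair of compared coordinates, one inequality or two. -/
abbrev GCConstraint (n : ℕ) : Type := (GCIndex n × Bool) ⊕ (GCIndex n × GCIndex n × Bool)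

instance (n : ℕ) : Finite (GCIndex n) :=
  Finite.of_injective (fun p : GCIndex n => ((⟨p.1.1, by have := p.2; omega⟩,
    ⟨p.1.2, by have := p.2; omega⟩) : Fin (n + 1) × Fin (n + 1))) (by
    intro p q h
    simp only [Prod.mk.injEq, Fin.mk.injEq] at h
    exact Subtype.ext (Prod.ext h.1 h.2))

/-- The sign named by a Boolean. -/
def boolSign (s : Bool) : ℝ := if s then 1 else -1

open Classical in
/-- The left-hand sides of the constraints; combinations that are no constraint of the polytope are
replaced by the trivial inequality `0 ≤ 0`. -/
noncomputable def gcForm (n : ℕ) : GCConstraint n → (GCIndex n → ℝ) →L[ℝ] ℝ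
  | Sum.inl (p, s) => if p.1.1 + p.1.2 = n then boolSign s • ContinuousLinearMap.proj p else 0
  | Sum.inr (p, q, s) => if Cov p q ∧ (s = true ∨ p.1.1 = p.1.2) then
      boolSign s • ContinuousLinearMap.proj p - ContinuousLinearMap.proj q else 0

/-- The right-hand sides of the constraints. -/
noncomputable def gcBound (n : ℕ) (lam : Fin (n / 2) → ℝ) : GCConstraint n → ℝ
  | Sum.inl (p, s) => if p.1.1 + p.1.2 = n then boolSign s * wt n lam p.1.1 else 0
  | Sum.inr _ => 0

section

variable {n : ℕ} {lam : Fin (n / 2) → ℝ} {u v w : GCIndex n → ℝ}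

theorem diagAbs_le_iff {p : GCIndex n} {c : ℝ} :
    diagAbs u p ≤ c ↔ u p ≤ c ∧ (p.1.1 = p.1.2 → - u p ≤ c) := by
  unfold diagAbs
  split_ifs with h
  · simp [abs_le', h]
  · simp [h]

theorem gcForm_true {p q : GCIndex n} (hc : Cov p q) :
    gcForm n (Sum.inr (p, q, true)) w = w p - w q := by
  simp [gcForm, hc, boolSign]

theorem gcForm_false {p q : GCIndex n} (hc : Cov p q) (hd : p.1.1 = p.1.2) :
    gcForm n (Sum.inr (p, q, false)) w = -w p - w q := by
  simp [gcForm, hc, hd, boolSign]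

theorem gcPolytope_eq_polyhedron : gcPolytope n lam = polyhedron (gcForm n) (gcBound n lam) := by
  ext u
  rw [mem_gcPolytope_iff]
  constructor
  · rintro ⟨h1, h2⟩ (⟨p, s⟩ | ⟨p, q, s⟩)
    · simp only [gcForm, gcBound]
      split_ifs with hp
      · simp [h1 p hp]
      · simp
    · simp only [gcForm, gcBound]
      split_ifs with hc
      · obtain ⟨hc, hs⟩ := hc
        have h3 := diagAbs_le_iff.1 (h2 p q hc)
        cases s
        · have := h3.2 (by simpa using hs)
          simp [boolSign]; linarith
        · simp [boolSign, h3.1]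
      · simp
  · intro h
    refine ⟨fun p hp => ?_, fun p q hc => diagAbs_le_iff.2 ⟨?_, fun hd => ?_⟩⟩
    · have h1 := h (Sum.inl (p, true))
      have h2 := h (Sum.inl (p, false))
      simp only [gcForm, gcBound, if_pos hp, boolSign] at h1 h2
      simp at h1 h2
      linarith
    · have h1 := h (Sum.inr (p, q, true))
      simp only [gcForm, gcBound, boolSign] at h1
      rw [if_pos ⟨hc, Or.inl rfl⟩] at h1
      simpa using h1
    · have h1 := h (Sum.inr (p, q, false))
      simp only [gcForm, gcBound, boolSign] at h1
      rw [if_pos ⟨hc, Or.inr hd⟩] at h1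
      simp at h1
      linarith

/-- Tightness at `v` implies tightness at `u`, spelled out. -/
def TightLE (v u : GCIndex n → ℝ) : Prop :=
  ∀ p q : GCIndex n, Cov p q → (v p = v q → u p = u q) ∧ (p.1.1 = p.1.2 → -v p = v q → -u p = u q)

theorem tight_subset_iff (hu : IsPoint n lam u) :
    tight (gcForm n) (gcBound n lam) v ⊆ tight (gcForm n) (gcBound n lam) u ↔ TightLE v u := by
  constructor
  · intro h p q hc
    refine ⟨fun he => ?_, fun hd he => ?_⟩
    · have h1 := @h (Sum.inr (p, q, true))
      simp only [tight, Set.mem_ofPred_eq, gcForm_true hc, gcBound, sub_eq_zero] at h1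
      exact h1 he
    · have h1 := @h (Sum.inr (p, q, false))
      simp only [tight, Set.mem_ofPred_eq, gcForm_false hc hd, gcBound, sub_eq_zero] at h1
      exact h1 he
  · rintro h (⟨p, s⟩ | ⟨p, q, s⟩)
    · intro _
      simp only [tight, Set.mem_ofPred_eq, gcForm, gcBound]
      split_ifs with hp
      · simp [hu.outer p hp]
      · simp
    · simp only [tight, Set.mem_ofPred_eq, gcForm, gcBound]
      split_ifs with hc
      · obtain ⟨hc, hs⟩ := hc
        cases s
        · simpa [boolSign, sub_eq_zero] using (h p q hc).2 (by simpa using hs)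
        · simpa [boolSign, sub_eq_zero] using (h p q hc).1
      · simp

/-- The direction space of the smallest face containing `u`. -/
theorem mem_vectorSpan_gcFace_iff (hu : IsPoint n lam u) :
    w ∈ vectorSpan ℝ (faceAt (gcForm n) (gcBound n lam) u) ↔
      (∀ p : GCIndex n, p.1.1 + p.1.2 = n → w p = 0) ∧ TightLE u w := by
  rw [mem_vectorSpan_faceAt (gcPolytope_eq_polyhedron ▸ mem_gcPolytope_iff.2 hu)]
  constructor
  · intro h
    refine ⟨fun p hp => ?_, fun p q hc => ⟨fun he => ?_, fun hd he => ?_⟩⟩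
    · have h1 := h (Sum.inl (p, true))
      simp only [tight, Set.mem_ofPred_eq, gcForm, gcBound, if_pos hp, boolSign] at h1
      simpa using h1 (by simp [hu.outer p hp])
    · have h1 := h (Sum.inr (p, q, true))
      simp only [tight, Set.mem_ofPred_eq, gcForm_true hc, gcBound, sub_eq_zero] at h1
      exact h1 he
    · have h1 := h (Sum.inr (p, q, false))
      simp only [tight, Set.mem_ofPred_eq, gcForm_false hc hd, gcBound, sub_eq_zero] at h1
      exact h1 he
  · rintro ⟨h1, h2⟩ (⟨p, s⟩ | ⟨p, q, s⟩)
    · intro _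
      simp only [gcForm]
      split_ifs with hp
      · simp [h1 p hp]
      · simp
    · simp only [tight, Set.mem_ofPred_eq, gcForm, gcBound]
      split_ifs with hc
      · obtain ⟨hc, hs⟩ := hc
        cases s
        · simpa [boolSign, sub_eq_zero] using (h2 p q hc).2 (by simpa using hs)
        · simpa [boolSign, sub_eq_zero] using (h2 p q hc).1
      · simp

/-! ### Points of the polytope as signed fillings -/

/-- The index of the coordinate of a box. -/
def boxIndex (n : ℕ) (i k : ℤ) (h : 1 ≤ i ∧ i ≤ k ∧ i + k ≤ n) : GCIndex n :=
  ⟨(i.toNat, k.toNat), by omega⟩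

theorem boxIndex_natCast (p : GCIndex n) (h : 1 ≤ (p.1.1 : ℤ) ∧ (p.1.1 : ℤ) ≤ p.1.2 ∧
    (p.1.1 : ℤ) + p.1.2 ≤ n) : boxIndex n p.1.1 p.1.2 h = p :=
  Subtype.ext (Prod.ext (Int.toNat_natCast _) (Int.toNat_natCast _))

theorem index_spec (p : GCIndex n) : 1 ≤ (p.1.1 : ℤ) ∧ (p.1.1 : ℤ) ≤ p.1.2 ∧
    (p.1.1 : ℤ) + p.1.2 ≤ n := by
  have := p.2; omega

theorem exists_index {i k : ℤ} (h : 1 ≤ i ∧ i ≤ k ∧ i + k ≤ n) :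
    ∃ p : GCIndex n, (p.1.1 : ℤ) = i ∧ (p.1.2 : ℤ) = k :=
  ⟨boxIndex n i k h, Int.toNat_of_nonneg (by omega), Int.toNat_of_nonneg (by omega)⟩

/-- The filling of the plane by the absolute values of the coordinates of `u`. -/
noncomputable def absFill (n : ℕ) (lam : Fin (n / 2) → ℝ) (u : GCIndex n → ℝ) (i k : ℤ) : ℝ :=
  if i ≤ 0 then wt n lam 1 else if h : 1 ≤ i ∧ i ≤ k ∧ i + k ≤ n then |u (boxIndex n i k h)|
  else if k < i then 0 else wt n lam i

theorem absFill_index (p : GCIndex n) : absFill n lam u p.1.1 p.1.2 = |u p| := by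
  have h := index_spec p
  rw [absFill, if_neg (by omega), dif_pos h, boxIndex_natCast]

theorem Cov.snd_ne {p q : GCIndex n} (h : Cov p q) : q.1.1 ≠ q.1.2 := by
  have := p.2; have := q.2
  rcases h with h | h <;> omega

theorem exists_cov {p : GCIndex n} (h : p.1.1 + p.1.2 < n) : ∃ q : GCIndex n,
    q.1.1 = p.1.1 ∧ q.1.2 = p.1.2 + 1 ∧ Cov p q := by
  have := p.2
  exact ⟨⟨(p.1.1, p.1.2 + 1), by simp only []; omega⟩, rfl, rfl, Or.inl ⟨rfl, rfl⟩⟩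

theorem IsPoint.nonneg (h0 : ∀ k, 0 ≤ lam k) (hu : IsPoint n lam u) :
    ∀ (m : ℕ) (p : GCIndex n), p.1.2 ≤ p.1.1 + m → 0 ≤ diagAbs u p := by
  intro m
  induction m with
  | zero =>
    intro p hp
    have := p.2
    rw [diagAbs, if_pos (by omega)]
    exact abs_nonneg _
  | succ m ih =>
    intro p hp
    by_cases hd : p.1.1 = p.1.2
    · rw [diagAbs, if_pos hd]; exact abs_nonneg _
    · rw [diagAbs, if_neg hd]
      have hp2 := p.2
      by_cases hs : p.1.1 + p.1.2 = n
      · rw [hu.outer p hs]; exact wt_nonneg h0 _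
      · exact (ih ⟨(p.1.1 + 1, p.1.2), by simp only []; omega⟩ (by simp only []; omega)).trans
          (hu.le _ p (Or.inr ⟨rfl, rfl⟩))

theorem IsPoint.diagAbs_eq (h0 : ∀ k, 0 ≤ lam k) (hu : IsPoint n lam u) (p : GCIndex n) :
    diagAbs u p = |u p| := by
  have := hu.nonneg h0 p.1.2 p (by omega)
  unfold diagAbs at this ⊢
  split_ifs at this ⊢ with h
  · rfl
  · rw [abs_of_nonneg this]

theorem IsPoint.nonneg_of_ne (h0 : ∀ k, 0 ≤ lam k) (hu : IsPoint n lam u) {p : GCIndex n}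
    (h : p.1.1 ≠ p.1.2) : 0 ≤ u p := by
  have := hu.nonneg h0 p.1.2 p (by omega)
  rwa [diagAbs, if_neg h] at this

theorem IsPoint.abs_le (h0 : ∀ k, 0 ≤ lam k) (hu : IsPoint n lam u) {p q : GCIndex n}
    (h : Cov p q) : |u p| ≤ u q := hu.diagAbs_eq h0 p ▸ hu.le p q h

theorem IsPoint.isFilling (hl : Antitone lam) (h0 : ∀ k, 0 ≤ lam k) (hu : IsPoint n lam u) :
    IsFilling n lam (absFill n lam u) := by
  have hanti := wt_antitone hl h0
  have hw0 := wt_nonneg (n := n) h0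
  have houter : ∀ i k, (n : ℤ) ≤ i + k → absFill n lam u i k = wt n lam i := by
    intro i k hik
    by_cases hi : i ≤ 0
    · rw [absFill, if_pos hi, wt_of_nonpos hi]
    · by_cases h : 1 ≤ i ∧ i ≤ k ∧ i + k ≤ n
      · obtain ⟨p, rfl, rfl⟩ := exists_index h
        rw [absFill_index, hu.outer p (by omega), abs_of_nonneg (hw0 _)]
      · rw [absFill, if_neg hi, dif_neg h]
        split_ifs with hk
        · rw [wt_eq_zero (by omega)]
        · rfl
  have hbelow : ∀ i k, 1 ≤ i → k < i → absFill n lam u i k = 0 := by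
    intro i k hi hk
    rw [absFill, if_neg (by omega), dif_neg (by omega), if_pos hk]
  have hleft : ∀ i k, i ≤ 0 → absFill n lam u i k = wt n lam 1 := by
    intro i k hi
    rw [absFill, if_pos hi]
  have hnonneg : ∀ i k, 0 ≤ absFill n lam u i k := by
    intro i k
    unfold absFill
    split_ifs
    · exact hw0 _
    · exact abs_nonneg _
    · exact le_rfl
    · exact hw0 _
  have hsnd : ∀ i k, absFill n lam u i k ≤ absFill n lam u i (k + 1) := by
    intro i k
    by_cases hi : i ≤ 0
    · rw [hleft i _ hi, hleft i _ hi]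
    · by_cases hk : k < i
      · rw [hbelow i k (by omega) hk]; exact hnonneg _ _
      · by_cases hs : (n : ℤ) ≤ i + k
        · rw [houter _ _ hs, houter _ _ (by omega)]
        · obtain ⟨p, hp1, hp2⟩ := exists_index (n := n) (i := i) (k := k) (by omega)
          obtain ⟨q, hq1, hq2, hc⟩ := exists_cov (p := p) (by omega)
          have h1 := absFill_index (lam := lam) (u := u) p
          have h2 := absFill_index (lam := lam) (u := u) q
          rw [hq1, hq2] at h2
          push_cast at h2
          rw [hp1, hp2] at h1 h2
          rw [h1, h2]
          exact (hu.abs_le h0 hc).trans (le_abs_self _)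
  have hmono : ∀ i, Monotone (absFill n lam u i) := fun i => monotone_int_of_le_succ (hsnd i)
  refine ⟨fun i k => ?_, hsnd, houter, hbelow, hleft⟩
  by_cases hi : i + 1 ≤ 0
  · rw [hleft _ _ hi, hleft _ _ (by omega)]
  · have hwt : ∀ i k, absFill n lam u i k ≤ wt n lam i := fun i k => by
      rw [← houter i (max k (n - i)) (by omega)]
      exact hmono i (le_max_left _ _)
    by_cases hi' : i ≤ 0
    · rw [hleft i k hi', ← wt_of_nonpos hi']
      exact (hwt _ _).trans (hanti (by omega))
    · by_cases hk : k < i + 1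
      · rw [hbelow _ k (by omega) hk]; exact hnonneg _ _
      · by_cases hs : (n : ℤ) ≤ i + k
        · rw [houter _ _ hs, houter _ _ (by omega)]; exact hanti (by omega)
        · obtain ⟨p, hp1, hp2⟩ := exists_index (n := n) (i := i + 1) (k := k) (by omega)
          obtain ⟨q, hq1, hq2⟩ := exists_index (n := n) (i := i) (k := k) (by omega)
          have h1 := absFill_index (lam := lam) (u := u) p
          have h2 := absFill_index (lam := lam) (u := u) q
          rw [hp1, hp2] at h1
          rw [hq1, hq2] at h2
          rw [h1, h2]
          exact (hu.abs_le h0 (Or.inr ⟨by omega, by omega⟩)).trans (le_abs_self _)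

/-- A filling with signs on the diagonal, positive where the value is prescribed, is a point. -/
theorem IsFilling.isPoint_signed (h0 : ∀ k, 0 ≤ lam k) {V : ℤ → ℤ → ℝ} (hV : IsFilling n lam V)
    {σ : GCIndex n → ℝ} (hσ : ∀ p, σ p = 1 ∨ σ p = -1)
    (hσ1 : ∀ p : GCIndex n, σ p = -1 → p.1.1 = p.1.2 ∧ p.1.1 + p.1.2 < n) :
    IsPoint n lam (fun p => σ p * V p.1.1 p.1.2) ∧
      absFill n lam (fun p => σ p * V p.1.1 p.1.2) = V := by
  have habs : ∀ p : GCIndex n, |σ p * V p.1.1 p.1.2| = V p.1.1 p.1.2 := by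
    intro p
    rcases hσ p with h | h <;> simp [h, abs_of_nonneg (hV.nonneg h0 _ _)]
  refine ⟨⟨fun p hp => ?_, fun p q hc => ?_⟩, ?_⟩
  · rcases hσ p with h | h
    · rw [h, one_mul, hV.outer _ _ (by omega)]
    · have := (hσ1 p h).2; omega
  · have hq : σ q = 1 := (hσ q).resolve_right fun h => hc.snd_ne (hσ1 q h).1
    rw [hq, one_mul]
    have h1 : V p.1.1 p.1.2 ≤ V q.1.1 q.1.2 := by
      rcases hc with ⟨h1, h2⟩ | ⟨h1, h2⟩
      · rw [h1, h2]; push_cast; exact hV.le_succ_snd _ _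
      · rw [h1, h2]; push_cast; exact hV.succ_fst_le _ _
    refine diagAbs_le_iff.2 ⟨?_, fun _ => ?_⟩
    · exact (le_abs_self _).trans ((habs p).le.trans h1)
    · exact (neg_le_abs _).trans ((habs p).le.trans h1)
  · funext i k
    by_cases hi : i ≤ 0
    · rw [absFill, if_pos hi, hV.left _ _ hi]
    · by_cases h : 1 ≤ i ∧ i ≤ k ∧ i + k ≤ n
      · obtain ⟨p, rfl, rfl⟩ := exists_index h
        rw [absFill_index, habs]
      · rw [absFill, if_neg hi, dif_neg h]
        split_ifs with hk
        · rw [hV.below _ _ (by omega) hk]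
        · rw [hV.outer _ _ (by omega)]

end

/-! ### Isograms and generic points -/

/-- A filling is generic on the diagonal if a diagonal value vanishes only when it is forced to by one
of its two neighbours. -/
def DiagGeneric (V : ℤ → ℤ → ℝ) : Prop := ∀ i, 1 ≤ i → V i i = 0 → V i (i + 1) = 0 ∨ V (i - 1) i = 0

section

variable {n : ℕ} {lam : Fin (n / 2) → ℝ} {V : ℤ → ℤ → ℝ} {γ δ : (ladder n lam).Subgraph}

theorem IsContour.hasLeft_iff (hγ : IsContour γ V) (i : ℤ) :
    HasLeft γ i i ↔ 1 ≤ i ∧ 2 * i ≤ n ∧ V i i < V (i - 1) i := by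
  have h := hγ.right (i - 1) i
  rw [show i - 1 + 1 = i by ring, show (i - 1 + i ≤ (n : ℤ) - 1) ↔ 2 * i ≤ n by omega] at h
  exact h

theorem IsContour.hasBottom_iff (hV : IsFilling n lam V) (hγ : IsContour γ V)
    {i : ℤ} (hi : 1 ≤ i) : HasBottom γ i i ↔ 0 < V i i := by
  have h := hγ.top i (i - 1)
  rw [show i - 1 + 1 = i by ring, hV.below i (i - 1) hi (by omega)] at h
  exact h

theorem IsContour.hasRight_iff (hV : IsFilling n lam V) (hγ : IsContour γ V)
    {i : ℤ} (hi : 1 ≤ i) : HasRight γ i i ↔ 2 * i ≤ (n : ℤ) - 1 ∧ 0 < V i i := by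
  have h := hγ.right i i
  rw [hV.below (i + 1) i (by omega) (by omega)] at h
  rw [h]
  constructor
  · rintro ⟨-, h1, h2⟩; exact ⟨by omega, h2⟩
  · rintro ⟨h1, h2⟩; exact ⟨hi, by omega, h2⟩

/-- At a box that touches the outer boundary the value does not change upwards. -/
theorem IsFilling.two_mul_lt (hV : IsFilling n lam V) {i : ℤ} (h : V i i < V i (i + 1)) :
    2 * i ≤ (n : ℤ) - 1 := by
  by_contra hlt
  rw [hV.outer i i (by omega), hV.outer i (i + 1) (by omega)] at h
  exact lt_irrefl _ h

theorem IsContour.hasFullBox_iff (hV : IsFilling n lam V) (hγ : IsContour γ V)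
    {i : ℤ} (hi : 1 ≤ i) :
    HasFullBox γ i ↔ 0 < V i i ∧ V i i < V i (i + 1) ∧ V i i < V (i - 1) i := by
  rw [HasFullBox, hγ.top, hγ.hasLeft_iff, hγ.hasBottom_iff hV hi, hγ.hasRight_iff hV hi]
  constructor
  · rintro ⟨h1, ⟨-, -, h2⟩, h3, -⟩; exact ⟨h3, h1, h2⟩
  · rintro ⟨h3, h1, h2⟩
    have := hV.two_mul_lt h1
    exact ⟨h1, ⟨hi, by omega, h2⟩, h3, by omega, h3⟩

theorem IsContour.diagGeneric (h0 : ∀ k, 0 ≤ lam k) (hV : IsFilling n lam V) (hγ : IsContour γ V)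
    (hiso : IsIsogram n lam γ) : DiagGeneric V := by
  intro i hi hz
  by_contra hno
  push Not at hno
  have h1 : V i i < V i (i + 1) := by rw [hz]; exact lt_of_le_of_ne (hV.nonneg h0 _ _) hno.1.symm
  have h2 : V i i < V (i - 1) i := by rw [hz]; exact lt_of_le_of_ne (hV.nonneg h0 _ _) hno.2.symm
  have h3 := hV.two_mul_lt h1
  have := (hiso.2.2 i ((hγ.top i i).2 h1) ((hγ.hasLeft_iff i).2 ⟨hi, by omega, h2⟩)).1
  rw [hγ.hasBottom_iff hV hi, hz] at this
  exact lt_irrefl _ this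

/-- The contour of a filling that is generic on the diagonal is an isogram. -/
theorem IsFilling.exists_isogram (hl : Antitone lam) (h0 : ∀ k, 0 ≤ lam k) (hn : 0 < n)
    (hV : IsFilling n lam V) (hgen : DiagGeneric V) :
    ∃ γ : (ladder n lam).Subgraph, IsIsogram n lam γ ∧ IsContour γ V := by
  obtain ⟨S, hS, hterm, hc⟩ := hV.exists_contour hl h0 hn
  refine ⟨sSup S, ⟨⟨S, hS, rfl⟩, hterm, fun i h1 h2 => ?_⟩, hc⟩
  rw [hc.top] at h1
  obtain ⟨hi, -, h2⟩ := (hc.hasLeft_iff i).1 h2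
  have hpos : 0 < V i i := by
    refine lt_of_le_of_ne (hV.nonneg h0 _ _) fun hz => ?_
    rcases hgen i hi hz.symm with h | h
    · rw [h] at h1; exact absurd (hV.nonneg h0 i i) (not_le.2 h1)
    · rw [h] at h2; exact absurd (hV.nonneg h0 i i) (not_le.2 h2)
  exact ⟨(hc.hasBottom_iff hV hi).2 hpos, (hc.hasRight_iff hV hi).2 ⟨hV.two_mul_lt h1, hpos⟩⟩

theorem IsIsogram.exists_filling (hl : Antitone lam) (h0 : ∀ k, 0 ≤ lam k) (hn : 0 < n)
    (h : IsIsogram n lam γ) : ∃ V, IsFilling n lam V ∧ IsContour γ V := by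
  obtain ⟨⟨S, hS, rfl⟩, hterm, -⟩ := h
  exact GelfandCetlin.exists_filling hl h0 hn hS hterm

/-! ### Heights over a column -/

theorem mem_heights_iff {j y : ℤ} : y ∈ heights γ j ↔ HasTop γ (j + 1) y := by
  rw [HasTop, show j + 1 - 1 = j by ring]; rfl

theorem IsContour.baseHeight_spec (h0 : ∀ k, 0 ≤ lam k) (hV : IsFilling n lam V) (hγ : IsContour γ V)
    {j : ℤ} (hj : 0 ≤ j) (hw : 0 < wt n lam (j + 1)) :
    V (j + 1) (baseHeight γ j) = 0 ∧ 0 < V (j + 1) (baseHeight γ j + 1) := by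
  obtain ⟨y, hy, hmin⟩ := Int.exists_least_of_bdd (P := fun y => 0 < V (j + 1) (y + 1))
    ⟨j, fun z hz => by
      by_contra hlt
      rw [hV.below _ _ (by omega) (by omega)] at hz
      exact lt_irrefl _ hz⟩ ⟨n, by rw [hV.outer _ _ (by omega)]; exact hw⟩
  have hy0 : V (j + 1) y = 0 := by
    refine le_antisymm (not_lt.1 fun h => ?_) (hV.nonneg h0 _ _)
    have := hmin (y - 1) (by rwa [show y - 1 + 1 = y by ring])
    omega
  have hleast : IsLeast (heights γ j) y := by
    refine ⟨mem_heights_iff.2 ((hγ.top _ _).2 (by rw [hy0]; exact hy)), fun z hz => hmin z ?_⟩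
    exact (hV.nonneg h0 _ _).trans_lt ((hγ.top _ _).1 (mem_heights_iff.1 hz))
  rw [baseHeight, hleast.csInf_eq]
  exact ⟨hy0, hy⟩

theorem IsContour.baseHeight_le_iff (h0 : ∀ k, 0 ≤ lam k) (hV : IsFilling n lam V)
    (hγ : IsContour γ V) {j : ℤ} (hj : 0 ≤ j) (hw : 0 < wt n lam (j + 1)) (y : ℤ) :
    baseHeight γ j ≤ y ↔ 0 < V (j + 1) (y + 1) := by
  obtain ⟨h1, h2⟩ := hγ.baseHeight_spec h0 hV hj hw
  constructor
  · intro h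
    exact h2.trans_le (hV.monotone_snd _ (by omega))
  · intro h
    by_contra hlt
    exact absurd (hV.monotone_snd (j + 1) (show y + 1 ≤ baseHeight γ j by omega))
      (not_le.2 (by rw [h1]; exact h))

theorem IsContour.le_baseHeight (h0 : ∀ k, 0 ≤ lam k) (hV : IsFilling n lam V) (hγ : IsContour γ V)
    {j : ℤ} (hj : 0 ≤ j) (hw : 0 < wt n lam (j + 1)) : j ≤ baseHeight γ j := by
  by_contra h
  have := (hγ.baseHeight_le_iff h0 hV hj hw (j - 1)).1 (by omega)
  rw [hV.below _ _ (by omega) (by omega)] at this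
  exact lt_irrefl _ this

/-! ### Coastlines -/

theorem heights_sSup_eq {d : ℤ → Set ℤ}
    (hδ : δ = sSup {P | IsPositivePath n lam P ∧ ∀ j, heights P j ⊆ d j}) {j : ℤ}
    (hd : d j ⊆ heights δ j) : heights δ j = d j := by
  refine subset_antisymm ?_ hd
  intro y hy
  rw [mem_heights_iff, hδ, HasTop, SimpleGraph.Subgraph.sSup_adj] at hy
  obtain ⟨P, ⟨-, hP⟩, hy⟩ := hy
  exact hP j (mem_heights_iff.2 hy)

theorem IsCoastline.isSegmentChoice (h : IsCoastline n lam γ δ) :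
    IsSegmentChoice n lam γ (heights δ) := by
  obtain ⟨d, hd, hδ, hsub⟩ := h
  intro j hj hjN
  rw [heights_sSup_eq hδ (hsub j hj hjN)]
  exact hd j hj hjN

theorem column_of_mem_heights (hl : Antitone lam) (h0 : ∀ k, 0 ≤ lam k) {j y : ℤ}
    (h : y ∈ heights γ j) : 0 ≤ j ∧ 0 < wt n lam (j + 1) := by
  have h1 := (mem_ladderVertices_iff hl h0 _).1 (γ.adj_sub h).2.1
  have h2 := (mem_ladderVertices_iff hl h0 _).1 (γ.adj_sub h).2.2
  exact ⟨h1.1, (wt_nonneg h0 _).trans_lt h2.2.2.2⟩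

theorem IsCoastline.eq_sSup (hl : Antitone lam) (h0 : ∀ k, 0 ≤ lam k) (h : IsCoastline n lam γ δ) :
    δ = sSup {P | IsPositivePath n lam P ∧ ∀ j : ℤ, 0 ≤ j → j < numNonzero n lam →
      heights P j ⊆ heights δ j} := by
  obtain ⟨d, -, hδ, hsub⟩ := h
  conv_lhs => rw [hδ]
  congr 1
  ext P
  refine and_congr_right fun _ => ⟨fun h j hj hjN => ?_, fun h j y hy => ?_⟩
  · rw [heights_sSup_eq hδ (hsub j hj hjN)]; exact h j
  · obtain ⟨hj, hw⟩ := column_of_mem_heights hl h0 hy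
    have hjN := (lt_numNonzero_iff_wt hl h0 hj).2 hw
    rw [← heights_sSup_eq hδ (hsub j hj hjN)]
    exact h j hj hjN hy

/-- The height of the coastline is forced over a column where the base of the isogram runs along the
top of the diagonal box: by the isogram condition the path to its left is already too high for the
lower choice. -/
theorem IsCoastline.heights_eq_of_base (hl : Antitone lam) (h0 : ∀ k, 0 ≤ lam k)
    (hiso : IsIsogram n lam γ) (hδ : IsCoastline n lam γ δ) (hV : IsFilling n lam V)
    (hγ : IsContour γ V) {j : ℤ} (hj : 0 ≤ j)
    (hw : 0 < wt n lam (j + 1)) (hb : baseHeight γ j = j + 1) : heights δ j = {j + 1} := by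
  have hgen := hγ.diagGeneric h0 hV hiso
  obtain ⟨h1, h2⟩ := hγ.baseHeight_spec h0 hV hj hw
  rw [hb] at h1 h2
  have hjN := (lt_numNonzero_iff_wt hl h0 hj).2 hw
  have hch := hδ.isSegmentChoice
  have hnf : ¬ HasFullBox γ (j + 1) := by
    rw [hγ.hasFullBox_iff hV (by omega), h1]
    exact fun h => lt_irrefl _ h.1
  refine ((hch j hj hjN).2.2 hb.le hnf).resolve_left fun hd => ?_
  have hleft : V j (j + 1) = 0 := by
    have := hgen (j + 1) (by omega) h1
    rw [show j + 1 - 1 = j by ring] at this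
    exact this.resolve_left h2.ne'
  have hj1 : 1 ≤ j := by
    by_contra h
    rw [hV.left j _ (by omega)] at hleft
    exact absurd (wt_antitone hl h0 (show (1 : ℤ) ≤ j + 1 by omega)) (by rw [hleft]; exact not_le.2 hw)
  have hw' : 0 < wt n lam (j - 1 + 1) := hw.trans_le (wt_antitone hl h0 (by omega))
  have hj0' : 0 ≤ j - 1 := by omega
  have hb' : j < baseHeight γ (j - 1) := by
    by_contra h
    have := (hγ.baseHeight_le_iff h0 hV hj0' hw' j).1 (by omega)
    rw [show j - 1 + 1 = j by ring, hleft] at this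
    exact lt_irrefl _ this
  have hd' := (hch (j - 1) hj0' ((lt_numNonzero_iff_wt hl h0 hj0').2 hw')).1 (by omega)
  have hmem : j ∈ heights δ j := by rw [hd]; rfl
  rw [mem_heights_iff, hδ.eq_sSup hl h0, HasTop, SimpleGraph.Subgraph.sSup_adj] at hmem
  obtain ⟨P, ⟨hP, hPd⟩, hPj⟩ := hmem
  obtain ⟨A, hA, hPA⟩ := hP.exists_traces hl h0
  obtain ⟨ha, -⟩ := (hPA.top _ _).1 hPj
  have h3 := ((hPA.top _ _).1 hPj).2
  have h4 := hA.succ_le (j + 1 + j - 1)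
  rw [show j + 1 + j - 1 + 1 = j + 1 + j by ring] at h4
  -- the step of the path over the previous column
  obtain ⟨s, hs, hmin⟩ := Int.exists_least_of_bdd (P := fun s => j ≤ A s)
    ⟨0, fun z hz => by
      by_contra hlt
      rw [hA.start z (by omega)] at hz
      omega⟩ ⟨j + 1 + j - 1, by omega⟩
  have hs2 := hmin (j + 1 + j - 1) (by omega)
  have hstep : HasTop P (j - 1 + 1) (s - j) := by
    rw [hPA.top, show j - 1 + 1 + (s - j) - 1 = s - 1 by ring, show j - 1 + 1 + (s - j) = s by ring]
    refine ⟨fun h => ?_, by omega⟩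
    have := hmin (s - 1) (by omega)
    omega
  have := hPd (j - 1) hj0' ((lt_numNonzero_iff_wt hl h0 hj0').2 hw') (mem_heights_iff.2 hstep)
  rw [hd', Set.mem_singleton_iff] at this
  omega

/-- The filling with the diagonal values at the positions in `I` replaced by zero. -/
noncomputable def zeroDiag (V : ℤ → ℤ → ℝ) (I : Set ℤ) (i k : ℤ) : ℝ :=
  open Classical in if k = i ∧ i ∈ I then 0 else V i k

theorem IsFilling.zeroDiag (h0 : ∀ k, 0 ≤ lam k) (hV : IsFilling n lam V) {I : Set ℤ}
    (hI : ∀ i ∈ I, 1 ≤ i ∧ 2 * i ≤ (n : ℤ) - 1) : IsFilling n lam (zeroDiag V I) := by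
  refine ⟨fun i k => ?_, fun i k => ?_, fun i k h => ?_, fun i k hi hk => ?_, fun i k hi => ?_⟩
  · unfold GelfandCetlin.zeroDiag
    split_ifs with h1 h2 h2
    · exact le_rfl
    · exact hV.nonneg h0 _ _
    · have := hI i h2.2
      rw [hV.below _ _ (by omega) (by omega)]
    · exact hV.succ_fst_le i k
  · unfold GelfandCetlin.zeroDiag
    split_ifs with h1 h2 h2
    · exact le_rfl
    · exact hV.nonneg h0 _ _
    · have := hI i h2.2
      rw [hV.below _ _ (by omega) (by omega)]
    · exact hV.le_succ_snd i k
  · unfold GelfandCetlin.zeroDiag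
    rw [if_neg, hV.outer i k h]
    rintro ⟨rfl, h2⟩
    have := hI k h2
    omega
  · unfold GelfandCetlin.zeroDiag
    rw [if_neg (by omega), hV.below i k hi hk]
  · unfold GelfandCetlin.zeroDiag
    rw [if_neg, hV.left i k hi]
    rintro ⟨-, h2⟩
    have := hI i h2
    omega

/-- The lowest path of a filling, raised over the diagonal boxes in `I`. -/
theorem exists_path_zeroDiag (hl : Antitone lam) (h0 : ∀ k, 0 ≤ lam k) (hn : 0 < n)
    (hw1 : 0 < wt n lam 1) (hV : IsFilling n lam V) {I : Set ℤ}
    (hI : ∀ i ∈ I, 1 ≤ i ∧ 2 * i ≤ (n : ℤ) - 1) :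
    ∃ P : (ladder n lam).Subgraph, IsPositivePath n lam P ∧
      ∀ i k, HasTop P i k ↔ zeroDiag V I i k = 0 ∧ 0 < zeroDiag V I i (k + 1) := by
  have hF := hV.zeroDiag h0 hI
  obtain ⟨A, hA, hAV⟩ := hF.exists_levelPath hl h0 le_rfl hw1
  obtain ⟨P, hP, hPA⟩ := hA.exists_positivePath hl h0 hn
  refine ⟨P, hP, fun i k => ?_⟩
  rw [hPA.top_levelPath hAV]
  exact and_congr_left' ⟨fun h => le_antisymm h (hF.nonneg h0 _ _), fun h => h.le⟩

/-- Every compatible choice of segments comes from a coastline. The choice is compatible if it takes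
the base where the diagonal value vanishes, and one of the two diagonal heights elsewhere. -/
theorem exists_coastline (hl : Antitone lam) (h0 : ∀ k, 0 ≤ lam k) (hn : 0 < n)
    (hV : IsFilling n lam V) (hγ : IsContour γ V) {d : ℤ → Set ℤ} (hd : IsSegmentChoice n lam γ d)
    (hd0 : ∀ j, 0 ≤ j → 0 < wt n lam (j + 1) → V (j + 1) (j + 1) = 0 → d j = {baseHeight γ j})
    (hd1 : ∀ j, 0 ≤ j → 0 < V (j + 1) (j + 1) → j ∈ d j ∨ j + 1 ∈ d j)
    (hd2 : ∀ j, 0 ≤ j → 0 < V (j + 1) (j + 1) → d j ⊆ {j, j + 1})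
    (hd3 : ∀ j, 0 ≤ j → 0 < V (j + 1) (j + 1) → j + 1 ∈ d j → 2 * (j + 1) ≤ (n : ℤ) - 1) :
    ∃ δ, IsCoastline n lam γ δ ∧ ∀ j : ℤ, 0 ≤ j → j < numNonzero n lam → heights δ j = d j := by
  set δ : (ladder n lam).Subgraph := sSup {P | IsPositivePath n lam P ∧ ∀ j, heights P j ⊆ d j}
    with hδ
  -- paths that take the upper choice exactly at the diagonal boxes in `I`
  have hpath : ∀ I : Set ℤ, 0 < wt n lam 1 →
      (∀ i ∈ I, 1 ≤ i ∧ 0 < V i i ∧ i ∈ d (i - 1)) →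
      (∀ i, 1 ≤ i → 0 < V i i → i ∉ I → i - 1 ∈ d (i - 1)) →
      ∀ i y, 0 < wt n lam i → 1 ≤ i → (V i i = 0 → y = baseHeight γ (i - 1)) →
      (0 < V i i → i ∈ I → y = i) → (0 < V i i → i ∉ I → y = i - 1) → y ∈ heights δ (i - 1) := by
    intro I hw1 hI hI' i y hwi hi hy0 hy1 hy2
    obtain ⟨P, hP, hPt⟩ := exists_path_zeroDiag hl h0 hn hw1 hV (I := I) (fun i hi => by
      obtain ⟨h1, h2, h3⟩ := hI i hi
      have := hd3 (i - 1) (by omega) (by rwa [show i - 1 + 1 = i by ring])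
        (by rwa [show i - 1 + 1 = i by ring])
      exact ⟨h1, by omega⟩)
    -- the height of the path over a column
    have hkey : ∀ i, 1 ≤ i → 0 < wt n lam i → ∀ k, HasTop P i k ↔
        (V i i = 0 → k = baseHeight γ (i - 1)) ∧ (0 < V i i → i ∈ I → k = i) ∧
        (0 < V i i → i ∉ I → k = i - 1) := by
      intro i hi hwi k
      have hbs := hγ.baseHeight_spec h0 hV (j := i - 1) (by omega)
        (by rwa [show i - 1 + 1 = i by ring])
      have hbl := hγ.baseHeight_le_iff h0 hV (j := i - 1) (by omega)
        (by rwa [show i - 1 + 1 = i by ring])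
      rw [show i - 1 + 1 = i by ring] at hbs hbl
      rw [hPt]
      unfold zeroDiag
      rcases (hV.nonneg h0 i i).eq_or_lt with hz | hpos
      · have hiI : i ∉ I := fun h => by
          have := (hI i h).2.1
          rw [← hz] at this
          exact lt_irrefl _ this
        rw [if_neg (fun h => hiI h.2), if_neg (fun h => hiI h.2)]
        simp only [← hz, lt_irrefl, false_imp_iff, and_true, true_imp_iff]
        constructor
        · rintro ⟨h1, h2⟩
          refine le_antisymm ?_ ((hbl k).2 h2)
          by_contra hlt
          have := (hbl (k - 1)).1 (by omega)
          rw [show k - 1 + 1 = k by ring, h1] at this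
          exact lt_irrefl _ this
        · rintro rfl
          exact hbs
      · simp only [hpos.ne', false_imp_iff, true_and, hpos, true_imp_iff]
        by_cases hiI : i ∈ I
        · simp only [hiI, and_true, not_true, false_imp_iff, true_imp_iff]
          constructor
          · rintro ⟨h1, h2⟩
            by_contra hk
            rw [if_neg hk] at h1
            by_cases hk1 : k + 1 = i
            · rw [if_pos hk1] at h2; exact lt_irrefl _ h2
            · rw [if_neg hk1] at h2
              rcases lt_or_gt_of_ne hk with h | h
              · rw [hV.below i (k + 1) hi (by omega)] at h2
                exact lt_irrefl _ h2
              · exact absurd (hV.monotone_snd i h.le) (by rw [h1]; exact not_le.2 hpos)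
          · rintro rfl
            rw [if_pos rfl, if_neg (by omega)]
            exact ⟨rfl, hpos.trans_le (hV.le_succ_snd _ _)⟩
        · simp only [hiI, and_false, if_false, not_false_iff, true_imp_iff, false_imp_iff, true_and]
          constructor
          · rintro ⟨h1, h2⟩
            by_contra hk
            rcases lt_or_gt_of_ne hk with h | h
            · rw [hV.below i (k + 1) hi (by omega)] at h2
              exact lt_irrefl _ h2
            · exact absurd (hV.monotone_snd i (show i ≤ k by omega)) (by rw [h1]; exact not_le.2 hpos)
          · rintro rfl
            rw [hV.below i _ hi (by omega), show i - 1 + 1 = i by ring]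
            exact ⟨rfl, hpos⟩
    have hPd : ∀ j, heights P j ⊆ d j := by
      intro j k hk
      obtain ⟨hj, hw⟩ := column_of_mem_heights hl h0 hk
      obtain ⟨h1, h2, h3⟩ := (hkey (j + 1) (by omega) hw k).1 (mem_heights_iff.1 hk)
      rw [show j + 1 - 1 = j by ring] at h1 h3
      rcases (hV.nonneg h0 (j + 1) (j + 1)).eq_or_lt with hz | hpos
      · rw [hd0 j hj hw hz.symm, h1 hz.symm]; rfl
      · by_cases hjI : j + 1 ∈ I
        · have := (hI _ hjI).2.2
          rw [show j + 1 - 1 = j by ring] at this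
          rwa [h2 hpos hjI]
        · have := hI' (j + 1) (by omega) hpos hjI
          rw [show j + 1 - 1 = j by ring] at this
          rwa [h3 hpos hjI]
    rw [mem_heights_iff, show i - 1 + 1 = i by ring, HasTop, hδ, SimpleGraph.Subgraph.sSup_adj]
    exact ⟨P, ⟨hP, hPd⟩, (hkey i hi hwi y).2 ⟨hy0, hy1, hy2⟩⟩
  have hsub : ∀ j : ℤ, 0 ≤ j → j < numNonzero n lam → d j ⊆ heights δ j := by
    intro j hj hjN y hy
    have hw := (lt_numNonzero_iff_wt hl h0 hj).1 hjN
    have hw1 : 0 < wt n lam 1 := hw.trans_le (wt_antitone hl h0 (by omega))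
    have hj1 : 1 ≤ j + 1 := by omega
    have h1 := hpath {i | 1 ≤ i ∧ 0 < V i i ∧ i ∈ d (i - 1) ∧ i - 1 ∉ d (i - 1)} hw1
      (fun i hi => ⟨hi.1, hi.2.1, hi.2.2.1⟩)
      (fun i hi hpos hno => by
        by_contra h
        have := hd1 (i - 1) (by omega) (by rwa [show i - 1 + 1 = i by ring])
        rw [show i - 1 + 1 = i by ring] at this
        exact hno ⟨hi, hpos, this.resolve_left h, h⟩) (j + 1) y hw hj1
    have h2 := hpath {i | 1 ≤ i ∧ 0 < V i i ∧ i ∈ d (i - 1)} hw1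
      (fun i hi => hi)
      (fun i hi hpos hno => by
        have := hd1 (i - 1) (by omega) (by rwa [show i - 1 + 1 = i by ring])
        rw [show i - 1 + 1 = i by ring] at this
        exact this.resolve_right fun h => hno ⟨hi, hpos, h⟩) (j + 1) y hw hj1
    simp only [show j + 1 - 1 = j by ring, Set.mem_ofPred_eq] at h1 h2
    rcases (hV.nonneg h0 (j + 1) (j + 1)).eq_or_lt with hz | hpos
    · rw [hd0 j hj hw hz.symm, Set.mem_singleton_iff] at hy
      exact h1 (fun _ => hy) (fun h => absurd h (by rw [← hz]; exact lt_irrefl _))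
        (fun h => absurd h (by rw [← hz]; exact lt_irrefl _))
    · rcases hd2 j hj hpos hy with rfl | hy'
      · exact h1 (fun h => absurd h hpos.ne') (fun _ h => absurd hy h.2.2.2) (fun _ _ => rfl)
      · rw [Set.mem_singleton_iff] at hy'
        subst hy'
        exact h2 (fun h => absurd h hpos.ne') (fun _ _ => rfl) (fun _ h => absurd ⟨hj1, hpos, hy⟩ h)
  exact ⟨δ, ⟨d, hd, hδ, hsub⟩, fun j hj hjN => heights_sSup_eq hδ (hsub j hj hjN)⟩

end

/-! ### Points in the relative interior of the face attached to a diagram face -/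

/-- The point `u` lies in the relative interior of the face of the polytope that corresponds to `F`: the
isogram is the contour of the absolute values, and the coastline records the signs of the diagonal
coordinates, except where a full diagonal box leaves the sign open. -/
structure Represents {n : ℕ} {lam : Fin (n / 2) → ℝ} (F : DiagramFace n lam) (u : GCIndex n → ℝ) :
    Prop where
  isPoint : IsPoint n lam u
  isContour : IsContour F.isogram (absFill n lam u)
  sign : ∀ p : GCIndex n, p.1.1 = p.1.2 → u p ≠ 0 → ¬ HasFullBox F.isogram p.1.1 →
    (0 < u p ∧ heights F.coastline ((p.1.1 : ℤ) - 1) = {(p.1.1 : ℤ) - 1}) ∨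
    (u p < 0 ∧ heights F.coastline ((p.1.1 : ℤ) - 1) = {(p.1.1 : ℤ)})

section

variable {n : ℕ} {lam : Fin (n / 2) → ℝ} {u v : GCIndex n → ℝ} {F G : DiagramFace n lam}

theorem absFill_diag {p : GCIndex n} (hd : p.1.1 = p.1.2) :
    absFill n lam u p.1.1 p.1.1 = |u p| := by
  have := absFill_index (lam := lam) (u := u) p
  rwa [← hd] at this

theorem absFill_succ_snd {p q : GCIndex n} (h1 : q.1.1 = p.1.1) (h2 : q.1.2 = p.1.2 + 1) :
    absFill n lam u p.1.1 (p.1.2 + 1) = |u q| := by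
  have := absFill_index (lam := lam) (u := u) q
  rw [h1, h2] at this
  exact_mod_cast this

theorem absFill_pred_fst {p q : GCIndex n} (h1 : p.1.1 = q.1.1 + 1) (h2 : p.1.2 = q.1.2) :
    absFill n lam u (p.1.1 - 1) p.1.2 = |u q| := by
  have := absFill_index (lam := lam) (u := u) q
  rw [h1, h2]
  push_cast
  rwa [show (q.1.1 : ℤ) + 1 - 1 = q.1.1 by ring]

theorem wt_pos_of_ne (hl : Antitone lam) (h0 : ∀ k, 0 ≤ lam k) (hu : IsPoint n lam u) {p : GCIndex n}
    (h : u p ≠ 0) : 0 < wt n lam p.1.1 := by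
  have := (hu.isFilling hl h0).le_wt p.1.1 p.1.2
  rw [absFill_index] at this
  exact (abs_pos.2 h).trans_le this

theorem exists_represents (hl : Antitone lam) (h0 : ∀ k, 0 ≤ lam k) (hn : 0 < n)
    (F : DiagramFace n lam) : ∃ u, Represents F u := by
  classical
  obtain ⟨V, hV, hγ⟩ := F.isIsogram.exists_filling hl h0 hn
  set σ : GCIndex n → ℝ := fun p =>
    if p.1.1 = p.1.2 ∧ heights F.coastline ((p.1.1 : ℤ) - 1) = {(p.1.1 : ℤ)} then -1 else 1 with hσ
  obtain ⟨hu, hVu⟩ := hV.isPoint_signed h0 (σ := σ)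
    (fun p => by simp only [hσ]; split_ifs <;> simp) (fun p hp => by
      have hc : p.1.1 = p.1.2 ∧ heights F.coastline ((p.1.1 : ℤ) - 1) = {(p.1.1 : ℤ)} := by
        by_contra hc
        simp only [hσ, if_neg hc] at hp
        norm_num at hp
      refine ⟨hc.1, ?_⟩
      have hmem : (p.1.1 : ℤ) ∈ heights F.coastline ((p.1.1 : ℤ) - 1) := by rw [hc.2]; rfl
      have := add_le_of_mem hl h0 (F.coastline.adj_sub hmem).2.2
      simp only [] at this
      omega)
  have hcu : IsContour F.isogram (absFill n lam fun p => σ p * V p.1.1 p.1.2) := by rwa [hVu]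
  refine ⟨_, hu, hcu, fun p hd hne hnf => ?_⟩
  have hp := p.2
  have hw := wt_pos_of_ne hl h0 hu hne
  have hpos : 0 < V p.1.1 p.1.1 := by
    have := absFill_diag (lam := lam) (u := fun p => σ p * V p.1.1 p.1.2) hd
    rw [hVu] at this
    rw [this]
    exact abs_pos.2 hne
  have hb := (hγ.baseHeight_le_iff h0 hV (j := (p.1.1 : ℤ) - 1) (by omega)
    (by rwa [sub_add_cancel]) ((p.1.1 : ℤ) - 1)).2 (by rwa [sub_add_cancel])
  have hch := (F.isCoastline.isSegmentChoice ((p.1.1 : ℤ) - 1) (by omega)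
    ((lt_numNonzero_iff_wt hl h0 (by omega)).2 (by rwa [sub_add_cancel]))).2.2
  rw [sub_add_cancel] at hch
  rcases hch (by omega) hnf with h | h
  · left
    refine ⟨?_, h⟩
    have : ¬ (p.1.1 = p.1.2 ∧ heights F.coastline ((p.1.1 : ℤ) - 1) = {(p.1.1 : ℤ)}) := by
      rintro ⟨-, h'⟩
      rw [h, Set.singleton_eq_singleton_iff] at h'
      omega
    simp only [hσ, if_neg this, one_mul, ← hd]
    exact hpos
  · right
    refine ⟨?_, h⟩
    simp only [hσ, if_pos (And.intro hd h), neg_mul, one_mul, ← hd]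
    linarith

/-! ### Moving a point into the relative interior of its face -/

/-- Replace the vanishing diagonal coordinates by half the smaller neighbour. -/
noncomputable def perturb (n : ℕ) (lam : Fin (n / 2) → ℝ) (u : GCIndex n → ℝ) (p : GCIndex n) : ℝ :=
  if p.1.1 = p.1.2 ∧ u p = 0 then
    min (absFill n lam u p.1.1 (p.1.2 + 1)) (absFill n lam u (p.1.1 - 1) p.1.2) / 2 else u p

theorem perturb_of_ne {p : GCIndex n} (h : p.1.1 ≠ p.1.2) : perturb n lam u p = u p := by
  rw [perturb, if_neg (fun hc => h hc.1)]

theorem min_le_of_cov (h0 : ∀ k, 0 ≤ lam k) (hu : IsPoint n lam u) {p q : GCIndex n} (hc : Cov p q) :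
    min (absFill n lam u p.1.1 (p.1.2 + 1)) (absFill n lam u (p.1.1 - 1) p.1.2) ≤ u q := by
  have hq := abs_of_nonneg (hu.nonneg_of_ne h0 hc.snd_ne)
  rcases hc with ⟨h1, h2⟩ | ⟨h1, h2⟩
  · rw [absFill_succ_snd h1 h2, hq]; exact min_le_left _ _
  · rw [absFill_pred_fst h1 h2, hq]; exact min_le_right _ _

theorem min_nonneg (hl : Antitone lam) (h0 : ∀ k, 0 ≤ lam k) (hu : IsPoint n lam u) (p : GCIndex n) :
    0 ≤ min (absFill n lam u p.1.1 (p.1.2 + 1)) (absFill n lam u (p.1.1 - 1) p.1.2) :=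
  le_min ((hu.isFilling hl h0).nonneg h0 _ _) ((hu.isFilling hl h0).nonneg h0 _ _)

theorem isPoint_perturb (hl : Antitone lam) (h0 : ∀ k, 0 ≤ lam k) (hu : IsPoint n lam u) :
    IsPoint n lam (perturb n lam u) := by
  refine ⟨fun p hp => ?_, fun p q hc => ?_⟩
  · rw [perturb]
    split_ifs with h
    · obtain ⟨hd, hz⟩ := h
      have h1 := hu.outer p hp
      rw [hz] at h1
      have h2 := (hu.isFilling hl h0).outer p.1.1 (p.1.2 + 1) (by omega)
      have h3 := min_nonneg hl h0 hu p
      have h4 := min_le_left (absFill n lam u p.1.1 (p.1.2 + 1)) (absFill n lam u (p.1.1 - 1) p.1.2)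
      rw [h2, ← h1] at h4 h3
      rw [h2, ← h1]
      linarith
    · exact hu.outer p hp
  · rw [perturb_of_ne hc.snd_ne]
    have h1 := min_le_of_cov h0 hu hc
    have h2 := min_nonneg hl h0 hu p
    have h3 := hu.abs_le h0 hc
    refine diagAbs_le_iff.2 ⟨?_, fun hd => ?_⟩ <;> rw [perturb] <;> split_ifs
    · linarith
    · exact (le_abs_self _).trans h3
    · linarith
    · exact (neg_le_abs _).trans h3

theorem tightLE_perturb (hl : Antitone lam) (h0 : ∀ k, 0 ≤ lam k) (hu : IsPoint n lam u) :
    TightLE u (perturb n lam u) ∧ TightLE (perturb n lam u) u := by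
  have key : ∀ p q : GCIndex n, Cov p q → (perturb n lam u p = u q ↔ u p = u q) ∧
      (-perturb n lam u p = u q ↔ -u p = u q) := by
    intro p q hc
    have h1 := min_le_of_cov h0 hu hc
    have h2 := min_nonneg hl h0 hu p
    have h3 := hu.nonneg_of_ne h0 hc.snd_ne
    rw [perturb]
    split_ifs with h
    · rw [h.2]
      constructor <;> constructor <;> intro h4 <;> linarith
    · exact ⟨Iff.rfl, Iff.rfl⟩
  constructor
  · intro p q hc
    rw [perturb_of_ne hc.snd_ne]
    exact ⟨(key p q hc).1.2, fun _ => (key p q hc).2.2⟩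
  · intro p q hc
    rw [perturb_of_ne hc.snd_ne]
    exact ⟨(key p q hc).1.1, fun _ => (key p q hc).2.1⟩

theorem absFill_perturb_of_ne {i k : ℤ} (h : i ≠ k) :
    absFill n lam (perturb n lam u) i k = absFill n lam u i k := by
  unfold absFill
  split_ifs with h1 h2
  · rfl
  · rw [perturb_of_ne]
    simp only [boxIndex]
    omega
  · rfl
  · rfl

theorem diagGeneric_perturb (hl : Antitone lam) (h0 : ∀ k, 0 ≤ lam k) (hu : IsPoint n lam u) :
    DiagGeneric (absFill n lam (perturb n lam u)) := by
  intro i hi hz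
  rw [absFill_perturb_of_ne (by omega), absFill_perturb_of_ne (by omega)]
  have hF := hu.isFilling hl h0
  by_cases hin : 2 * i ≤ n
  · obtain ⟨p, hp1, hp2⟩ := exists_index (n := n) (i := i) (k := i) (by omega)
    have hd : p.1.1 = p.1.2 := by omega
    rw [← hp1, absFill_diag hd, abs_eq_zero, perturb] at hz
    have hle := min_nonneg hl h0 hu p
    split_ifs at hz with h
    · have hm : min (absFill n lam u p.1.1 (p.1.2 + 1)) (absFill n lam u (p.1.1 - 1) p.1.2) = 0 := by
        linarith
      rw [hp1, hp2] at hm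
      rcases min_choice (absFill n lam u i (i + 1)) (absFill n lam u (i - 1) i) with h1 | h1
      · left; rw [← h1, hm]
      · right; rw [← h1, hm]
    · exact absurd ⟨hd, hz⟩ h
  · left
    rw [hF.outer _ _ (by omega), wt_eq_zero (by omega)]

/-- Every point of the polytope shares its tight constraints with a point that represents a diagram
face. -/
theorem exists_face_of_isPoint (hl : Antitone lam) (h0 : ∀ k, 0 ≤ lam k) (hn : 0 < n)
    (hu : IsPoint n lam u) :
    ∃ (F : DiagramFace n lam) (v : GCIndex n → ℝ), Represents F v ∧ TightLE u v ∧ TightLE v u := by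
  classical
  set v := perturb n lam u with hv
  have hvP : IsPoint n lam v := isPoint_perturb hl h0 hu
  have hV := hvP.isFilling hl h0
  obtain ⟨γ, hiso, hγ⟩ := hV.exists_isogram hl h0 hn (diagGeneric_perturb hl h0 hu)
  set V := absFill n lam v with hVdef
  set neg : ℤ → Prop := fun i => ∃ p : GCIndex n, p.1.1 = p.1.2 ∧ (p.1.1 : ℤ) = i ∧ v p < 0 with hneg
  set d : ℤ → Set ℤ := fun j => if 0 < V (j + 1) (j + 1) then
    (if HasFullBox γ (j + 1) then {j, j + 1} else if neg (j + 1) then {j + 1} else {j})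
    else {baseHeight γ j} with hd
  have hdpos : ∀ j, 0 < V (j + 1) (j + 1) → d j =
      if HasFullBox γ (j + 1) then {j, j + 1} else if neg (j + 1) then {j + 1} else {j} :=
    fun j h => if_pos h
  have hdzero : ∀ j, ¬ 0 < V (j + 1) (j + 1) → d j = {baseHeight γ j} := fun j h => if_neg h
  have hchoice : IsSegmentChoice n lam γ d := by
    intro j hj hjN
    have hw := (lt_numNonzero_iff_wt hl h0 hj).1 hjN
    have hb := hγ.baseHeight_le_iff h0 hV hj hw j
    have hb1 := hγ.baseHeight_le_iff h0 hV hj hw (j + 1)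
    have hb2 := hγ.le_baseHeight h0 hV hj hw
    refine ⟨fun h => hdzero j (fun hpos => ?_), fun h => ?_, fun h hnf => ?_⟩
    · have := hb.2 hpos
      omega
    · have hpos := ((hγ.hasFullBox_iff hV (by omega)).1 h).1
      rw [hdpos j hpos, if_pos h, show baseHeight γ j = j by have := hb.2 hpos; omega]
    · by_cases hpos : 0 < V (j + 1) (j + 1)
      · rw [hdpos j hpos, if_neg hnf]
        split_ifs
        · exact Or.inr rfl
        · exact Or.inl rfl
      · right
        rw [hdzero j hpos]
        have : ¬ baseHeight γ j ≤ j := fun h => hpos (hb.1 h)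
        rw [show baseHeight γ j = j + 1 by omega]
  obtain ⟨δ, hδ, hδd⟩ := exists_coastline hl h0 hn hV hγ hchoice
    (fun j _ _ hz => hdzero j (by rw [hz]; exact lt_irrefl _))
    (fun j _ hpos => by
      rw [hdpos j hpos]
      split_ifs <;> simp)
    (fun j _ hpos => by
      rw [hdpos j hpos]
      split_ifs <;> simp)
    (fun j hj hpos hmem => by
      rw [hdpos j hpos] at hmem
      split_ifs at hmem with h1 h2
      · exact hV.two_mul_lt ((hγ.hasFullBox_iff hV (by omega)).1 h1).2.1
      · obtain ⟨p, hpd, hpi, hp⟩ := h2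
        by_contra hlt
        have hp2 := p.2
        have := hvP.outer p (by omega)
        rw [this] at hp
        exact absurd (wt_nonneg h0 _) (not_le.2 hp)
      · rw [Set.mem_singleton_iff] at hmem; omega)
  refine ⟨⟨γ, δ, hiso, hδ⟩, v, ⟨hvP, hγ, fun p hpd hne hnf => ?_⟩, (tightLE_perturb hl h0 hu).1,
    (tightLE_perturb hl h0 hu).2⟩
  have hp := p.2
  have hw := wt_pos_of_ne hl h0 hvP hne
  have hpos : 0 < V p.1.1 p.1.1 := by
    rw [hVdef, absFill_diag hpd]; exact abs_pos.2 hne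
  simp only []
  rw [hδd ((p.1.1 : ℤ) - 1) (by omega)
    ((lt_numNonzero_iff_wt hl h0 (by omega)).2 (by rwa [sub_add_cancel])),
    hdpos _ (by rwa [sub_add_cancel]), sub_add_cancel, if_neg hnf]
  rcases lt_or_gt_of_ne hne with h | h
  · right
    exact ⟨h, if_pos ⟨p, hpd, rfl, h⟩⟩
  · left
    refine ⟨h, if_neg ?_⟩
    rintro ⟨q, hq1, hq2, hq⟩
    have : q = p := Subtype.ext (Prod.ext (by omega) (by omega))
    rw [this] at hq
    linarith

/-! ### Comparison of the two orders -/

/-- An isogram is contained in a subgraph as soon as its edges are. -/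
theorem IsIsogram.le_of_edges (hl : Antitone lam) (h0 : ∀ k, 0 ≤ lam k) (hn : 0 < n)
    {γ γ' : (ladder n lam).Subgraph} (h : IsIsogram n lam γ)
    (htop : ∀ i k, HasTop γ i k → HasTop γ' i k)
    (hright : ∀ i k, HasRight γ i k → HasRight γ' i k) : γ ≤ γ' := by
  obtain ⟨⟨S, hS, rfl⟩, -, -⟩ := h
  exact sSup_le_of_edges hl h0 hn hS htop hright

theorem hasFullBox_mono {γ γ' : (ladder n lam).Subgraph} (h : γ ≤ γ') {i : ℤ} (ht : HasFullBox γ i) :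
    HasFullBox γ' i := ⟨h.2 ht.1, h.2 ht.2.1, h.2 ht.2.2.1, h.2 ht.2.2.2⟩

/-- An edge that is missing in the larger isogram forces equal values at the smaller one. -/
theorem abs_eq_of_le (hl : Antitone lam) (h0 : ∀ k, 0 ≤ lam k) (hF : Represents F u)
    (hG : Represents G v) (h : F.isogram ≤ G.isogram) {p q : GCIndex n} (hc : Cov p q)
    (he : |v p| = v q) : |u p| = u q := by
  have hU := hF.isPoint.isFilling hl h0
  have hVq := abs_of_nonneg (hG.isPoint.nonneg_of_ne h0 hc.snd_ne)
  have hUq := abs_of_nonneg (hF.isPoint.nonneg_of_ne h0 hc.snd_ne)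
  have hp := p.2
  have hq := q.2
  refine le_antisymm (hF.isPoint.abs_le h0 hc) (not_lt.1 fun hlt => ?_)
  rw [← absFill_index (lam := lam), ← hUq] at hlt
  rw [← absFill_index (lam := lam), ← hVq] at he
  rcases hc with ⟨h1, h2⟩ | ⟨h1, h2⟩
  · rw [← absFill_succ_snd (lam := lam) h1 h2] at hlt he
    have := (hG.isContour.top _ _).1 (h.2 ((hF.isContour.top _ _).2 hlt))
    exact this.ne he
  · rw [← absFill_pred_fst (lam := lam) h1 h2] at hlt he
    have hr := (hF.isContour.right ((p.1.1 : ℤ) - 1) p.1.2).2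
      ⟨by omega, by omega, by rwa [sub_add_cancel]⟩
    have := ((hG.isContour.right _ _).1 (h.2 hr)).2.2
    rw [sub_add_cancel] at this
    exact this.ne he

theorem tightLE_of_le (hl : Antitone lam) (h0 : ∀ k, 0 ≤ lam k) (hF : Represents F u)
    (hG : Represents G v) (h : F ≤ G) : TightLE v u := by
  obtain ⟨hle, hδ⟩ := h
  have hU := hF.isPoint.isFilling hl h0
  have hV := hG.isPoint.isFilling hl h0
  intro p q hc
  have huq := hF.isPoint.nonneg_of_ne h0 hc.snd_ne
  have hvq := hG.isPoint.nonneg_of_ne h0 hc.snd_ne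
  have hp := p.2
  by_cases hd : p.1.1 = p.1.2
  · by_cases hz : u p = 0
    · have key : |v p| = v q → u q = 0 := fun he => by
        rw [← abs_eq_of_le hl h0 hF hG hle hc he, hz, abs_zero]
      refine ⟨fun he => ?_, fun _ he => ?_⟩
      · rw [hz, key (by rw [he, abs_of_nonneg hvq])]
      · rw [hz, key (by rw [← abs_neg, he, abs_of_nonneg hvq]), neg_zero]
    · have hi : (1 : ℤ) ≤ p.1.1 := by omega
      have hUpos : 0 < absFill n lam u p.1.1 p.1.1 := by rw [absFill_diag hd]; exact abs_pos.2 hz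
      have hVpos := (hG.isContour.hasBottom_iff hV hi).1
        (hle.2 ((hF.isContour.hasBottom_iff hU hi).2 hUpos))
      have hvp : v p ≠ 0 := by rwa [absFill_diag hd, abs_pos] at hVpos
      have key : |v p| = v q → (0 < v p ↔ 0 < u p) := by
        intro he
        have hnf : ¬ HasFullBox G.isogram p.1.1 := by
          rw [hG.isContour.hasFullBox_iff hV hi, absFill_diag hd, he]
          rintro ⟨-, h1, h2⟩
          have hvq' := abs_of_nonneg hvq
          rcases hc with ⟨h3, h4⟩ | ⟨h3, h4⟩
          · have h5 := absFill_succ_snd (lam := lam) (u := v) h3 h4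
            rw [← hd, hvq'] at h5
            rw [h5] at h1
            exact lt_irrefl _ h1
          · have h5 := absFill_pred_fst (lam := lam) (u := v) h3 h4
            rw [← hd, hvq'] at h5
            rw [h5] at h2
            exact lt_irrefl _ h2
        have hnf' : ¬ HasFullBox F.isogram p.1.1 := fun h => hnf (hasFullBox_mono hle h)
        have hw := wt_pos_of_ne hl h0 hF.isPoint hz
        have hw' : 0 < wt n lam ((p.1.1 : ℤ) - 1 + 1) := by rwa [sub_add_cancel]
        have hb := (hF.isContour.baseHeight_le_iff h0 hU (j := (p.1.1 : ℤ) - 1) (by omega)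
          hw' ((p.1.1 : ℤ) - 1)).2 (by rwa [sub_add_cancel])
        have hsub := hδ ((p.1.1 : ℤ) - 1) (by omega)
          ((lt_numNonzero_iff_wt hl h0 (by omega)).2 hw') (by omega)
        rcases hF.sign p hd hz hnf' with ⟨h1, h2⟩ | ⟨h1, h2⟩ <;>
          rcases hG.sign p hd hvp hnf with ⟨h3, h4⟩ | ⟨h3, h4⟩
        · exact iff_of_true h3 h1
        · rw [h2, h4, Set.singleton_subset_iff, Set.mem_singleton_iff] at hsub; omega
        · rw [h2, h4, Set.singleton_subset_iff, Set.mem_singleton_iff] at hsub; omega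
        · exact iff_of_false h3.not_gt h1.not_gt
      refine ⟨fun he => ?_, fun _ he => ?_⟩
      · have habs : |v p| = v q := by rw [he, abs_of_nonneg hvq]
        have hvpos : 0 < v p := lt_of_le_of_ne (he ▸ hvq) hvp.symm
        rw [← abs_eq_of_le hl h0 hF hG hle hc habs, abs_of_pos ((key habs).1 hvpos)]
      · have habs : |v p| = v q := by rw [← abs_neg, he, abs_of_nonneg hvq]
        have hvneg : ¬ 0 < v p := by linarith
        rw [← abs_eq_of_le hl h0 hF hG hle hc habs,
          abs_of_nonpos (not_lt.1 (mt (key habs).2 hvneg))]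
  · refine ⟨fun he => ?_, fun h => absurd h hd⟩
    rw [← abs_eq_of_le hl h0 hF hG hle hc (by rw [he, abs_of_nonneg hvq]),
      abs_of_nonneg (hF.isPoint.nonneg_of_ne h0 hd)]

theorem TightLE.abs_eq (h0 : ∀ k, 0 ≤ lam k) (hu : IsPoint n lam u) (hv : IsPoint n lam v)
    (h : TightLE v u) {p q : GCIndex n} (hc : Cov p q) (he : |v p| = |v q|) : |u p| = |u q| := by
  rw [abs_of_nonneg (hv.nonneg_of_ne h0 hc.snd_ne)] at he
  have huq := hu.nonneg_of_ne h0 hc.snd_ne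
  rcases le_total 0 (v p) with hp | hp
  · rw [abs_of_nonneg hp] at he
    rw [(h p q hc).1 he]
  · rw [abs_of_nonpos hp] at he
    by_cases hd : p.1.1 = p.1.2
    · rw [← (h p q hc).2 hd he, abs_neg]
    · have : v p = 0 := le_antisymm hp (hv.nonneg_of_ne h0 hd)
      rw [(h p q hc).1 (by linarith)]

theorem TightLE.eq_zero_of_diag (h : TightLE v u) {p q : GCIndex n}
    (hc : Cov p q) (hd : p.1.1 = p.1.2) (hp : v p = 0) (hq : v q = 0) : u p = 0 := by
  have h1 := (h p q hc).1 (by rw [hp, hq])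
  have h2 := (h p q hc).2 hd (by rw [hp, hq, neg_zero])
  linarith

/-- Tightness transfers the vanishing of generic diagonal values. -/
theorem TightLE.diag_eq_zero (hl : Antitone lam) (h0 : ∀ k, 0 ≤ lam k) (hu : IsPoint n lam u)
    (hv : IsPoint n lam v) (h : TightLE v u) (hgen : DiagGeneric (absFill n lam v)) {i : ℤ}
    (hi : 1 ≤ i) (hz : absFill n lam v i i = 0) : absFill n lam u i i = 0 := by
  have hU := hu.isFilling hl h0
  have hV := hv.isFilling hl h0
  by_cases hin : (n : ℤ) ≤ 2 * i
  · rw [hU.outer i i (by omega), ← hV.outer i i (by omega), hz]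
  · obtain ⟨p, hp1, hp2⟩ := exists_index (n := n) (i := i) (k := i) (by omega)
    have hd : p.1.1 = p.1.2 := by omega
    have hz' := hz
    rw [← hp1, absFill_diag hd, abs_eq_zero] at hz ⊢
    rcases hgen i hi hz' with h1 | h1
    · obtain ⟨q, hq1, hq2, hc⟩ := exists_cov (p := p) (by omega)
      have h2 := absFill_succ_snd (lam := lam) (u := v) hq1 hq2
      rw [hp1, hp2, h1, eq_comm, abs_eq_zero] at h2
      exact h.eq_zero_of_diag hc hd hz h2
    · by_cases hi1 : i = 1
      · rw [hV.left _ _ (by omega)] at h1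
        have := hU.le_wt_one p.1.1 p.1.2
        rw [absFill_index, h1] at this
        exact abs_eq_zero.1 (le_antisymm this (abs_nonneg _))
      · obtain ⟨q, hq1, hq2⟩ := exists_index (n := n) (i := i - 1) (k := i) (by omega)
        have h2 := absFill_index (lam := lam) (u := v) q
        rw [hq1, hq2, h1, eq_comm, abs_eq_zero] at h2
        exact h.eq_zero_of_diag (Or.inr ⟨by omega, by omega⟩) hd hz h2

theorem TightLE.top_eq (hl : Antitone lam) (h0 : ∀ k, 0 ≤ lam k) (hu : IsPoint n lam u)
    (hv : IsPoint n lam v) (h : TightLE v u) (hgen : DiagGeneric (absFill n lam v)) {i k : ℤ}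
    (he : absFill n lam v i k = absFill n lam v i (k + 1)) :
    absFill n lam u i k = absFill n lam u i (k + 1) := by
  have hU := hu.isFilling hl h0
  have hV := hv.isFilling hl h0
  by_cases hi : i ≤ 0
  · rw [hU.left _ _ hi, hU.left _ _ hi]
  · by_cases hk : k < i
    · by_cases hk1 : k + 1 < i
      · rw [hU.below _ _ (by omega) hk, hU.below _ _ (by omega) hk1]
      · obtain rfl : i = k + 1 := by omega
        rw [hV.below _ _ (by omega) hk] at he
        rw [hU.below _ _ (by omega) hk, h.diag_eq_zero hl h0 hu hv hgen (by omega) he.symm]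
    · by_cases hs : (n : ℤ) ≤ i + k
      · rw [hU.outer _ _ hs, hU.outer _ _ (by omega)]
      · obtain ⟨p, rfl, rfl⟩ := exists_index (n := n) (i := i) (k := k) (by omega)
        obtain ⟨q, hq1, hq2, hc⟩ := exists_cov (p := p) (by omega)
        rw [absFill_index, absFill_succ_snd hq1 hq2] at he ⊢
        exact h.abs_eq h0 hu hv hc he

theorem TightLE.right_eq (hl : Antitone lam) (h0 : ∀ k, 0 ≤ lam k) (hu : IsPoint n lam u)
    (hv : IsPoint n lam v) (h : TightLE v u) (hgen : DiagGeneric (absFill n lam v)) {i k : ℤ}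
    (hs : i + k ≤ (n : ℤ) - 1)
    (he : absFill n lam v (i + 1) k = absFill n lam v i k) :
    absFill n lam u (i + 1) k = absFill n lam u i k := by
  have hU := hu.isFilling hl h0
  have hV := hv.isFilling hl h0
  by_cases hi : i + 1 ≤ 0
  · rw [hU.left _ _ hi, hU.left _ _ (by omega)]
  · by_cases hi0 : i = 0
    · -- the values above a box with value `λ_1` in the first column are all equal to `λ_1`
      subst hi0
      rw [hV.left 0 _ le_rfl] at he
      have hup : ∀ m : ℕ, absFill n lam u (0 + 1) k = absFill n lam u (0 + 1) (k + m) := by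
        intro m
        induction m with
        | zero => simp
        | succ m ih =>
          rw [ih]
          push_cast
          rw [← add_assoc]
          refine h.top_eq hl h0 hu hv hgen ?_
          have h1 := hV.monotone_snd (0 + 1) (show k ≤ k + m by omega)
          have h2 := hV.le_succ_snd (0 + 1) (k + m)
          have h3 := hV.le_wt_one (0 + 1) (k + m + 1)
          rw [he] at h1
          exact le_antisymm h2 (h3.trans h1)
      have := hup (n - k).toNat
      rw [this, hU.left 0 _ le_rfl, hU.outer _ _ (by omega), zero_add]
    · by_cases hk : k < i + 1
      · rw [hU.below _ _ (by omega) hk]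
        by_cases hk1 : k < i
        · rw [hU.below _ _ (by omega) hk1]
        · obtain rfl : i = k := by omega
          rw [hV.below _ _ (by omega) hk] at he
          rw [h.diag_eq_zero hl h0 hu hv hgen (by omega) he.symm]
      · obtain ⟨p, hp1, hp2⟩ := exists_index (n := n) (i := i + 1) (k := k) (by omega)
        obtain ⟨q, hq1, hq2⟩ := exists_index (n := n) (i := i) (k := k) (by omega)
        have hc : Cov p q := Or.inr ⟨by omega, by omega⟩
        rw [← hp1, ← hp2, absFill_index] at he ⊢
        rw [hp2, ← hq1, ← hq2, absFill_index] at he ⊢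
        exact h.abs_eq h0 hu hv hc he

theorem le_of_tightLE (hl : Antitone lam) (h0 : ∀ k, 0 ≤ lam k) (hn : 0 < n) (hF : Represents F u)
    (hG : Represents G v) (h : TightLE v u) : F ≤ G := by
  have hU := hF.isPoint.isFilling hl h0
  have hV := hG.isPoint.isFilling hl h0
  have hgen := hG.isContour.diagGeneric h0 hV G.isIsogram
  have hle : F.isogram ≤ G.isogram := by
    refine F.isIsogram.le_of_edges hl h0 hn (fun i k ht => ?_) (fun i k ht => ?_)
    · rw [hF.isContour.top] at ht
      rw [hG.isContour.top]
      exact lt_of_le_of_ne (hV.le_succ_snd _ _) fun he =>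
        ht.ne (h.top_eq hl h0 hF.isPoint hG.isPoint hgen he)
    · rw [hF.isContour.right] at ht
      rw [hG.isContour.right]
      exact ⟨ht.1, ht.2.1, lt_of_le_of_ne (hV.succ_fst_le _ _) fun he =>
        ht.2.2.ne (h.right_eq hl h0 hF.isPoint hG.isPoint hgen ht.2.1 he)⟩
  refine ⟨hle, fun j hj hjN hb => ?_⟩
  have hw := (lt_numNonzero_iff_wt hl h0 hj).1 hjN
  have hj1 : 1 ≤ j + 1 := by omega
  have hb' : baseHeight F.isogram j = j :=
    le_antisymm (by omega) (hF.isContour.le_baseHeight h0 hU hj hw)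
  have hUpos := (hF.isContour.baseHeight_le_iff h0 hU hj hw j).1 hb'.le
  have hVpos := (hG.isContour.hasBottom_iff hV hj1).1
    (hle.2 ((hF.isContour.hasBottom_iff hU hj1).2 hUpos))
  have hbG : baseHeight G.isogram j = j :=
    le_antisymm ((hG.isContour.baseHeight_le_iff h0 hV hj hw j).2 hVpos)
      (hG.isContour.le_baseHeight h0 hV hj hw)
  have hchF := F.isCoastline.isSegmentChoice j hj hjN
  have hchG := G.isCoastline.isSegmentChoice j hj hjN
  by_cases hfG : HasFullBox G.isogram (j + 1)
  · rw [hchG.2.1 hfG, hbG]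
    by_cases hfF : HasFullBox F.isogram (j + 1)
    · rw [hchF.2.1 hfF, hb']
    · rcases hchF.2.2 (by omega) hfF with h1 | h1 <;> rw [h1] <;> simp
  · have hfF : ¬ HasFullBox F.isogram (j + 1) := fun h => hfG (hasFullBox_mono hle h)
    have h2 := le_half_of_wt_pos hw
    obtain ⟨p, hp1, hp2⟩ := exists_index (n := n) (i := j + 1) (k := j + 1) (by omega)
    have hd : p.1.1 = p.1.2 := by omega
    have hUp : u p ≠ 0 := by
      rw [← hp1, absFill_diag hd] at hUpos; exact abs_pos.1 hUpos
    have hVp : v p ≠ 0 := by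
      rw [← hp1, absFill_diag hd] at hVpos; exact abs_pos.1 hVpos
    -- a missing edge of the diagonal box ties the two signs together
    have hsign : 0 < u p ↔ 0 < v p := by
      have key : ∀ q, Cov p q → |v p| = v q → (0 < u p ↔ 0 < v p) := by
        intro q hc he
        have huq := hF.isPoint.nonneg_of_ne h0 hc.snd_ne
        rcases lt_or_gt_of_ne hVp with hlt | hgt
        · rw [abs_of_neg hlt] at he
          have := (h p q hc).2 hd he
          exact iff_of_false (by linarith) hlt.not_gt
        · rw [abs_of_pos hgt] at he
          have := (h p q hc).1 he
          exact iff_of_true (lt_of_le_of_ne (by linarith) hUp.symm) hgt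
      by_cases hs : (n : ℤ) ≤ 2 * (j + 1)
      · have h3 := hF.isPoint.outer p (by omega)
        have h4 := hG.isPoint.outer p (by omega)
        rw [h3, h4]
      · have htop : absFill n lam v (j + 1) (j + 1) = absFill n lam v (j + 1) (j + 1 + 1) →
            (0 < u p ↔ 0 < v p) := by
          intro he
          obtain ⟨q, hq1, hq2, hc⟩ := exists_cov (p := p) (by omega)
          have h5 := absFill_succ_snd (lam := lam) (u := v) hq1 hq2
          refine key q hc ?_
          rw [hp1, hp2, ← he, ← hp1, absFill_diag hd,
            abs_of_nonneg (hG.isPoint.nonneg_of_ne h0 hc.snd_ne)] at h5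
          exact h5
        rw [hG.isContour.hasFullBox_iff hV hj1] at hfG
        by_cases ht : absFill n lam v (j + 1) (j + 1) < absFill n lam v (j + 1) (j + 1 + 1)
        · have hleft : absFill n lam v (j + 1) (j + 1) = absFill n lam v j (j + 1) := by
            have h6 := hV.succ_fst_le j (j + 1)
            refine le_antisymm h6 (not_lt.1 fun h7 => hfG ⟨hVpos, ht, ?_⟩)
            rwa [show j + 1 - 1 = j by ring]
          by_cases hj0 : j = 0
          · -- the value is already the maximal one
            rw [hleft, hV.left j _ (by omega)] at ht
            exact absurd (hV.le_wt_one _ _) (not_le.2 ht)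
          · obtain ⟨q, hq1, hq2⟩ := exists_index (n := n) (i := j) (k := j + 1) (by omega)
            have hc : Cov p q := Or.inr ⟨by omega, by omega⟩
            refine key q hc ?_
            have h5 := absFill_index (lam := lam) (u := v) q
            rw [hq1, hq2, ← hleft, ← hp1, absFill_diag hd,
              abs_of_nonneg (hG.isPoint.nonneg_of_ne h0 hc.snd_ne)] at h5
            exact h5
        · exact htop (le_antisymm (hV.le_succ_snd _ _) (not_lt.1 ht))
    have hsF := hF.sign p hd hUp (by rwa [hp1])
    have hsG := hG.sign p hd hVp (by rwa [hp1])
    rw [hp1, show j + 1 - 1 = j by ring] at hsF hsG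
    rcases hsF with ⟨h3, h4⟩ | ⟨h3, h4⟩ <;> rcases hsG with ⟨h5, h6⟩ | ⟨h5, h6⟩
    · rw [h4, h6]
    · exact absurd (hsign.1 h3) h5.not_gt
    · exact absurd (hsign.2 h5) h3.not_gt
    · rw [h4, h6]

theorem DiagramFace.antisymm (hl : Antitone lam) (h0 : ∀ k, 0 ≤ lam k) (hn : 0 < n)
    (h1 : F ≤ G) (h2 : G ≤ F) : F = G := by
  obtain ⟨γ, δ, hγ, hδ⟩ := F
  obtain ⟨γ', δ', hγ', hδ'⟩ := G
  obtain rfl : γ = γ' := le_antisymm h1.1 h2.1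
  obtain ⟨V, hV, hc⟩ := hγ.exists_filling hl h0 hn
  have hh : ∀ j : ℤ, 0 ≤ j → j < numNonzero n lam → heights δ j = heights δ' j := by
    intro j hj hjN
    have hw := (lt_numNonzero_iff_wt hl h0 hj).1 hjN
    rcases lt_trichotomy (baseHeight γ j) (j + 1) with hb | hb | hb
    · exact subset_antisymm (h1.2 j hj hjN hb) (h2.2 j hj hjN hb)
    · rw [hδ.heights_eq_of_base hl h0 hγ hV hc hj hw hb, hδ'.heights_eq_of_base hl h0 hγ hV hc hj hw hb]
    · rw [(hδ.isSegmentChoice j hj hjN).1 hb, (hδ'.isSegmentChoice j hj hjN).1 hb]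
  obtain rfl : δ = δ' := by
    rw [hδ.eq_sSup hl h0, hδ'.eq_sSup hl h0]
    congr 1
    ext P
    refine and_congr_right fun _ => forall_congr' fun j => forall_congr' fun hj =>
      forall_congr' fun hjN => ?_
    rw [hh j hj hjN]
  rfl

end

/-! ### Regions of an isogram and the dimension of a face -/

/-- The boxes of the ladder diagram, that is, the coordinates that are not constant on the polytope. -/
def FreeBox (n : ℕ) (lam : Fin (n / 2) → ℝ) (s : ℤ × ℤ) : Prop :=
  1 ≤ s.1 ∧ s.1 ≤ s.2 ∧ wt n lam (n - s.2) < wt n lam s.1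

/-- The sign of a coordinate, counting zero as positive. -/
noncomputable def coordSign {n : ℕ} (u : GCIndex n → ℝ) (p : GCIndex n) : ℝ := if u p < 0 then -1 else 1

open Classical in
/-- The coordinates of `w`, multiplied by the signs of those of `u`, as a function on all boxes that
vanishes outside the polytope. -/
noncomputable def signedFill {n : ℕ} (u w : GCIndex n → ℝ) (s : ℤ × ℤ) : ℝ :=
  if h : 1 ≤ s.1 ∧ s.1 ≤ s.2 ∧ s.1 + s.2 ≤ n then
    coordSign u (boxIndex n s.1 s.2 h) * w (boxIndex n s.1 s.2 h) else 0

/-- The box of a coordinate. -/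
def GCIndex.box {n : ℕ} (p : GCIndex n) : ℤ × ℤ := (p.1.1, p.1.2)

section

variable {n : ℕ} {lam : Fin (n / 2) → ℝ} {γ : (ladder n lam).Subgraph} {u w : GCIndex n → ℝ}

theorem FreeBox.add_lt (hl : Antitone lam) (h0 : ∀ k, 0 ≤ lam k) {s : ℤ × ℤ}
    (h : FreeBox n lam s) : s.1 + s.2 < n := by
  by_contra hlt
  exact absurd (wt_antitone hl h0 (show (n : ℤ) - s.2 ≤ s.1 by omega)) (not_le.2 h.2.2)

theorem finite_freeBox (hl : Antitone lam) (h0 : ∀ k, 0 ≤ lam k) :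
    {s | FreeBox n lam s}.Finite := by
  refine (Set.finite_Icc ((1, 1) : ℤ × ℤ) (n, n)).subset fun s hs => ?_
  have h1 := hs.add_lt hl h0
  have h2 := hs.1
  have h3 := hs.2.1
  exact ⟨⟨h2, by simp only []; omega⟩, ⟨by simp only []; omega, by simp only []; omega⟩⟩

theorem boxGraph_adj_up {i k : ℤ} (h : ¬ HasTop γ i k) : (boxGraph γ).Adj (i, k) (i, k + 1) := by
  rw [boxGraph, SimpleGraph.fromRel_adj]
  exact ⟨by simp, Or.inl (Or.inl ⟨rfl, h⟩)⟩

theorem boxGraph_adj_right {i k : ℤ} (h : ¬ HasRight γ i k) : (boxGraph γ).Adj (i, k) (i + 1, k) := by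
  rw [boxGraph, SimpleGraph.fromRel_adj]
  exact ⟨by simp, Or.inl (Or.inr ⟨rfl, h⟩)⟩

/-- A box outside the ladder diagram can be joined to infinity without crossing the diagram: to the
right below the diagonal, to the left of the diagram, and upwards above the diagram. -/
theorem infinite_supp_of_not_freeBox (hl : Antitone lam) (h0 : ∀ k, 0 ≤ lam k) {s : ℤ × ℤ}
    (hs : ¬ FreeBox n lam s) : ((boxGraph γ).connectedComponentMk s).supp.Infinite := by
  obtain ⟨i, k⟩ := s
  have hvertex : ∀ {p q : ℤ × ℤ}, γ.Adj p q → 0 ≤ p.1 ∧ p.1 ≤ p.2 + 1 ∧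
      0 ≤ q.1 ∧ wt n lam (n - q.2) < wt n lam q.1 := fun h => by
    have h1 := (mem_ladderVertices_iff hl h0 _).1 (γ.adj_sub h).2.1
    have h2 := (mem_ladderVertices_iff hl h0 _).1 (γ.adj_sub h).2.2
    exact ⟨h1.1, h1.2.2.1, h2.1, h2.2.2.2⟩
  have hmem : ∀ t, (boxGraph γ).Reachable (i, k) t →
      t ∈ ((boxGraph γ).connectedComponentMk (i, k)).supp := fun t h => by
    rw [SimpleGraph.ConnectedComponent.mem_supp_iff, SimpleGraph.ConnectedComponent.eq]
    exact h.symm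
  by_cases hi : i ≤ 0
  · refine Set.infinite_of_injective_forall_mem (f := fun m : ℕ => ((i - m, k) : ℤ × ℤ))
      (fun a b h => by simp only [Prod.mk.injEq] at h; omega) fun m => hmem _ ?_
    induction m with
    | zero => simp
    | succ m ih =>
      refine ih.trans (SimpleGraph.Adj.reachable ?_)
      have := boxGraph_adj_right (γ := γ) (i := i - (m + 1 : ℕ)) (k := k) fun h => by
        have := (hvertex h).1
        simp only [] at this
        omega
      rw [show i - ((m + 1 : ℕ) : ℤ) + 1 = i - m by push_cast; ring] at this
      exact this.symm
  · by_cases hk : k < i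
    · refine Set.infinite_of_injective_forall_mem (f := fun m : ℕ => ((i + m, k) : ℤ × ℤ))
        (fun a b h => by simp only [Prod.mk.injEq] at h; omega) fun m => hmem _ ?_
      induction m with
      | zero => simp
      | succ m ih =>
        refine ih.trans (SimpleGraph.Adj.reachable ?_)
        have := boxGraph_adj_right (γ := γ) (i := i + m) (k := k) fun h => by
          have := (hvertex h).2.1
          simp only [] at this
          omega
        rw [show i + (m : ℤ) + 1 = i + (m + 1 : ℕ) by push_cast; ring] at this
        exact this
    · have hw : wt n lam i ≤ wt n lam (n - k) := by
        by_contra h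
        exact hs ⟨by simp only []; omega, by simp only []; omega, not_le.1 h⟩
      refine Set.infinite_of_injective_forall_mem (f := fun m : ℕ => ((i, k + m) : ℤ × ℤ))
        (fun a b h => by simp only [Prod.mk.injEq] at h; omega) fun m => hmem _ ?_
      induction m with
      | zero => simp
      | succ m ih =>
        refine ih.trans (SimpleGraph.Adj.reachable ?_)
        have := boxGraph_adj_up (γ := γ) (i := i) (k := k + m) fun h => by
          have h1 := (hvertex h).2.2.2
          simp only [] at h1
          have h2 := wt_antitone hl h0 (show (n : ℤ) - (k + m) ≤ n - k by omega)
          linarith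
        rw [show k + (m : ℤ) + 1 = k + (m + 1 : ℕ) by push_cast; ring] at this
        exact this

theorem finite_supp_iff (hl : Antitone lam) (h0 : ∀ k, 0 ≤ lam k)
    (c : (boxGraph γ).ConnectedComponent) : c.supp.Finite ↔ ∀ s ∈ c.supp, FreeBox n lam s := by
  constructor
  · intro h s hs
    by_contra hno
    rw [SimpleGraph.ConnectedComponent.mem_supp_iff] at hs
    exact infinite_supp_of_not_freeBox hl h0 hno (hs ▸ h)
  · intro h
    exact (finite_freeBox hl h0).subset h

theorem coordSign_eq_one {p : GCIndex n} (h : 0 ≤ u p) : coordSign u p = 1 := if_neg h.not_gt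

theorem coordSign_mul_self (p : GCIndex n) : coordSign u p * coordSign u p = 1 := by
  unfold coordSign; split_ifs <;> norm_num

theorem coordSign_ne_zero (p : GCIndex n) : coordSign u p ≠ 0 := by
  unfold coordSign; split_ifs <;> norm_num

theorem signedFill_box (p : GCIndex n) : signedFill u w p.box = coordSign u p * w p := by
  have h := index_spec p
  unfold signedFill GCIndex.box
  rw [dif_pos h]
  simp only [boxIndex_natCast]

theorem signedFill_of_not {i k : ℤ} (h : ¬ (1 ≤ i ∧ i ≤ k ∧ i + k ≤ n)) :
    signedFill u w (i, k) = 0 := dif_neg h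

/-- Along a tight constraint the signed values agree. -/
theorem TightLE.coordSign_mul (h0 : ∀ k, 0 ≤ lam k) (hu : IsPoint n lam u) (h : TightLE u w)
    {p q : GCIndex n} (hc : Cov p q) (he : |u p| = |u q|) :
    coordSign u p * w p = coordSign u q * w q := by
  have hq := hu.nonneg_of_ne h0 hc.snd_ne
  rw [coordSign_eq_one hq, one_mul]
  rw [abs_of_nonneg hq] at he
  by_cases hp : u p < 0
  · have hd : p.1.1 = p.1.2 := by
      by_contra hd
      exact absurd (hu.nonneg_of_ne h0 hd) (not_le.2 hp)
    rw [abs_of_neg hp] at he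
    rw [coordSign, if_pos hp, neg_one_mul]
    exact (h p q hc).2 hd he
  · rw [abs_of_nonneg (not_lt.1 hp)] at he
    rw [coordSign_eq_one (not_lt.1 hp), one_mul]
    exact (h p q hc).1 he

/-- A direction of the face vanishes at the coordinates whose value is the largest possible. -/
theorem eq_zero_of_eq_wt (hl : Antitone lam) (h0 : ∀ k, 0 ≤ lam k) (hu : IsPoint n lam u)
    (hw : ∀ p : GCIndex n, p.1.1 + p.1.2 = n → w p = 0) (h : TightLE u w) :
    ∀ (m : ℕ) (p : GCIndex n), p.1.1 + p.1.2 + m = n → |u p| = wt n lam p.1.1 → w p = 0 := by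
  have hF := hu.isFilling hl h0
  intro m
  induction m with
  | zero => intro p hp _; exact hw p hp
  | succ m ih =>
    intro p hp he
    obtain ⟨q, hq1, hq2, hc⟩ := exists_cov (p := p) (by omega)
    have hqe : |u q| = wt n lam q.1.1 := by
      refine le_antisymm ?_ ?_
      · rw [← absFill_index (lam := lam)]; exact hF.le_wt _ _
      · rw [hq1, ← he]
        exact (hu.abs_le h0 hc).trans (le_abs_self _)
    have hq0 := ih q (by omega) hqe
    have := h.coordSign_mul h0 hu hc (by rw [he, hqe, hq1])
    rw [hq0, mul_zero] at this
    exact (mul_eq_zero.1 this).resolve_left (coordSign_ne_zero p)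

theorem eq_zero_of_not_freeBox (hl : Antitone lam) (h0 : ∀ k, 0 ≤ lam k) (hu : IsPoint n lam u)
    (hw : ∀ p : GCIndex n, p.1.1 + p.1.2 = n → w p = 0) (h : TightLE u w) {p : GCIndex n}
    (hp : ¬ FreeBox n lam p.box) : w p = 0 := by
  have hF := hu.isFilling hl h0
  have hs := index_spec p
  have h1 : wt n lam p.1.1 ≤ wt n lam (n - p.1.2) := by
    by_contra hlt
    exact hp ⟨hs.1, hs.2.1, not_le.1 hlt⟩
  refine eq_zero_of_eq_wt hl h0 hu hw h (n - (p.1.1 + p.1.2)) p (by omega) ?_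
  rw [← absFill_index (lam := lam)]
  exact le_antisymm (hF.le_wt _ _) (h1.trans (hF.wt_le (by omega)))

theorem eq_zero_of_diag (hl : Antitone lam) (h0 : ∀ k, 0 ≤ lam k) (hu : IsPoint n lam u)
    (hgen : DiagGeneric (absFill n lam u))
    (hw : ∀ p : GCIndex n, p.1.1 + p.1.2 = n → w p = 0) (h : TightLE u w) {p : GCIndex n}
    (hd : p.1.1 = p.1.2) (hp : u p = 0) : w p = 0 := by
  have hF := hu.isFilling hl h0
  have hs := index_spec p
  by_cases hn2 : p.1.1 + p.1.2 = n
  · exact hw p hn2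
  · rcases hgen p.1.1 hs.1 (by rw [absFill_diag hd, hp, abs_zero]) with h1 | h1
    · obtain ⟨q, hq1, hq2, hc⟩ := exists_cov (p := p) (by omega)
      have h2 := absFill_succ_snd (lam := lam) (u := u) hq1 hq2
      rw [← hd, h1, eq_comm, abs_eq_zero] at h2
      exact h.eq_zero_of_diag hc hd hp h2
    · by_cases hi : p.1.1 = 1
      · rw [hF.left _ _ (by omega)] at h1
        refine eq_zero_of_eq_wt hl h0 hu hw h (n - (p.1.1 + p.1.2)) p (by omega) ?_
        rw [hp, abs_zero, hi]
        exact h1.symm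
      · obtain ⟨q, hq1, hq2⟩ := exists_index (n := n) (i := (p.1.1 : ℤ) - 1) (k := p.1.1) (by omega)
        have h2 := absFill_index (lam := lam) (u := u) q
        rw [hq1, hq2, h1, eq_comm, abs_eq_zero] at h2
        exact h.eq_zero_of_diag (Or.inr ⟨by omega, by omega⟩) hd hp h2

/-- A direction of the face is, up to the signs, constant on the regions of the isogram. -/
theorem signedFill_eq_of_adj (hl : Antitone lam) (h0 : ∀ k, 0 ≤ lam k) (hu : IsPoint n lam u)
    (hγ : IsContour γ (absFill n lam u)) (hgen : DiagGeneric (absFill n lam u))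
    (hw : ∀ p : GCIndex n, p.1.1 + p.1.2 = n → w p = 0) (h : TightLE u w) {s t : ℤ × ℤ}
    (hst : (boxGraph γ).Adj s t) : signedFill u w s = signedFill u w t := by
  have hF := hu.isFilling hl h0
  have hbox : ∀ p : GCIndex n, w p = 0 → signedFill u w (p.1.1, p.1.2) = 0 := fun p hp => by
    have := signedFill_box (u := u) (w := w) p
    rwa [hp, mul_zero] at this
  have hup : ∀ i k, ¬ HasTop γ i k → signedFill u w (i, k) = signedFill u w (i, k + 1) := by
    intro i k ht
    have he : absFill n lam u i k = absFill n lam u i (k + 1) :=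
      le_antisymm (hF.le_succ_snd _ _) (not_lt.1 fun hlt => ht ((hγ.top _ _).2 hlt))
    by_cases hs : 1 ≤ i ∧ i ≤ k ∧ i + k ≤ n
    · obtain ⟨p, rfl, rfl⟩ := exists_index hs
      by_cases hs2 : p.1.1 + p.1.2 < n
      · obtain ⟨q, hq1, hq2, hc⟩ := exists_cov hs2
        rw [absFill_index, absFill_succ_snd hq1 hq2] at he
        have h1 := signedFill_box (u := u) (w := w) p
        have h2 := signedFill_box (u := u) (w := w) q
        rw [GCIndex.box] at h1 h2
        rw [hq1, hq2] at h2
        push_cast at h2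
        rw [h1, h2]
        exact h.coordSign_mul h0 hu hc he
      · rw [hbox p (hw p (by omega)), signedFill_of_not (by omega)]
    · rw [signedFill_of_not hs]
      by_cases hs2 : 1 ≤ i ∧ i ≤ k + 1 ∧ i + (k + 1) ≤ n
      · -- the bottom edge of a diagonal box
        obtain ⟨p, hp1, hp2⟩ := exists_index hs2
        rw [← hp1, ← hp2, hbox]
        refine eq_zero_of_diag hl h0 hu hgen hw h (by omega) ?_
        rw [hF.below i k (by omega) (by omega), ← hp1, ← hp2, absFill_index, eq_comm,
          abs_eq_zero] at he
        exact he
      · rw [signedFill_of_not hs2]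
  have hright : ∀ i k, ¬ HasRight γ i k → signedFill u w (i, k) = signedFill u w (i + 1, k) := by
    intro i k ht
    have he : 1 ≤ k → i + k ≤ (n : ℤ) - 1 → absFill n lam u (i + 1) k = absFill n lam u i k :=
      fun hk hik => le_antisymm (hF.succ_fst_le _ _)
        (not_lt.1 fun hlt => ht ((hγ.right _ _).2 ⟨hk, hik, hlt⟩))
    by_cases hs : 1 ≤ i ∧ i ≤ k ∧ i + k ≤ n
    · obtain ⟨q, hq1, hq2⟩ := exists_index hs
      by_cases hs2 : i + 1 ≤ k ∧ i + k < n
      · obtain ⟨p, hp1, hp2⟩ := exists_index (n := n) (i := i + 1) (k := k) (by omega)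
        have he' := he (by omega) (by omega)
        have h1 := absFill_index (lam := lam) (u := u) p
        have h2 := absFill_index (lam := lam) (u := u) q
        rw [hp1, hp2] at h1
        rw [hq1, hq2] at h2
        rw [h1, h2] at he'
        have h3 := signedFill_box (u := u) (w := w) p
        have h4 := signedFill_box (u := u) (w := w) q
        rw [GCIndex.box, hp1, hp2] at h3
        rw [GCIndex.box, hq1, hq2] at h4
        rw [h3, h4]
        exact (h.coordSign_mul h0 hu (Or.inr ⟨by omega, by omega⟩) he').symm
      · rw [signedFill_of_not (i := i + 1) (by omega), ← hq1, ← hq2, hbox]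
        by_cases hik : i + k = n
        · exact hw q (by omega)
        · refine eq_zero_of_diag hl h0 hu hgen hw h (by omega) ?_
          have he' := he (by omega) (by omega)
          rw [hF.below (i + 1) k (by omega) (by omega), ← hq1, ← hq2, absFill_index, eq_comm,
            abs_eq_zero] at he'
          exact he'
    · rw [signedFill_of_not hs]
      by_cases hs2 : 1 ≤ i + 1 ∧ i + 1 ≤ k ∧ i + 1 + k ≤ n
      · -- the left boundary of the diagram
        obtain ⟨p, hp1, hp2⟩ := exists_index hs2
        obtain rfl : i = 0 := by omega
        rw [← hp1, ← hp2, hbox]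
        have he' := he (by omega) (by omega)
        rw [hF.left 0 _ le_rfl, ← hp1, ← hp2, absFill_index] at he'
        refine eq_zero_of_eq_wt hl h0 hu hw h (n - (p.1.1 + p.1.2)) p (by omega) ?_
        rw [he', hp1, zero_add]
      · rw [signedFill_of_not hs2]
  rw [boxGraph, SimpleGraph.fromRel_adj] at hst
  obtain ⟨-, (⟨rfl, h1⟩ | ⟨rfl, h1⟩) | (⟨rfl, h1⟩ | ⟨rfl, h1⟩)⟩ := hst
  · exact hup _ _ h1
  · exact hright _ _ h1
  · exact (hup _ _ h1).symm
  · exact (hright _ _ h1).symm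

open Classical in
/-- Extension by zero of a function on the bounded regions to all regions. -/
noncomputable def regionValue (γ : (ladder n lam).Subgraph)
    (f : {c : (boxGraph γ).ConnectedComponent // c.supp.Finite} → ℝ)
    (c : (boxGraph γ).ConnectedComponent) : ℝ := if h : c.supp.Finite then f ⟨c, h⟩ else 0

/-- The direction with prescribed values on the bounded regions of the isogram. -/
noncomputable def regionDirection (γ : (ladder n lam).Subgraph) (u : GCIndex n → ℝ) :
    ({c : (boxGraph γ).ConnectedComponent // c.supp.Finite} → ℝ) →ₗ[ℝ] (GCIndex n → ℝ) where
  toFun f p := coordSign u p * regionValue γ f ((boxGraph γ).connectedComponentMk p.box)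
  map_add' f g := by
    funext p
    simp only [Pi.add_apply, regionValue]
    split_ifs
    · ring
    · simp
  map_smul' a f := by
    funext p
    simp only [Pi.smul_apply, smul_eq_mul, RingHom.id_apply, regionValue]
    split_ifs
    · ring
    · simp

theorem regionDirection_apply (f : {c : (boxGraph γ).ConnectedComponent // c.supp.Finite} → ℝ)
    (p : GCIndex n) : regionDirection γ u f p =
      coordSign u p * regionValue γ f ((boxGraph γ).connectedComponentMk p.box) := rfl

theorem regionDirection_injective (hl : Antitone lam) (h0 : ∀ k, 0 ≤ lam k) :
    Function.Injective (regionDirection γ u) := by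
  rw [← LinearMap.ker_eq_bot, LinearMap.ker_eq_bot']
  intro f hf
  funext ⟨c, hc⟩
  obtain ⟨⟨i, k⟩, hik⟩ := c.exists_rep
  have hfree := (finite_supp_iff hl h0 _).1 hc (i, k) hik
  have hlt := hfree.add_lt hl h0
  obtain ⟨p, hp1, hp2⟩ := exists_index (n := n) (i := i) (k := k)
    ⟨hfree.1, hfree.2.1, by simp only [] at hlt; omega⟩
  have hpb : (boxGraph γ).connectedComponentMk p.box = c := by
    rw [GCIndex.box, hp1, hp2]; exact hik
  have hfp := congrFun hf p
  rw [regionDirection_apply, hpb, regionValue, dif_pos hc] at hfp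
  exact (mul_eq_zero.1 hfp).resolve_left (coordSign_ne_zero p)

theorem range_regionDirection (hl : Antitone lam) (h0 : ∀ k, 0 ≤ lam k) (hu : IsPoint n lam u)
    (hγ : IsContour γ (absFill n lam u)) (hgen : DiagGeneric (absFill n lam u)) :
    LinearMap.range (regionDirection γ u) = vectorSpan ℝ (faceAt (gcForm n) (gcBound n lam) u) := by
  have hF := hu.isFilling hl h0
  ext w
  rw [mem_vectorSpan_gcFace_iff hu, LinearMap.mem_range]
  constructor
  · rintro ⟨f, rfl⟩
    constructor
    · intro p hp
      have hnf : ¬ FreeBox n lam p.box := fun h => by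
        have := h.add_lt hl h0
        simp only [GCIndex.box] at this
        omega
      rw [regionDirection_apply, regionValue, dif_neg (infinite_supp_of_not_freeBox hl h0 hnf),
        mul_zero]
    · intro p q hc
      have hp := p.2
      have hq := q.2
      have huq := hu.nonneg_of_ne h0 hc.snd_ne
      have hcomp : |u p| = u q → (boxGraph γ).connectedComponentMk p.box =
          (boxGraph γ).connectedComponentMk q.box := by
        intro he
        rw [← abs_of_nonneg huq] at he
        rw [SimpleGraph.ConnectedComponent.eq]
        rcases hc with ⟨h1, h2⟩ | ⟨h1, h2⟩
        · have hadj := boxGraph_adj_up (γ := γ) (i := p.1.1) (k := p.1.2) (by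
            rw [hγ.top, absFill_index, absFill_succ_snd h1 h2, he]; exact lt_irrefl _)
          have hqb : q.box = ((p.1.1 : ℤ), (p.1.2 : ℤ) + 1) := by
            rw [GCIndex.box, h1, h2]; push_cast; rfl
          rw [hqb]
          exact hadj.reachable
        · have hadj := boxGraph_adj_right (γ := γ) (i := q.1.1) (k := q.1.2) (by
            rw [hγ.right]
            rintro ⟨-, -, h3⟩
            have h4 := absFill_index (lam := lam) (u := u) p
            rw [h1, h2] at h4
            push_cast at h4
            rw [h4, absFill_index, he] at h3
            exact lt_irrefl _ h3)
          have hpb : p.box = ((q.1.1 : ℤ) + 1, (q.1.2 : ℤ)) := by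
            rw [GCIndex.box, h1, h2]; push_cast; rfl
          rw [hpb]
          exact hadj.reachable.symm
      have hzero : p.1.1 = p.1.2 → u p = 0 →
          ¬ ((boxGraph γ).connectedComponentMk p.box).supp.Finite := by
        intro hd hz
        have hbot : ¬ HasTop γ p.1.1 (p.1.1 - 1) := by
          have hi : (1 : ℤ) ≤ p.1.1 := by omega
          have := (hγ.hasBottom_iff hF hi).not
          rw [absFill_diag hd, hz, abs_zero] at this
          exact this.2 (lt_irrefl _)
        have hadj := boxGraph_adj_up hbot
        rw [sub_add_cancel] at hadj
        have hpb : p.box = ((p.1.1 : ℤ), (p.1.1 : ℤ)) := by rw [GCIndex.box, ← hd]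
        rw [hpb, ← SimpleGraph.ConnectedComponent.eq.2 hadj.reachable]
        refine infinite_supp_of_not_freeBox hl h0 fun h => ?_
        have := h.2.1
        simp only [] at this
        omega
      rw [regionDirection_apply, regionDirection_apply]
      refine ⟨fun he => ?_, fun hd he => ?_⟩
      · have hup : 0 ≤ u p := he ▸ huq
        rw [hcomp (by rw [abs_of_nonneg hup, he]), coordSign_eq_one hup, coordSign_eq_one huq]
      · by_cases hz : u p = 0
        · have hcm := hcomp (by rw [← he, hz, abs_zero, neg_zero])
          rw [← hcm, regionValue, dif_neg (hzero hd hz), mul_zero, mul_zero, neg_zero]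
        · have hneg : u p < 0 := lt_of_le_of_ne (by linarith) hz
          have hs : coordSign u p = -1 := if_pos hneg
          rw [hcomp (by rw [abs_of_neg hneg, he]), hs, coordSign_eq_one huq]
          ring
  · rintro ⟨hw, h⟩
    have hadj : ∀ s t, (boxGraph γ).Adj s t → signedFill u w s = signedFill u w t :=
      fun s t => signedFill_eq_of_adj hl h0 hu hγ hgen hw h
    have hreach : ∀ s t, (boxGraph γ).connectedComponentMk s = (boxGraph γ).connectedComponentMk t →
        signedFill u w s = signedFill u w t := by
      intro s t hst
      obtain ⟨W⟩ := SimpleGraph.ConnectedComponent.eq.1 hst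
      clear hst
      induction W with
      | nil => rfl
      | cons h1 _ ih => exact (hadj _ _ h1).trans ih
    choose rep hrep using fun c : (boxGraph γ).ConnectedComponent => c.exists_rep
    refine ⟨fun c => signedFill u w (rep c.1), ?_⟩
    funext p
    rw [regionDirection_apply, regionValue]
    split_ifs with hfin
    · rw [hreach (rep ((boxGraph γ).connectedComponentMk p.box)) p.box (hrep _), signedFill_box,
        ← mul_assoc, coordSign_mul_self, one_mul]
    · -- an unbounded region reaches a box outside the diagram, where the direction vanishes
      rw [finite_supp_iff hl h0] at hfin
      push Not at hfin
      obtain ⟨⟨i, k⟩, ht, hnf⟩ := hfin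
      rw [SimpleGraph.ConnectedComponent.mem_supp_iff] at ht
      have h1 := hreach _ _ ht
      have h2 : signedFill u w (i, k) = 0 := by
        by_cases hs : 1 ≤ i ∧ i ≤ k ∧ i + k ≤ n
        · obtain ⟨q, rfl, rfl⟩ := exists_index hs
          have := signedFill_box (u := u) (w := w) q
          rw [eq_zero_of_not_freeBox hl h0 hu hw h hnf, mul_zero] at this
          exact this
        · exact signedFill_of_not hs
      rw [h2, signedFill_box] at h1
      rw [mul_zero, (mul_eq_zero.1 h1.symm).resolve_left (coordSign_ne_zero p)]

theorem finite_regions (hl : Antitone lam) (h0 : ∀ k, 0 ≤ lam k) :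
    Finite {c : (boxGraph γ).ConnectedComponent // c.supp.Finite} := by
  have := (finite_freeBox (n := n) hl h0).to_subtype
  choose rep hrep using fun c : (boxGraph γ).ConnectedComponent => c.exists_rep
  refine Finite.of_injective (β := {s | FreeBox n lam s})
    (fun c => ⟨rep c.1, (finite_supp_iff hl h0 _).1 c.2 _ (hrep c.1)⟩) fun c c' h => ?_
  simp only [Subtype.mk.injEq] at h
  exact Subtype.ext (by rw [← hrep c.1, h, hrep])

theorem finrank_vectorSpan_faceAt (hl : Antitone lam) (h0 : ∀ k, 0 ≤ lam k) {F : DiagramFace n lam}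
    (hF : Represents F u) :
    Module.finrank ℝ (vectorSpan ℝ (faceAt (gcForm n) (gcBound n lam) u)) = F.dim := by
  classical
  have hgen := hF.isContour.diagGeneric h0 (hF.isPoint.isFilling hl h0) F.isIsogram
  have := finite_regions (γ := F.isogram) hl h0
  have := Fintype.ofFinite {c : (boxGraph F.isogram).ConnectedComponent // c.supp.Finite}
  rw [← range_regionDirection hl h0 hF.isPoint hF.isContour hgen,
    LinearMap.finrank_range_of_inj (regionDirection_injective hl h0),
    Module.finrank_fintype_fun_eq_card, DiagramFace.dim, regionCount, Nat.card_eq_fintype_card]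

end

end GelfandCetlin

open GelfandCetlin in
theorem theorem3p5 (n : ℕ) (hn : 0 < n) (lam : Fin (n / 2) → ℝ)
    (hlam : Antitone lam) (hlam0 : ∀ k, 0 ≤ lam k) :
    ∃ Ψ : GelfandCetlin.DiagramFace n lam → GelfandCetlin.PolytopeFace n lam,
      Function.Bijective Ψ ∧
      (∀ F G : GelfandCetlin.DiagramFace n lam, F ≤ G ↔ Ψ F ≤ Ψ G) ∧
      (∀ F : GelfandCetlin.DiagramFace n lam, (Ψ F).dim = F.dim) := by
  choose u hu using exists_represents hlam hlam0 hn
  have hpoint : ∀ F, u F ∈ polyhedron (gcForm n) (gcBound n lam) := fun F =>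
    gcPolytope_eq_polyhedron ▸ mem_gcPolytope_iff.2 (hu F).isPoint
  have hle : ∀ F G : DiagramFace n lam, F ≤ G ↔
      faceAt (gcForm n) (gcBound n lam) (u F) ⊆ faceAt (gcForm n) (gcBound n lam) (u G) := by
    intro F G
    rw [faceAt_subset_iff (hpoint F), tight_subset_iff (hu F).isPoint]
    exact ⟨tightLE_of_le hlam hlam0 (hu F) (hu G), le_of_tightLE hlam hlam0 hn (hu F) (hu G)⟩
  refine ⟨fun F => ⟨faceAt (gcForm n) (gcBound n lam) (u F), ?_, u F, hpoint F, subset_rfl⟩,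
    ⟨fun F G h => ?_, fun f => ?_⟩, hle, fun F => finrank_vectorSpan_faceAt hlam hlam0 (hu F)⟩
  · rw [gcPolytope_eq_polyhedron]
    exact isExposed_faceAt (hpoint F)
  · have h' : faceAt (gcForm n) (gcBound n lam) (u F) = faceAt (gcForm n) (gcBound n lam) (u G) :=
      congrArg Subtype.val h
    exact DiagramFace.antisymm hlam hlam0 hn ((hle F G).2 h'.le) ((hle G F).2 h'.ge)
  · obtain ⟨f, hf, hne⟩ := f
    rw [gcPolytope_eq_polyhedron] at hf
    obtain ⟨x, hx, rfl⟩ := exists_eq_faceAt hf hne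
    have hxP : IsPoint n lam x := mem_gcPolytope_iff.1 (gcPolytope_eq_polyhedron ▸ hx)
    obtain ⟨F, v, hFv, hxv, hvx⟩ := exists_face_of_isPoint hlam hlam0 hn hxP
    -- the chosen point of `F` and `v` have the same tight constraints
    have h1 := tightLE_of_le hlam hlam0 (hu F) hFv ⟨le_rfl, fun _ _ _ _ => subset_rfl⟩
    have h2 := tightLE_of_le hlam hlam0 hFv (hu F) ⟨le_rfl, fun _ _ _ _ => subset_rfl⟩
    refine ⟨F, Subtype.ext (subset_antisymm ?_ ?_)⟩
    · rw [faceAt_subset_iff (hpoint F), tight_subset_iff (hu F).isPoint]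
      exact fun p q hc => ⟨fun h => (h1 p q hc).1 ((hxv p q hc).1 h),
        fun hd h => (h1 p q hc).2 hd ((hxv p q hc).2 hd h)⟩
    · rw [faceAt_subset_iff hx, tight_subset_iff hxP]
      exact fun p q hc => ⟨fun h => (hvx p q hc).1 ((h2 p q hc).1 h),
        fun hd h => (hvx p q hc).2 hd ((h2 p q hc).2 hd h)⟩
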